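/- **Problem.** An instance $J$ of *Diverse Multistage Perfect Matching* consists of a sequence $(G_i)_{i=1}^{\tau}$ of finite simple undirected graphs (with vertex sets $V(G_i)\subseteq\{0,\dots,n-1\}$ that may differ from each other) and an integer $\ell\in\mathbb{N}_0$. The question is whether there is a sequence $(M_i)_{i=1}^{\tau}$ of perfect matchings $M_i\subseteq E(G_i)$ such that $|M_i\,\Delta\,M_{i+1}|\ge \ell$ for all $i\in\{1,\dots,\tau-1\}$. The size $|J|$ is the length of the encoding of $J$ in which numbers are written in binary and graphs are given by the indicator vectors of their vertex sets and by their adjacency matrices. **Model.** Running time is the number of steps of a randomized random-access machine with unit-cost addition, truncated subtraction, indirect addressing and fair coin tosses, and without multiplication (which is equivalent to a randomized Turing machine up to polynomial factors). **Theorem.** Diverse Multistage Perfect Matching can be solved in $2^{O(\ell)}\cdot|J|^{O(1)}$ time with constant error probability. That is, for every constant $\varepsilon>0$ there are a randomized algorithm and constants $C,c,d\in\mathbb{N}$ such that, on every instance $J$, the algorithm halts within $C\cdot 2^{c\ell}\cdot|J|^{d}$ steps for every outcome of its coin tosses, and answers correctly whether $J$ is a yes-instance with probability at least $1-\varepsilon$.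 (This is a running time of the form $f(\ell)\cdot|J|^{O(1)}$ with computable $f$, that is, the problem is randomized fixed-parameter tractable when parameterized by $\ell$.) -/

import Mathlib

/-! ### Randomized random-access machines -/

namespace RandRAM

/-- Programs of a randomized random-access machine with unit-cost addition and (truncated)
subtraction and with no multiplication.  Registers and arrays are named by natural numbers; a
program mentions only finitely many of them.  Every register and every array cell holds a natural
number, and array cells are addressed indirectly, through the contents of a register. -/
inductive Program where
  /-- do nothing -/
  | skip : Program
  /-- `r := k` for a constant `k` -/
  | const (r k : ℕ) : Program
  /-- `r := a` -/
  | copy (r a : ℕ) : Program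
  /-- `r := a + b` -/
  | add (r a b : ℕ) : Program
  /-- `r := max (a - b) 0` -/
  | sub (r a b : ℕ) : Program
  /-- `r := A[i]` -/
  | load (r A i : ℕ) : Program
  /-- `A[i] := r` -/
  | store (A i r : ℕ) : Program
  /-- `r := ` the outcome (`0` or `1`) of a fresh fair coin toss -/
  | flip (r : ℕ) : Program
  /-- first `p`, then `q` -/
  | seq (p q : Program) : Program
  /-- if the content of `r` is nonzero then `p`, else `q` -/
  | ite (r : ℕ) (p q : Program) : Program
  /-- as long as the content of `r` is nonzero, repeat `p` -/
  | loop (r : ℕ) (p : Program) : Program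

/-- A configuration: contents of the registers, contents of the arrays, and the outcomes of the
coin tosses that have not been made yet. -/
@[ext]
structure Config where
  reg : ℕ → ℕ
  mem : ℕ → ℕ → ℕ
  coins : ℕ → Bool

/-- Overwrite the register `r` by the value `x`. -/
def Config.setReg (s : Config) (r x : ℕ) : Config :=
  { s with reg := Function.update s.reg r x }

/-- Overwrite the cell `k` of the array `A` by the value `x`. -/
def Config.setMem (s : Config) (A k x : ℕ) : Config :=
  { s with mem := Function.update s.mem A (Function.update (s.mem A) k x) }

/-- Put the outcome of the next coin toss into the register `r`. -/
def Config.toss (s : Config) (r : ℕ) : Config :=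
  { s with
    reg := Function.update s.reg r (if s.coins 0 then 1 else 0)
    coins := fun k => s.coins (k + 1) }

/-- `Runs p s t s'`: started in `s`, the program `p` halts after exactly `t` steps in `s'`.
Every elementary instruction and every test of a branching or of a loop is one step. -/
inductive Runs : Program → Config → ℕ → Config → Prop where
  | skip (s : Config) : Runs .skip s 1 s
  | const (r k : ℕ) (s : Config) : Runs (.const r k) s 1 (s.setReg r k)
  | copy (r a : ℕ) (s : Config) : Runs (.copy r a) s 1 (s.setReg r (s.reg a))
  | add (r a b : ℕ) (s : Config) : Runs (.add r a b) s 1 (s.setReg r (s.reg a + s.reg b))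
  | sub (r a b : ℕ) (s : Config) : Runs (.sub r a b) s 1 (s.setReg r (s.reg a - s.reg b))
  | load (r A i : ℕ) (s : Config) : Runs (.load r A i) s 1 (s.setReg r (s.mem A (s.reg i)))
  | store (A i r : ℕ) (s : Config) : Runs (.store A i r) s 1 (s.setMem A (s.reg i) (s.reg r))
  | flip (r : ℕ) (s : Config) : Runs (.flip r) s 1 (s.toss r)
  | seq {p q : Program} {s s' s'' : Config} {t u : ℕ} :
      Runs p s t s' → Runs q s' u s'' → Runs (.seq p q) s (t + u) s''
  | ite_true {r : ℕ} {p q : Program} {s s' : Config} {t : ℕ} :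
      s.reg r ≠ 0 → Runs p s t s' → Runs (.ite r p q) s (1 + t) s'
  | ite_false {r : ℕ} {p q : Program} {s s' : Config} {t : ℕ} :
      s.reg r = 0 → Runs q s t s' → Runs (.ite r p q) s (1 + t) s'
  | loop_false {r : ℕ} {p : Program} {s : Config} :
      s.reg r = 0 → Runs (.loop r p) s 1 s
  | loop_true {r : ℕ} {p : Program} {s s' s'' : Config} {t u : ℕ} :
      s.reg r ≠ 0 → Runs p s t s' → Runs (.loop r p) s' u s'' →
      Runs (.loop r p) s (1 + t + u) s''

/-- Once the coin tosses are fixed, the machine is deterministic: the number of steps and the final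
configuration are determined by the program and the initial configuration. -/
theorem Runs.deterministic {p : Program} {s s₁ s₂ : Config} {t₁ t₂ : ℕ}
    (h₁ : Runs p s t₁ s₁) (h₂ : Runs p s t₂ s₂) : t₁ = t₂ ∧ s₁ = s₂ := by
  induction h₁ generalizing t₂ s₂ with
  | seq _ _ ih ih' =>
    cases h₂ with
    | seq a b =>
      obtain ⟨rfl, rfl⟩ := ih a
      obtain ⟨rfl, rfl⟩ := ih' b
      exact ⟨rfl, rfl⟩
  | ite_true h _ ih =>
    cases h₂ with
    | ite_true _ a => obtain ⟨rfl, rfl⟩ := ih a; exact ⟨rfl, rfl⟩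
    | ite_false h' _ => exact absurd h' h
  | ite_false h _ ih =>
    cases h₂ with
    | ite_true h' _ => exact absurd h h'
    | ite_false _ a => obtain ⟨rfl, rfl⟩ := ih a; exact ⟨rfl, rfl⟩
  | loop_false h =>
    cases h₂ with
    | loop_false _ => exact ⟨rfl, rfl⟩
    | loop_true h' _ _ => exact absurd h h'
  | loop_true h _ _ ih ih' =>
    cases h₂ with
    | loop_false h' => exact absurd h' h
    | loop_true _ a b =>
      obtain ⟨rfl, rfl⟩ := ih a
      obtain ⟨rfl, rfl⟩ := ih' b
      exact ⟨rfl, rfl⟩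
  | _ => cases h₂; exact ⟨rfl, rfl⟩

/-- The initial configuration: the input `x` stands in the array `0`, everything else is `0`. -/
def initial (x : List ℕ) (ω : ℕ → Bool) : Config where
  reg := fun _ => 0
  mem := fun A k => if A = 0 then x.getD k 0 else 0
  coins := ω

/-- The size of an input: its total length when its entries are written in binary, with one
separator symbol per entry. -/
def inputSize (x : List ℕ) : ℕ :=
  (x.map fun a => a.size + 1).sum

/-- The law of an infinite sequence of independent fair coin tosses. -/
noncomputable def fairCoins : MeasureTheory.Measure (ℕ → Bool) :=
  MeasureTheory.Measure.infinitePi fun _ => (PMF.uniformOfFintype Bool).toMeasure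

/-- With the coin tosses `ω`, the program `p` halts on the input `x` within `T` steps. -/
def HaltsWithin (p : Program) (x : List ℕ) (ω : ℕ → Bool) (T : ℕ) : Prop :=
  ∃ t ≤ T, ∃ s, Runs p (initial x ω) t s

/-- With the coin tosses `ω`, the program `p` halts on the input `x` with output `b`, which is the
final content of the register `0`. -/
def Outputs (p : Program) (x : List ℕ) (ω : ℕ → Bool) (b : ℕ) : Prop :=
  ∃ t s, Runs p (initial x ω) t s ∧ s.reg 0 = b

open Classical in
/-- The program `p` solves the decision problem with instances `ι`, encoding `code` and
yes-instances `Yes`, in time `T` and with error probability (at most) `ε`: on every instance `J` it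
halts within `T J` steps, whatever the coin tosses are, and with probability at least `1 - ε` it
returns the correct answer (`1` for yes, `0` for no). -/
def Solves {ι : Type} (p : Program) (code : ι → List ℕ) (Yes : ι → Prop) (T : ι → ℕ) (ε : ℝ) :
    Prop :=
  ∀ J : ι, (∀ ω, HaltsWithin p (code J) ω (T J)) ∧
    1 - ε ≤ fairCoins.real {ω | Outputs p (code J) ω (if Yes J then 1 else 0)}

end RandRAM

/-! ### Diverse Multistage Perfect Matching -/

namespace DiverseMatching

/-- A simple undirected graph whose vertex set is a subset of `{0, …, n - 1}`. -/
abbrev Graph (n : ℕ) := (⊤ : SimpleGraph (Fin n)).Subgraph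

/-- `M`, given as a subgraph, is a perfect matching of `G`: it consists of edges of `G`, and every
vertex of `G` lies on exactly one edge of `M`. -/
def IsPerfectMatchingOf {n : ℕ} (M G : Graph n) : Prop :=
  M ≤ G ∧ M.verts = G.verts ∧ M.IsMatching

/-- An instance: a sequence of `τ` graphs, whose vertex sets are subsets of `{0, …, n - 1}` and may
differ from each other, and the required diversity `ℓ`. -/
structure Instance where
  n : ℕ
  τ : ℕ
  ℓ : ℕ
  G : Fin τ → Graph n

/-- There are perfect matchings of the graphs of `J` such that the edge sets of any two consecutive
ones have a symmetric difference of size at least `ℓ`. -/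
def Instance.IsYes (J : Instance) : Prop :=
  ∃ M : Fin J.τ → Graph J.n,
    (∀ i, IsPerfectMatchingOf (M i) (J.G i)) ∧
    ∀ i j : Fin J.τ, (j : ℕ) = i + 1 → J.ℓ ≤ (symmDiff (M i).edgeSet (M j).edgeSet).ncard

open Classical in
/-- A graph is encoded by `n`, the indicator vector of its vertex set, and its adjacency matrix, row
by row. -/
noncomputable def graphCode {n : ℕ} (G : Graph n) : List ℕ :=
  n :: ((List.ofFn fun v : Fin n => if v ∈ G.verts then 1 else 0) ++
    (List.ofFn fun u : Fin n => List.ofFn fun v : Fin n => if G.Adj u v then 1 else 0).flatten)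

/-- An instance is encoded by `ℓ`, `τ`, and the codes of its graphs, one after the other. -/
noncomputable def Instance.code (J : Instance) : List ℕ :=
  J.ℓ :: J.τ :: (List.ofFn fun i => graphCode (J.G i)).flatten

/-- The size `|J|` of an instance `J`. -/
noncomputable def Instance.size (J : Instance) : ℕ := RandRAM.inputSize J.code

end DiverseMatching

/-!
The algorithm combines colour coding, an algebraic test for perfect matchings, and dynamic
programming over the stages.

*Certifying diversity.*  Colour all pairs of vertices with `k` colours, where `3 ℓ ≤ k ≤ 6 ℓ`, and let
the signature of a matching be the vector of the numbers of its edges of each colour, modulo `3`.  Two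
matchings whose signatures are at Hamming distance at least `ℓ` differ in at least `ℓ` edges
(`hammingDist_signature_le`).  Conversely, if two matchings differ in at least `ℓ` edges then a random
colouring shows this through the signatures with probability at least `18 ^ (-ℓ)`
(`card_colourings_le`).  Hence among `c (τ + 1) 18 ^ ℓ` random colourings there is, for each pair of
consecutive matchings of a fixed solution, one that certifies their difference, except with
probability `1 / c`.  It remains to know, for each graph, which pairs of signatures with respect to
two given colourings (the one for the preceding stage and the one for the next) belong to a perfect
matching; the rest is dynamic programming over `τ` stages and at most `N 3 ^ k` states, where `N` is
the number of colourings (`Reachable`).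

*Testing signatures.*  Over a field of characteristic two, the determinant of a symmetric matrix is a
sum over involutions, so that for the weighted adjacency matrix of a graph it is the sum of the
squares of the weights of all perfect matchings (`det_tutteMatrix`).  If the field contains a cube
root of unity then the edges can be weighted in addition by characters of `(ℤ/3)^k`, evaluated at
their colours, and a Fourier sum over all pairs of characters retains exactly the matchings with the
given signatures (`testValue_eq`).  With random weights from a large field this sum vanishes only with
small probability if there is such a matching, by the lemma of Schwartz and Zippel
(`card_testValue_eq_zero_le`), and always if there is none.  Altogether the error is one-sided and at
most `2 / c` (`card_correct_ge`).

*The field.*  The polynomial `X ^ (2 q) + X ^ q + 1` with `q = 3 ^ j` is cyclotomic, and it is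
irreducible modulo `2` as `2` is a primitive root modulo `3 ^ (j + 1)`.  Thus there are explicit fields
of order `2 ^ (2 q)`, with `X ^ q` as cube root of unity, whose elements are numbered by the binary
digits of their coefficients (`exists_field`, `binVal`).  A field of polynomial size suffices, so the
machine can tabulate its arithmetic.

*The machine.*  Programs are written in a small language of expressions, assignments, bounded loops
and coin tosses, which compiles to the machine and whose running time is polynomial in a bound on its
loops that stands in register `1` (`Stmt.compile_spec`, `Stmt.cost_poly`).  The algorithm runs in
phases, each of which computes the bound for the next one (`phases_spec`): it reads the input,
computes the numbers of colours and of colourings and the size of the field (`preparedConfig_spec`),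
fills the tables, draws the colourings and the weights, and runs the dynamic program
(`mainPhase_spec`).  The random choices are uniformly distributed since they depend bijectively on the
coin tosses (`draw_uniform`), and all bounds are polynomial in `2 ^ ℓ` and the size of the instance
(`bound_le`).
-/

/-! ### A loop language for the random-access machine -/

namespace RandRAM

/-- Expressions over registers and arrays.  Register `1` holds a bound: `mul a b` multiplies by
repeated addition, with the first factor cut off at that bound. -/
inductive Expr where
  | var (r : ℕ)
  | lit (k : ℕ)
  | add (a b : Expr)
  | sub (a b : Expr)
  | mul (a b : Expr)
  | load (A : ℕ) (i : Expr)

/-- The value of an expression. -/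
def Expr.eval : Expr → Config → ℕ
  | .var r, s => s.reg r
  | .lit k, _ => k
  | .add a b, s => a.eval s + b.eval s
  | .sub a b, s => a.eval s - b.eval s
  | .mul a b, s => min (a.eval s) (s.reg 1) * b.eval s
  | .load A i, s => s.mem A (i.eval s)

/-- Statements.  `loop i e p` runs `p` with register `i` set to `0, 1, …, e - 1`, where the number of
rounds is fixed at the beginning and is cut off at the content of register `1`; hence every
statement terminates. -/
inductive Stmt where
  | assign (r : ℕ) (e : Expr)
  | store (A : ℕ) (i e : Expr)
  | flip (r : ℕ)
  | seq (p q : Stmt)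
  | ite (e : Expr) (p q : Stmt)
  | loop (i : ℕ) (e : Expr) (p : Stmt)
  | skip

/-- `iterUp f n s = f (n - 1) (… (f 1 (f 0 s)))`. -/
def iterUp {α : Type} (f : ℕ → α → α) : ℕ → α → α
  | 0, s => s
  | n + 1, s => f n (iterUp f n s)

/-- The effect of a statement. -/
def Stmt.eval : Stmt → Config → Config
  | .assign r e, s => s.setReg r (e.eval s)
  | .store A i e, s => s.setMem A (i.eval s) (e.eval s)
  | .flip r, s => s.toss r
  | .seq p q, s => q.eval (p.eval s)
  | .ite e p q, s => if e.eval s ≠ 0 then p.eval s else q.eval s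
  | .loop i e p, s =>
    iterUp (fun j s' => p.eval (s'.setReg i j)) (min (e.eval s) (s.reg 1)) s
  | .skip, s => s

/-- Registers from `100` on are reserved for the intermediate results of the compiled code. -/
def Expr.WF : Expr → Bool
  | .var r => r < 100
  | .lit _ => true
  | .add a b => a.WF && b.WF
  | .sub a b => a.WF && b.WF
  | .mul a b => a.WF && b.WF
  | .load _ i => i.WF

/-- The statement uses no reserved registers and does not change the bound in register `1`. -/
def Stmt.WF : Stmt → Bool
  | .assign r e => r < 100 && r != 1 && e.WF
  | .store _ i e => i.WF && e.WF
  | .flip r => r < 100 && r != 1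
  | .seq p q => p.WF && q.WF
  | .ite e p q => e.WF && p.WF && q.WF
  | .loop i e p => i < 100 && i != 1 && e.WF && p.WF
  | .skip => true

/-- The registers a statement may change. -/
def Stmt.regs : Stmt → List ℕ
  | .assign r _ => [r]
  | .store _ _ _ => []
  | .flip r => [r]
  | .seq p q => p.regs ++ q.regs
  | .ite _ p q => p.regs ++ q.regs
  | .loop i _ p => i :: p.regs
  | .skip => []

/-- The arrays a statement may change. -/
def Stmt.arrs : Stmt → List ℕ
  | .assign _ _ => []
  | .store A _ _ => [A]
  | .flip _ => []
  | .seq p q => p.arrs ++ q.arrs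
  | .ite _ p q => p.arrs ++ q.arrs
  | .loop _ _ p => p.arrs
  | .skip => []

/-- Code that evaluates an expression into register `100 + d`, and that changes no register below
it. -/
def Expr.compile : Expr → ℕ → Program
  | .var r, d => .copy (100 + d) r
  | .lit k, d => .const (100 + d) k
  | .add a b, d =>
    .seq (a.compile d) (.seq (b.compile (d + 1)) (.add (100 + d) (100 + d) (100 + (d + 1))))
  | .sub a b, d =>
    .seq (a.compile d) (.seq (b.compile (d + 1)) (.sub (100 + d) (100 + d) (100 + (d + 1))))
  | .mul a b, d =>
    .seq (a.compile d) <| .seq (b.compile (d + 1)) <|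
    .seq (.sub (100 + (d + 2)) (100 + d) 1) <|
    .seq (.sub (100 + d) (100 + d) (100 + (d + 2))) <|
    .seq (.const (100 + (d + 2)) 0) <|
    .seq (.loop (100 + d) <|
      .seq (.add (100 + (d + 2)) (100 + (d + 2)) (100 + (d + 1))) <|
      .seq (.const (100 + (d + 3)) 1) (.sub (100 + d) (100 + d) (100 + (d + 3)))) <|
    .copy (100 + d) (100 + (d + 2))
  | .load A i, d => .seq (i.compile d) (.load (100 + d) A (100 + d))

/-- Code for a statement; of the reserved registers it changes none below `100 + d`. -/
def Stmt.compile : Stmt → ℕ → Program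
  | .assign r e, d => .seq (e.compile d) (.copy r (100 + d))
  | .store A i e, d =>
    .seq (i.compile d) (.seq (e.compile (d + 1)) (.store A (100 + d) (100 + (d + 1))))
  | .flip r, _ => .flip r
  | .seq p q, d => .seq (p.compile d) (q.compile d)
  | .ite e p q, d => .seq (e.compile d) (.ite (100 + d) (p.compile d) (q.compile d))
  | .loop i e p, d =>
    .seq (e.compile d) <|
    .seq (.sub (100 + (d + 1)) (100 + d) 1) <|
    .seq (.sub (100 + d) (100 + d) (100 + (d + 1))) <|
    .seq (.const (100 + (d + 1)) 0) <|
    .loop (100 + d) <|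
      .seq (.copy i (100 + (d + 1))) <|
      .seq (p.compile (d + 2)) <|
      .seq (.const (100 + (d + 2)) 1) <|
      .seq (.add (100 + (d + 1)) (100 + (d + 1)) (100 + (d + 2)))
        (.sub (100 + d) (100 + d) (100 + (d + 2)))
  | .skip, _ => .skip

/-- A bound on the number of steps of the code for an expression when register `1` holds `B`. -/
def Expr.cost (B : ℕ) : Expr → ℕ
  | .var _ => 1
  | .lit _ => 1
  | .add a b => a.cost B + b.cost B + 1
  | .sub a b => a.cost B + b.cost B + 1
  | .mul a b => a.cost B + b.cost B + (B * 4 + 5)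
  | .load _ i => i.cost B + 1

/-- A bound on the number of steps of the code for a statement when register `1` holds `B`. -/
def Stmt.cost (B : ℕ) : Stmt → ℕ
  | .assign _ e => e.cost B + 1
  | .store _ i e => i.cost B + e.cost B + 1
  | .flip _ => 1
  | .seq p q => p.cost B + q.cost B
  | .ite e p q => e.cost B + (1 + (p.cost B + q.cost B))
  | .loop _ e p => e.cost B + (B * (p.cost B + 5) + 4)
  | .skip => 1

/-- `s` agrees with `σ` except possibly on the reserved registers. -/
def Sim (s σ : Config) : Prop :=
  s.mem = σ.mem ∧ s.coins = σ.coins ∧ ∀ r < 100, s.reg r = σ.reg r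

theorem Expr.eval_sim {s σ : Config} (h : Sim s σ) (e : Expr) (he : e.WF) :
    e.eval s = e.eval σ := by
  induction e with
  | var r => exact h.2.2 r (by simpa [Expr.WF] using he)
  | lit k => rfl
  | add a b iha ihb => simp only [Expr.WF, Bool.and_eq_true] at he; simp [Expr.eval, iha he.1, ihb he.2]
  | sub a b iha ihb => simp only [Expr.WF, Bool.and_eq_true] at he; simp [Expr.eval, iha he.1, ihb he.2]
  | mul a b iha ihb =>
    simp only [Expr.WF, Bool.and_eq_true] at he
    simp [Expr.eval, iha he.1, ihb he.2, h.2.2 1 (by norm_num)]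
  | load A i ih => simp [Expr.eval, ih he, h.1]

@[simp] theorem Config.setReg_reg (s : Config) (r x r' : ℕ) :
    (s.setReg r x).reg r' = if r' = r then x else s.reg r' := by
  simp [Config.setReg, Function.update_apply]

@[simp] theorem Config.setReg_mem (s : Config) (r x : ℕ) : (s.setReg r x).mem = s.mem := rfl

@[simp] theorem Config.setReg_coins (s : Config) (r x : ℕ) : (s.setReg r x).coins = s.coins := rfl

@[simp] theorem Config.setMem_reg (s : Config) (A k x : ℕ) : (s.setMem A k x).reg = s.reg := rfl

@[simp] theorem Config.setMem_coins (s : Config) (A k x : ℕ) :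
    (s.setMem A k x).coins = s.coins := rfl

@[simp] theorem Config.setMem_mem (s : Config) (A k x A' : ℕ) :
    (s.setMem A k x).mem A' = if A' = A then Function.update (s.mem A) k x else s.mem A' := by
  by_cases h : A' = A
  · subst h; simp [Config.setMem]
  · simp [Config.setMem, h]

@[simp] theorem Config.toss_reg (s : Config) (r r' : ℕ) :
    (s.toss r).reg r' = if r' = r then (if s.coins 0 then 1 else 0) else s.reg r' := by
  simp [Config.toss, Function.update_apply]

@[simp] theorem Config.toss_mem (s : Config) (r : ℕ) : (s.toss r).mem = s.mem := rfl

@[simp] theorem Config.toss_coins (s : Config) (r : ℕ) :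
    (s.toss r).coins = fun k => s.coins (k + 1) := rfl

/-- The loop of the code for a multiplication. -/
theorem Expr.mul_loop (d : ℕ) (m : ℕ) : ∀ s : Config, s.reg (100 + d) = m →
    ∃ s', Runs (.loop (100 + d) <|
      .seq (.add (100 + (d + 2)) (100 + (d + 2)) (100 + (d + 1))) <|
      .seq (.const (100 + (d + 3)) 1) (.sub (100 + d) (100 + d) (100 + (d + 3)))) s (m * 4 + 1) s' ∧
      s'.reg (100 + (d + 2)) = s.reg (100 + (d + 2)) + m * s.reg (100 + (d + 1)) ∧
      s'.mem = s.mem ∧ s'.coins = s.coins ∧ ∀ r < 100 + d, s'.reg r = s.reg r := by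
  induction m with
  | zero =>
    intro s hs
    exact ⟨s, .loop_false hs, by simp, rfl, rfl, fun _ _ => rfl⟩
  | succ m ih =>
    intro s hs
    have hbody := Runs.seq (Runs.add (100 + (d + 2)) (100 + (d + 2)) (100 + (d + 1)) s)
      (Runs.seq (Runs.const (100 + (d + 3)) 1 _) (Runs.sub (100 + d) (100 + d) (100 + (d + 3)) _))
    have hm := ih _ (by simp [hs] : (((s.setReg (100 + (d + 2))
      (s.reg (100 + (d + 2)) + s.reg (100 + (d + 1)))).setReg (100 + (d + 3)) 1).setReg (100 + d)
        (((s.setReg (100 + (d + 2)) (s.reg (100 + (d + 2)) + s.reg (100 + (d + 1)))).setReg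
          (100 + (d + 3)) 1).reg (100 + d) - ((s.setReg (100 + (d + 2)) (s.reg (100 + (d + 2)) +
            s.reg (100 + (d + 1)))).setReg (100 + (d + 3)) 1).reg (100 + (d + 3)))).reg
        (100 + d) = m)
    obtain ⟨s', h1, h2, h3, h4, h5⟩ := hm
    refine ⟨s', ?_, ?_, ?_, ?_, ?_⟩
    · convert Runs.loop_true (by omega) hbody h1 using 1
      ring
    · rw [h2]; simp; ring
    · rw [h3]; rfl
    · rw [h4]; rfl
    · intro r hr
      rw [h5 r hr]
      simp (disch := omega) [if_neg]

/-- The compiled code evaluates the expression within the bound on its cost, leaving everything but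
the reserved registers from `100 + d` on unchanged. -/
theorem Expr.compile_spec (e : Expr) (he : e.WF) : ∀ (d : ℕ) (s : Config),
    ∃ t ≤ e.cost (s.reg 1), ∃ s', Runs (e.compile d) s t s' ∧ s'.reg (100 + d) = e.eval s ∧
      s'.mem = s.mem ∧ s'.coins = s.coins ∧ ∀ r < 100 + d, s'.reg r = s.reg r := by
  induction e with
  | var r =>
    intro d s
    refine ⟨1, le_rfl, _, Runs.copy _ _ _, by simp [Expr.eval], rfl, rfl, ?_⟩
    intro r hr; simp; omega
  | lit k =>
    intro d s
    refine ⟨1, le_rfl, _, Runs.const _ _ _, by simp [Expr.eval], rfl, rfl, ?_⟩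
    intro r hr; simp; omega
  | load A i ih =>
    intro d s
    obtain ⟨t, ht, s1, h1, h2, h3, h4, h5⟩ := ih he d s
    refine ⟨_, Nat.add_le_add_right ht 1, _, h1.seq (Runs.load _ _ _ _), ?_, h3, h4, ?_⟩
    · simp [Expr.eval, h2, h3]
    · intro r hr; rw [← h5 r hr]; simp; omega
  | add a b iha ihb =>
    intro d s
    simp only [Expr.WF, Bool.and_eq_true] at he
    obtain ⟨t, ht, s1, h1, h2, h3, h4, h5⟩ := iha he.1 d s
    obtain ⟨t', ht', s2, k1, k2, k3, k4, k5⟩ := ihb he.2 (d + 1) s1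
    have hs : Sim s1 s := ⟨h3, h4, fun r hr => h5 r (by omega)⟩
    rw [hs.2.2 1 (by norm_num)] at ht'
    refine ⟨_, ?_, _, h1.seq (k1.seq (Runs.add _ _ _ _)), ?_, k3.trans h3, k4.trans h4, ?_⟩
    · simp only [Expr.cost]; omega
    · simp only [Config.setReg_reg, if_true]
      rw [k2, k5 _ (by omega), h2, Expr.eval_sim hs b he.2]; rfl
    · intro r hr
      rw [Config.setReg_reg, if_neg (by omega), k5 r (by omega), h5 r hr]
  | sub a b iha ihb =>
    intro d s
    simp only [Expr.WF, Bool.and_eq_true] at he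
    obtain ⟨t, ht, s1, h1, h2, h3, h4, h5⟩ := iha he.1 d s
    obtain ⟨t', ht', s2, k1, k2, k3, k4, k5⟩ := ihb he.2 (d + 1) s1
    have hs : Sim s1 s := ⟨h3, h4, fun r hr => h5 r (by omega)⟩
    rw [hs.2.2 1 (by norm_num)] at ht'
    refine ⟨_, ?_, _, h1.seq (k1.seq (Runs.sub _ _ _ _)), ?_, k3.trans h3, k4.trans h4, ?_⟩
    · simp only [Expr.cost]; omega
    · simp only [Config.setReg_reg, if_true]
      rw [k2, k5 _ (by omega), h2, Expr.eval_sim hs b he.2]; rfl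
    · intro r hr
      rw [Config.setReg_reg, if_neg (by omega), k5 r (by omega), h5 r hr]
  | mul a b iha ihb =>
    intro d s
    simp only [Expr.WF, Bool.and_eq_true] at he
    obtain ⟨t, ht, s1, h1, h2, h3, h4, h5⟩ := iha he.1 d s
    obtain ⟨t', ht', s2, k1, k2, k3, k4, k5⟩ := ihb he.2 (d + 1) s1
    have hs : Sim s1 s := ⟨h3, h4, fun r hr => h5 r (by omega)⟩
    have hB : s2.reg 1 = s.reg 1 := by rw [k5 1 (by omega), h5 1 (by omega)]
    rw [hs.2.2 1 (by norm_num)] at ht'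
    have ha : s2.reg (100 + d) = a.eval s := by rw [k5 _ (by omega), h2]
    have hb : s2.reg (100 + (d + 1)) = b.eval s := by rw [k2, Expr.eval_sim hs b he.2]
    let s3 := s2.setReg (100 + (d + 2)) (s2.reg (100 + d) - s2.reg 1)
    let s4 := s3.setReg (100 + d) (s3.reg (100 + d) - s3.reg (100 + (d + 2)))
    let s5 := s4.setReg (100 + (d + 2)) 0
    have hm : s5.reg (100 + d) = min (a.eval s) (s.reg 1) := by
      simp [s5, s4, s3, ha, hB]; omega
    obtain ⟨s6, m1, m2, m3, m4, m5⟩ := Expr.mul_loop d _ s5 hm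
    refine ⟨_, ?_, _, h1.seq <| k1.seq <| (Runs.sub _ _ _ _).seq <| (Runs.sub _ _ _ _).seq <|
      (Runs.const _ _ _).seq <| m1.seq (Runs.copy _ _ _), ?_, ?_, ?_, ?_⟩
    · simp only [Expr.cost]
      have := min_le_right (a.eval s) (s.reg 1)
      omega
    · have e1 : s5.reg (100 + (d + 2)) = 0 := by simp [s5]
      have e2 : s5.reg (100 + (d + 1)) = b.eval s := by simp [s5, s4, s3, hb]
      simp [m2, e1, e2, Expr.eval]
    · simp only [Config.setReg_mem]; rw [m3]; exact k3.trans h3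
    · simp only [Config.setReg_coins]; rw [m4]; exact k4.trans h4
    · intro r hr
      rw [Config.setReg_reg, if_neg (by omega), m5 r hr]
      simp only [s5, s4, s3, Config.setReg_reg]
      rw [if_neg (by omega), if_neg (by omega), if_neg (by omega), k5 r (by omega), h5 r hr]

theorem Sim.refl (s : Config) : Sim s s := ⟨rfl, rfl, fun _ _ => rfl⟩

theorem Sim.setReg {s σ : Config} (h : Sim s σ) (r x : ℕ) : Sim (s.setReg r x) (σ.setReg r x) :=
  ⟨h.1, h.2.1, fun r' hr' => by simp [h.2.2 r' hr']⟩

theorem iterUp_succ' {α : Type} (f : ℕ → α → α) (n : ℕ) (s : α) :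
    iterUp f (n + 1) s = iterUp (fun j => f (j + 1)) n (f 0 s) := by
  induction n with
  | zero => rfl
  | succ n ih => rw [iterUp, ih]; rfl

/-- Frame property for registers: registers that do not occur in `regs` keep their contents. -/
theorem Stmt.eval_reg (p : Stmt) : ∀ (s : Config) (r : ℕ), r ∉ p.regs →
    (p.eval s).reg r = s.reg r := by
  induction p with
  | assign r e => intro s r' h; simp [Stmt.regs] at h; simp [Stmt.eval, h]
  | store A i e => intro s r' h; simp [Stmt.eval]
  | flip r => intro s r' h; simp [Stmt.regs] at h; simp [Stmt.eval, h]
  | seq p q ihp ihq =>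
    intro s r' h; simp [Stmt.regs] at h; rw [Stmt.eval, ihq _ _ h.2, ihp _ _ h.1]
  | ite e p q ihp ihq =>
    intro s r' h; simp [Stmt.regs] at h; rw [Stmt.eval]
    split_ifs
    · exact ihp _ _ h.1
    · exact ihq _ _ h.2
  | loop i e p ih =>
    intro s r' h; simp [Stmt.regs] at h; rw [Stmt.eval]
    generalize min (e.eval s) (s.reg 1) = n
    induction n with
    | zero => rfl
    | succ n ihn => rw [iterUp, ih _ _ h.2, Config.setReg_reg, if_neg h.1, ihn]
  | skip => intro s r h; rfl

/-- Frame property for arrays: arrays that do not occur in `arrs` keep their contents. -/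
theorem Stmt.eval_mem (p : Stmt) : ∀ (s : Config) (A : ℕ), A ∉ p.arrs →
    (p.eval s).mem A = s.mem A := by
  induction p with
  | assign r e => intro s A h; rfl
  | store A i e => intro s A' h; simp [Stmt.arrs] at h; simp [Stmt.eval, h]
  | flip r => intro s r' h; rfl
  | seq p q ihp ihq =>
    intro s r' h; simp [Stmt.arrs] at h; rw [Stmt.eval, ihq _ _ h.2, ihp _ _ h.1]
  | ite e p q ihp ihq =>
    intro s r' h; simp [Stmt.arrs] at h; rw [Stmt.eval]
    split_ifs
    · exact ihp _ _ h.1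
    · exact ihq _ _ h.2
  | loop i e p ih =>
    intro s r' h; simp [Stmt.arrs] at h; rw [Stmt.eval]
    generalize min (e.eval s) (s.reg 1) = n
    induction n with
    | zero => rfl
    | succ n ihn => rw [iterUp, ih _ _ h, Config.setReg_mem, ihn]
  | skip => intro s r h; rfl

theorem Stmt.one_notMem_regs (p : Stmt) (hp : p.WF) : 1 ∉ p.regs := by
  induction p with
  | assign r e => simp [Stmt.WF, Stmt.regs] at *; tauto
  | store A i e => simp [Stmt.regs]
  | flip r => simp [Stmt.WF, Stmt.regs] at *; tauto
  | seq p q ihp ihq => simp [Stmt.WF, Stmt.regs] at *; tauto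
  | ite e p q ihp ihq => simp [Stmt.WF, Stmt.regs] at *; tauto
  | loop i e p ih => simp [Stmt.WF, Stmt.regs] at *; tauto
  | skip => simp [Stmt.regs]

/-- The compiled code does what the statement says, within the bound on its cost. -/
theorem Stmt.compile_spec (p : Stmt) (hp : p.WF) : ∀ (d : ℕ) (s σ : Config), Sim s σ →
    ∃ t ≤ p.cost (σ.reg 1), ∃ s', Runs (p.compile d) s t s' ∧ Sim s' (p.eval σ) ∧
      ∀ r, 100 ≤ r → r < 100 + d → s'.reg r = s.reg r := by
  induction p with
  | skip => intro d s σ h; exact ⟨1, le_rfl, s, .skip s, h, fun _ _ _ => rfl⟩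
  | flip r =>
    intro d s σ h
    simp only [Stmt.WF, Bool.and_eq_true, decide_eq_true_eq] at hp
    refine ⟨1, le_rfl, _, .flip r s, ⟨h.1, ?_, ?_⟩, ?_⟩
    · simp [Stmt.eval, h.2.1]
    · intro r' hr'; simp [Stmt.eval, h.2.1, h.2.2 r' hr']
    · intro r' h1 h2; rw [Config.toss_reg, if_neg (by omega)]
  | assign r e =>
    intro d s σ h
    simp only [Stmt.WF, Bool.and_eq_true, decide_eq_true_eq] at hp
    obtain ⟨t, ht, s1, h1, h2, h3, h4, h5⟩ := e.compile_spec hp.2 d s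
    rw [h.2.2 1 (by norm_num)] at ht
    refine ⟨_, Nat.add_le_add_right ht 1, _, h1.seq (.copy _ _ _), ⟨h3.trans h.1, h4.trans h.2.1, ?_⟩, ?_⟩
    · intro r' hr'
      rw [Config.setReg_reg, h2, h5 r' (by omega), Expr.eval_sim h e hp.2, h.2.2 r' hr']
      simp [Stmt.eval]
    · intro r' hr1 hr2; rw [Config.setReg_reg, if_neg (by omega), h5 r' hr2]
  | store A i e =>
    intro d s σ h
    simp only [Stmt.WF, Bool.and_eq_true] at hp
    obtain ⟨t, ht, s1, h1, h2, h3, h4, h5⟩ := i.compile_spec hp.1 d s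
    obtain ⟨t', ht', s2, k1, k2, k3, k4, k5⟩ := e.compile_spec hp.2 (d + 1) s1
    have hs : Sim s1 σ := ⟨h3.trans h.1, h4.trans h.2.1, fun r hr => by rw [h5 r (by omega), h.2.2 r hr]⟩
    rw [h.2.2 1 (by norm_num)] at ht
    rw [hs.2.2 1 (by norm_num)] at ht'
    refine ⟨_, ?_, _, h1.seq (k1.seq (.store _ _ _ _)), ⟨?_, ?_, ?_⟩, ?_⟩
    · simp only [Stmt.cost]; omega
    · simp only [Stmt.eval, Config.setMem]
      rw [k2, k5 _ (by omega), h2, Expr.eval_sim hs e hp.2, Expr.eval_sim h i hp.1, k3, hs.1]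
    · exact k4.trans hs.2.1
    · intro r hr; rw [Config.setMem_reg, k5 r (by omega), hs.2.2 r hr]; rfl
    · intro r hr1 hr2; rw [Config.setMem_reg, k5 r (by omega), h5 r (by omega)]
  | seq p q ihp ihq =>
    intro d s σ h
    simp only [Stmt.WF, Bool.and_eq_true] at hp
    obtain ⟨t, ht, s1, h1, h2, h3⟩ := ihp hp.1 d s σ h
    obtain ⟨t', ht', s2, k1, k2, k3⟩ := ihq hp.2 d s1 _ h2
    rw [Stmt.eval_reg p _ _ (p.one_notMem_regs hp.1)] at ht'
    exact ⟨_, Nat.add_le_add ht ht', _, h1.seq k1, k2, fun r a b => by rw [k3 r a b, h3 r a b]⟩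
  | ite e p q ihp ihq =>
    intro d s σ h
    simp only [Stmt.WF, Bool.and_eq_true] at hp
    obtain ⟨⟨hpe, hpp⟩, hpq⟩ := hp
    obtain ⟨t, ht, s1, h1, h2, h3, h4, h5⟩ := e.compile_spec hpe d s
    have hs : Sim s1 σ := ⟨h3.trans h.1, h4.trans h.2.1, fun r hr => by rw [h5 r (by omega), h.2.2 r hr]⟩
    rw [h.2.2 1 (by norm_num)] at ht
    rw [Expr.eval_sim h e hpe] at h2
    by_cases he : e.eval σ = 0
    · obtain ⟨t', ht', s2, k1, k2, k3⟩ := ihq hpq d s1 σ hs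
      refine ⟨_, ?_, s2, h1.seq (.ite_false (by rw [h2, he]) k1), by simpa [Stmt.eval, he] using k2, ?_⟩
      · simp only [Stmt.cost]; omega
      · intro r a b; rw [k3 r a b, h5 r b]
    · obtain ⟨t', ht', s2, k1, k2, k3⟩ := ihp hpp d s1 σ hs
      refine ⟨_, ?_, s2, h1.seq (.ite_true (by rwa [h2]) k1), by simpa [Stmt.eval, he] using k2, ?_⟩
      · simp only [Stmt.cost]; omega
      · intro r a b; rw [k3 r a b, h5 r b]
  | loop i e p ih =>
    intro d s σ h
    have hp0 := hp
    simp only [Stmt.WF, Bool.and_eq_true, decide_eq_true_eq] at hp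
    obtain ⟨⟨⟨hi, hi1⟩, hpe⟩, hpp⟩ := hp
    have hi1' : i ≠ 1 := by simpa using hi1
    obtain ⟨t, ht, s1, h1, h2, h3, h4, h5⟩ := e.compile_spec hpe d s
    have hs : Sim s1 σ := ⟨h3.trans h.1, h4.trans h.2.1, fun r hr => by rw [h5 r (by omega), h.2.2 r hr]⟩
    rw [h.2.2 1 (by norm_num)] at ht
    rw [Expr.eval_sim h e hpe] at h2
    -- the compiled loop, started with `m` rounds to go and with the index at `j`
    have key : ∀ (m j : ℕ) (s σ' : Config), Sim s σ' → σ'.reg 1 = σ.reg 1 →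
        s.reg (100 + d) = m → s.reg (100 + (d + 1)) = j →
        ∃ t ≤ m * (p.cost (σ.reg 1) + 5) + 1, ∃ s', Runs (.loop (100 + d) <|
          .seq (.copy i (100 + (d + 1))) <|
          .seq (p.compile (d + 2)) <|
          .seq (.const (100 + (d + 2)) 1) <|
          .seq (.add (100 + (d + 1)) (100 + (d + 1)) (100 + (d + 2)))
            (.sub (100 + d) (100 + d) (100 + (d + 2)))) s t s' ∧
          Sim s' (iterUp (fun j' s' => p.eval (s'.setReg i (j + j'))) m σ') ∧
          ∀ r, 100 ≤ r → r < 100 + d → s'.reg r = s.reg r := by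
      intro m
      induction m with
      | zero =>
        intro j s σ' hsim hB hm hj
        exact ⟨1, by omega, s, .loop_false hm, hsim, fun _ _ _ => rfl⟩
      | succ m ihm =>
        intro j s σ' hsim hB hm hj
        obtain ⟨t1, ht1, s2, k1, k2, k3⟩ := ih hpp (d + 2) _ _ (hsim.setReg i j)
        rw [Config.setReg_reg, if_neg (Ne.symm hi1'), hB] at ht1
        have e0 : s2.reg (100 + d) = m + 1 := by
          rw [k3 _ (by omega) (by omega), Config.setReg_reg, if_neg (by omega), hm]
        have e1 : s2.reg (100 + (d + 1)) = j := by
          rw [k3 _ (by omega) (by omega), Config.setReg_reg, if_neg (by omega), hj]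
        let s3 := s2.setReg (100 + (d + 2)) 1
        let s4 := s3.setReg (100 + (d + 1)) (s3.reg (100 + (d + 1)) + s3.reg (100 + (d + 2)))
        let s5 := s4.setReg (100 + d) (s4.reg (100 + d) - s4.reg (100 + (d + 2)))
        have hs5 : Sim s5 (p.eval (σ'.setReg i j)) := by
          refine ⟨k2.1, k2.2.1, fun r hr => ?_⟩
          simp only [s5, s4, s3, Config.setReg_reg]
          rw [if_neg (by omega), if_neg (by omega), if_neg (by omega), k2.2.2 r hr]
        obtain ⟨t2, ht2, s6, l1, l2, l3⟩ := ihm (j + 1) s5 _ hs5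
          (by rw [Stmt.eval_reg p _ _ (p.one_notMem_regs hpp), Config.setReg_reg,
            if_neg (Ne.symm hi1'), hB])
          (by simp [s5, s4, s3, e0]) (by simp [s5, s4, s3, e1])
        have hcopy : s.reg (100 + (d + 1)) = j := hj
        have r1 : Runs (.copy i (100 + (d + 1))) s 1 (s.setReg i j) := hj ▸ .copy i (100 + (d + 1)) s
        refine ⟨_, ?_, s6, .loop_true (by omega) (r1.seq <| k1.seq <|
          (Runs.const _ _ _).seq <| (Runs.add _ _ _ _).seq (Runs.sub _ _ _ _)) l1, ?_, ?_⟩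
        · ring_nf at ht2 ht1 ⊢; omega
        · rw [iterUp_succ']
          simpa [add_assoc, add_comm, add_left_comm] using l2
        · intro r a b
          rw [l3 r a b]
          simp only [s5, s4, s3, Config.setReg_reg]
          rw [if_neg (by omega), if_neg (by omega), if_neg (by omega), k3 r a (by omega),
            Config.setReg_reg, if_neg (by omega)]
    let s2 := s1.setReg (100 + (d + 1)) (s1.reg (100 + d) - s1.reg 1)
    let s3 := s2.setReg (100 + d) (s2.reg (100 + d) - s2.reg (100 + (d + 1)))
    let s4 := s3.setReg (100 + (d + 1)) 0
    have hs4 : Sim s4 σ := by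
      refine ⟨hs.1, hs.2.1, fun r hr => ?_⟩
      simp only [s4, s3, s2, Config.setReg_reg]
      rw [if_neg (by omega), if_neg (by omega), if_neg (by omega), hs.2.2 r hr]
    have hm : s4.reg (100 + d) = min (e.eval σ) (σ.reg 1) := by
      simp [s4, s3, s2, h2, hs.2.2 1]; omega
    obtain ⟨t2, ht2, s5, l1, l2, l3⟩ := key _ 0 s4 σ hs4 rfl hm (by simp [s4])
    refine ⟨_, ?_, s5, h1.seq <| (Runs.sub _ _ _ _).seq <| (Runs.sub _ _ _ _).seq <|
      (Runs.const _ _ _).seq l1, ?_, ?_⟩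
    · simp only [Stmt.cost]
      have := Nat.mul_le_mul_right (p.cost (σ.reg 1) + 5) (min_le_right (e.eval σ) (σ.reg 1))
      omega
    · simpa [Stmt.eval] using l2
    · intro r a b
      rw [l3 r a b]
      simp only [s4, s3, s2, Config.setReg_reg]
      rw [if_neg (by omega), if_neg (by omega), if_neg (by omega), h5 r b]

theorem Expr.cost_poly (e : Expr) : ∃ C d : ℕ, ∀ B, e.cost B ≤ C * (B + 1) ^ d := by
  have comb : ∀ (a b : Expr), (∃ C d : ℕ, ∀ B, a.cost B ≤ C * (B + 1) ^ d) →
      (∃ C d : ℕ, ∀ B, b.cost B ≤ C * (B + 1) ^ d) →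
      ∃ C d : ℕ, ∀ B, a.cost B + b.cost B + (B * 4 + 5) ≤ C * (B + 1) ^ d := by
    rintro a b ⟨C, d, h⟩ ⟨C', d', h'⟩
    refine ⟨C + C' + 5, d + d' + 1, fun B => ?_⟩
    have e1 : (B + 1) ^ d ≤ (B + 1) ^ (d + d' + 1) := Nat.pow_le_pow_right (by omega) (by omega)
    have e2 : (B + 1) ^ d' ≤ (B + 1) ^ (d + d' + 1) := Nat.pow_le_pow_right (by omega) (by omega)
    have e3 : (B + 1) ^ 1 ≤ (B + 1) ^ (d + d' + 1) := Nat.pow_le_pow_right (by omega) (by omega)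
    rw [pow_one] at e3
    have := h B
    have := h' B
    have := Nat.mul_le_mul_left C e1
    have := Nat.mul_le_mul_left C' e2
    rw [add_mul, add_mul]
    omega
  induction e with
  | var r => exact ⟨1, 0, fun B => by simp [Expr.cost]⟩
  | lit k => exact ⟨1, 0, fun B => by simp [Expr.cost]⟩
  | add a b iha ihb =>
    obtain ⟨C, d, h⟩ := comb a b iha ihb
    exact ⟨C, d, fun B => le_trans (by simp only [Expr.cost]; omega) (h B)⟩
  | sub a b iha ihb =>
    obtain ⟨C, d, h⟩ := comb a b iha ihb
    exact ⟨C, d, fun B => le_trans (by simp only [Expr.cost]; omega) (h B)⟩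
  | mul a b iha ihb =>
    obtain ⟨C, d, h⟩ := comb a b iha ihb
    exact ⟨C, d, fun B => le_trans (by simp only [Expr.cost]; omega) (h B)⟩
  | load A i ih =>
    obtain ⟨C, d, h⟩ := comb i i ih ih
    exact ⟨C, d, fun B => le_trans (by simp only [Expr.cost]; omega) (h B)⟩

/-- The cost of a statement is bounded by a polynomial in the bound on its loops. -/
theorem Stmt.cost_poly (p : Stmt) : ∃ C d : ℕ, ∀ B, p.cost B ≤ C * (B + 1) ^ d := by
  have comb : ∀ (f g : ℕ → ℕ), (∃ C d : ℕ, ∀ B, f B ≤ C * (B + 1) ^ d) →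
      (∃ C d : ℕ, ∀ B, g B ≤ C * (B + 1) ^ d) →
      ∃ C d : ℕ, ∀ B, f B + g B + 1 ≤ C * (B + 1) ^ d := by
    rintro f g ⟨C, d, h⟩ ⟨C', d', h'⟩
    refine ⟨C + C' + 1, d + d', fun B => ?_⟩
    have e1 : (B + 1) ^ d ≤ (B + 1) ^ (d + d') := Nat.pow_le_pow_right (by omega) (by omega)
    have e2 : (B + 1) ^ d' ≤ (B + 1) ^ (d + d') := Nat.pow_le_pow_right (by omega) (by omega)
    have e3 : 1 ≤ (B + 1) ^ (d + d') := Nat.one_le_pow _ _ (by omega)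
    have := h B
    have := h' B
    have := Nat.mul_le_mul_left C e1
    have := Nat.mul_le_mul_left C' e2
    rw [add_mul, add_mul]
    omega
  induction p with
  | skip => exact ⟨1, 0, fun B => by simp [Stmt.cost]⟩
  | flip r => exact ⟨1, 0, fun B => by simp [Stmt.cost]⟩
  | assign r e =>
    obtain ⟨C, d, h⟩ := comb _ _ e.cost_poly e.cost_poly
    exact ⟨C, d, fun B => le_trans (by simp only [Stmt.cost]; omega) (h B)⟩
  | store A i e =>
    obtain ⟨C, d, h⟩ := comb _ _ i.cost_poly e.cost_poly
    exact ⟨C, d, fun B => le_trans (by simp only [Stmt.cost]; omega) (h B)⟩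
  | seq p q ihp ihq =>
    obtain ⟨C, d, h⟩ := comb _ _ ihp ihq
    exact ⟨C, d, fun B => le_trans (by simp only [Stmt.cost]; omega) (h B)⟩
  | ite e p q ihp ihq =>
    obtain ⟨C, d, h⟩ := comb _ _ e.cost_poly (comb _ _ ihp ihq)
    exact ⟨C, d, fun B => le_trans (by simp only [Stmt.cost]; omega) (h B)⟩
  | loop i e p ih =>
    have : ∃ C d : ℕ, ∀ B, B * (p.cost B + 5) + 4 ≤ C * (B + 1) ^ d := by
      obtain ⟨C, d, h⟩ := ih
      refine ⟨C + 9, d + 1, fun B => ?_⟩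
      have h1 : 1 ≤ (B + 1) ^ d := Nat.one_le_pow _ _ (by omega)
      have h2 : p.cost B + 5 ≤ (C + 5) * (B + 1) ^ d := by nlinarith [h B]
      calc B * (p.cost B + 5) + 4 ≤ (B + 1) * ((C + 5) * (B + 1) ^ d) + 4 * (B + 1) ^ (d + 1) := by
            refine Nat.add_le_add (Nat.mul_le_mul (by omega) h2) ?_
            have := Nat.one_le_pow (d + 1) (B + 1) (by omega)
            omega
        _ = _ := by ring
    obtain ⟨C, d, h⟩ := comb _ _ e.cost_poly this
    exact ⟨C, d, fun B => le_trans (by simp only [Stmt.cost]; omega) (h B)⟩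

end RandRAM

/-! ### Finite fields of characteristic two with a cube root of unity -/

namespace DiverseMatching

/-- The field element with number `a`: the value at `x` of the polynomial over the field with two
elements whose coefficients are the binary digits of `a`. -/
def binVal {F : Type} [Field F] (x : F) (a : ℕ) : F :=
  if _ : a = 0 then 0 else ((a % 2 : ℕ) : F) + x * binVal x (a / 2)
termination_by a
decreasing_by omega

section binVal
variable {F : Type} [Field F] (x : F)

@[simp] theorem binVal_zero : binVal x 0 = 0 := by rw [binVal]; simp

theorem binVal_eq (a : ℕ) : binVal x a = ((a % 2 : ℕ) : F) + x * binVal x (a / 2) := by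
  by_cases h : a = 0
  · subst h; simp
  · rw [binVal, dif_neg h]

@[simp] theorem binVal_one : binVal x 1 = 1 := by rw [binVal_eq]; simp

theorem binVal_two_mul (a : ℕ) : binVal x (2 * a) = x * binVal x a := by
  rw [binVal_eq]; simp

theorem binVal_two_mul_add (a e : ℕ) (he : e < 2) : binVal x (2 * a + e) = e + x * binVal x a := by
  rw [binVal_eq, show (2 * a + e) % 2 = e by omega, show (2 * a + e) / 2 = a by omega]

theorem binVal_two_pow_add (m z : ℕ) (hz : z < 2 ^ m) :
    binVal x (2 ^ m + z) = x ^ m + binVal x z := by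
  induction m generalizing z with
  | zero => simp at hz; simp [hz]
  | succ m ih =>
    rw [binVal_eq, show (2 ^ (m + 1) + z) % 2 = z % 2 by omega,
      show (2 ^ (m + 1) + z) / 2 = 2 ^ m + z / 2 by omega, ih _ (by omega), binVal_eq x z]
    ring

theorem binVal_two_pow (m : ℕ) : binVal x (2 ^ m) = x ^ m := by
  simpa using binVal_two_pow_add x m 0 (by positivity)

variable [CharP F 2]

theorem exists_binVal_add (m : ℕ) : ∀ a < 2 ^ m, ∀ b < 2 ^ m,
    ∃ c < 2 ^ m, binVal x c = binVal x a + binVal x b := by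
  induction m with
  | zero => intro a ha b hb; exact ⟨0, by simp, by simp at ha hb; simp [ha, hb]⟩
  | succ m ih =>
    intro a ha b hb
    obtain ⟨c, hc, h⟩ := ih (a / 2) (by omega) (b / 2) (by omega)
    have h2 : (1 : F) + 1 = 0 := CharTwo.add_self_eq_zero 1
    refine ⟨2 * c + (a + b) % 2, by omega, ?_⟩
    rw [binVal_two_mul_add x _ _ (by omega), h, binVal_eq x a, binVal_eq x b]
    rcases Nat.mod_two_eq_zero_or_one a with e | e <;> rcases Nat.mod_two_eq_zero_or_one b with f | f <;>
      simp [Nat.add_mod, e, f] <;> first | (ring; done) | linear_combination -h2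

end binVal

/-- The order of `2` modulo `3 ^ (j + 1)` is `2 * 3 ^ j`. -/
theorem orderOf_two_zmod (j : ℕ) : orderOf (2 : ZMod (3 ^ (j + 1))) = 2 * 3 ^ j := by
  have h4 : orderOf ((2 : ZMod (3 ^ (j + 1))) ^ 2) = 3 ^ j := by
    have := ZMod.orderOf_one_add_prime (p := 3) (by norm_num) (by norm_num) j
    rw [← this]
    congr 1; norm_num
  have hne : orderOf (2 : ZMod (3 ^ (j + 1))) ≠ 0 := by
    intro h
    rw [orderOf_eq_zero_iff] at h
    apply h
    apply isOfFinOrder_iff_pow_eq_one.2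
    exact ⟨2 * 3 ^ j, by positivity, by rw [pow_mul, ← h4, pow_orderOf_eq_one]⟩
  rw [orderOf_pow' _ (by norm_num)] at h4
  rcases Nat.even_or_odd (orderOf (2 : ZMod (3 ^ (j + 1)))) with he | ho
  · obtain ⟨r, hr⟩ := he
    rw [hr, show Nat.gcd (r + r) 2 = 2 by rw [← two_mul]; simp] at h4
    omega
  · have hg : Nat.gcd (orderOf (2 : ZMod (3 ^ (j + 1)))) 2 = 1 :=
      (Nat.coprime_two_right.2 ho)
    rw [hg, Nat.div_one] at h4
    have h1 : (2 : ZMod (3 ^ (j + 1))) ^ (3 ^ j) = 1 := by rw [← h4]; exact pow_orderOf_eq_one _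
    have h2 := congrArg (ZMod.castHom (dvd_pow_self 3 (Nat.succ_ne_zero j)) (ZMod 3)) h1
    rw [map_pow, map_one, map_ofNat] at h2
    obtain ⟨r, hr⟩ := (Odd.pow (by decide : Odd 3) : Odd (3 ^ j))
    rw [hr, pow_succ, pow_mul, show (2 : ZMod 3) ^ 2 = 1 by decide, one_pow, one_mul] at h2
    exact absurd h2 (by decide)

theorem irreducible_cyclotomic_three_pow (j : ℕ) :
    Irreducible (Polynomial.cyclotomic (3 ^ (j + 1)) (ZMod 2)) := by
  have : Fact (Nat.Prime 2) := ⟨Nat.prime_two⟩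
  have hcop : (2 : ℕ).Coprime (3 ^ (j + 1)) := by
    apply Nat.Coprime.pow_right; norm_num
  apply Polynomial.irreducible_of_dvd_cyclotomic_of_natDegree (K := ZMod 2) (p := 2) (f := 1)
    (by simp [ZMod.card]) hcop dvd_rfl
  rw [Polynomial.natDegree_cyclotomic, Nat.totient_prime_pow_succ Nat.prime_three, ← orderOf_units,
    ZMod.coe_unitOfCoprime]
  have := orderOf_two_zmod j
  simp only [pow_one]
  norm_cast at this ⊢
  rw [this]; ring

/-- The finite field `F` of order `2 ^ (2 * 3 ^ j)`, generated by a root `x` of the cyclotomic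
polynomial `X ^ (2 * 3 ^ j) + X ^ (3 ^ j) + 1`, which is explicit, so that no irreducible polynomial
has to be searched for.  Here `x ^ (3 ^ j)` is a primitive cube root of unity. -/
theorem exists_field (j : ℕ) : ∃ (F : Type) (_ : Field F) (_ : Fintype F) (x : F), CharP F 2 ∧
    x ^ (2 * 3 ^ j) = x ^ (3 ^ j) + 1 ∧
    Function.Bijective (fun a : Fin (2 ^ (2 * 3 ^ j)) => binVal x a) := by
  have : Fact (Nat.Prime 2) := ⟨Nat.prime_two⟩
  set P := Polynomial.cyclotomic (3 ^ (j + 1)) (ZMod 2) with hP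
  have hirr : Fact (Irreducible P) := ⟨irreducible_cyclotomic_three_pow j⟩
  have hmon : P.Monic := Polynomial.cyclotomic.monic _ _
  have hfin : Module.Finite (ZMod 2) (AdjoinRoot P) := hmon.finite_adjoinRoot
  have hfinite : Finite (AdjoinRoot P) := Module.finite_of_finite (ZMod 2)
  let _ := Fintype.ofFinite (AdjoinRoot P)
  have hchar : CharP (AdjoinRoot P) 2 := charP_of_injective_algebraMap
    (algebraMap (ZMod 2) (AdjoinRoot P)).injective 2
  have hdeg : P.natDegree = 2 * 3 ^ j := by
    rw [hP, Polynomial.natDegree_cyclotomic, Nat.totient_prime_pow_succ Nat.prime_three]; ring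
  have hroot : (AdjoinRoot.root P) ^ (2 * 3 ^ j) = (AdjoinRoot.root P) ^ (3 ^ j) + 1 := by
    have hPeq : P = 1 + Polynomial.X ^ 3 ^ j + (Polynomial.X ^ 3 ^ j) ^ 2 := by
      rw [hP, Polynomial.cyclotomic_prime_pow_eq_geom_sum Nat.prime_three]
      simp [Finset.sum_range_succ]
    have h := congrArg (Polynomial.eval₂ (AdjoinRoot.of P) (AdjoinRoot.root P)) hPeq
    rw [AdjoinRoot.eval₂_root] at h
    simp only [Polynomial.eval₂_add, Polynomial.eval₂_pow, Polynomial.eval₂_X,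
      Polynomial.eval₂_one] at h
    have h2 : ∀ a : AdjoinRoot P, a + a = 0 := CharTwo.add_self_eq_zero
    rw [mul_comm, pow_mul]
    linear_combination -h - h2 (AdjoinRoot.root P ^ 3 ^ j) - h2 1
  refine ⟨AdjoinRoot P, inferInstance, inferInstance, AdjoinRoot.root P, hchar, hroot, ?_⟩
  have hcard : Fintype.card (AdjoinRoot P) = 2 ^ (2 * 3 ^ j) := by
    rw [Module.card_eq_pow_finrank (K := ZMod 2), ZMod.card,
      (AdjoinRoot.powerBasis' hmon).finrank, AdjoinRoot.powerBasis'_dim, hdeg]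
  rw [Fintype.bijective_iff_surjective_and_card]
  refine ⟨?_, by rw [Fintype.card_fin, hcard]⟩
  set x := AdjoinRoot.root P
  have hadd : ∀ y z : AdjoinRoot P, (∃ a < 2 ^ (2 * 3 ^ j), binVal x a = y) →
      (∃ a < 2 ^ (2 * 3 ^ j), binVal x a = z) → ∃ a < 2 ^ (2 * 3 ^ j), binVal x a = y + z := by
    rintro y z ⟨a, ha, rfl⟩ ⟨b, hb, rfl⟩
    exact exists_binVal_add x _ a ha b hb
  have hmul : ∀ y : AdjoinRoot P, (∃ a < 2 ^ (2 * 3 ^ j), binVal x a = y) →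
      ∃ a < 2 ^ (2 * 3 ^ j), binVal x a = x * y := by
    rintro y ⟨a, ha, rfl⟩
    by_cases h : 2 * a < 2 ^ (2 * 3 ^ j)
    · exact ⟨_, h, binVal_two_mul x a⟩
    · obtain ⟨b, hb, hab⟩ : ∃ b < 2 ^ (2 * 3 ^ j), 2 * a = 2 ^ (2 * 3 ^ j) + b :=
        ⟨2 * a - 2 ^ (2 * 3 ^ j), by omega, by omega⟩
      rw [← binVal_two_mul, hab, binVal_two_pow_add x _ _ hb, hroot]
      have hlt : 2 ^ (3 ^ j) < 2 ^ (2 * 3 ^ j) :=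
        Nat.pow_lt_pow_right (by norm_num) (by have : 0 < 3 ^ j := by positivity
                                               omega)
      refine hadd _ _ (hadd _ _ ⟨2 ^ (3 ^ j), hlt, binVal_two_pow _ _⟩ ⟨1, ?_, binVal_one x⟩) ⟨b, hb, rfl⟩
      exact lt_of_le_of_lt Nat.one_le_two_pow hlt
  have hC : ∀ c : ZMod 2, ∃ a < 2 ^ (2 * 3 ^ j), binVal x a = AdjoinRoot.mk P (Polynomial.C c) := by
    intro c
    have h1 : 1 < 2 ^ (2 * 3 ^ j) := Nat.one_lt_two_pow (by positivity)
    fin_cases c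
    · exact ⟨0, by positivity, by rw [binVal_zero]; exact (by simp : (0 : AdjoinRoot P) = AdjoinRoot.mk P (Polynomial.C 0))⟩
    · exact ⟨1, h1, by rw [binVal_one]; exact (by simp : (1 : AdjoinRoot P) = AdjoinRoot.mk P (Polynomial.C 1))⟩
  intro y
  obtain ⟨p, rfl⟩ := AdjoinRoot.mk_surjective y
  suffices h : ∃ a < 2 ^ (2 * 3 ^ j), binVal x a = AdjoinRoot.mk P p by
    obtain ⟨a, ha, h⟩ := h
    exact ⟨⟨a, ha⟩, h⟩
  induction p using Polynomial.induction_on with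
  | C a => exact hC a
  | add p q hp hq => rw [map_add]; exact hadd _ _ hp hq
  | monomial n a h =>
    have : AdjoinRoot.mk P (Polynomial.C a * Polynomial.X ^ (n + 1)) =
        x * AdjoinRoot.mk P (Polynomial.C a * Polynomial.X ^ n) := by
      rw [show x = AdjoinRoot.mk P Polynomial.X from AdjoinRoot.mk_X.symm, ← map_mul]; congr 1; ring
    rw [this]
    exact hmul _ h

end DiverseMatching

/-! ### Signatures of edge sets -/

namespace DiverseMatching

/-- The signature of a set `E` with respect to the colouring `χ`: the number of elements of each
colour, modulo `3`. -/
def signature {α : Type} {k : ℕ} (χ : α → Fin k) (E : Finset α) : Fin k → Fin 3 :=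
  fun c => Fin.ofNat 3 (E.filter fun e => χ e = c).card

theorem signature_eq_iff {α : Type} {k : ℕ} (χ : α → Fin k) (E E' : Finset α) (c : Fin k) :
    signature χ E c = signature χ E' c ↔
      (E.filter fun e => χ e = c).card ≡ (E'.filter fun e => χ e = c).card [MOD 3] := by
  simp [signature, Fin.ext_iff, Nat.ModEq]

/-- Signatures differ only at colours of elements of the symmetric difference. -/
theorem hammingDist_signature_le {α : Type} [DecidableEq α] {k : ℕ} (χ : α → Fin k)
    (E E' : Finset α) : hammingDist (signature χ E) (signature χ E') ≤ (symmDiff E E').card := by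
  refine le_trans (Finset.card_le_card ?_) (Finset.card_image_le (s := symmDiff E E') (f := χ))
  intro c hc
  by_contra h
  simp only [Finset.mem_filter, Finset.mem_univ, true_and] at hc
  apply hc
  rw [signature_eq_iff]
  have : (E.filter fun e => χ e = c) = (E'.filter fun e => χ e = c) := by
    ext e
    simp only [Finset.mem_image, not_exists, not_and] at h
    have := h e
    simp only [Finset.mem_symmDiff] at this
    simp only [Finset.mem_filter]
    tauto
  rw [this]

theorem card_filter_split {α : Type} [DecidableEq α] (E W : Finset α) (p : α → Prop) [DecidablePred p] :
    (E.filter p).card = ((E \ W).filter p).card + ((E ∩ W).filter p).card := by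
  rw [← Finset.card_union_of_disjoint, ← Finset.filter_union, Finset.sdiff_union_inter]
  exact Finset.disjoint_filter_filter (Finset.disjoint_sdiff_inter E W)

/-- If two sets differ in at least `ℓ` elements then a random colouring shows this with probability
at least `ℓ! / k ^ ℓ`.  Here `W` consists of `ℓ` elements of the difference, and `h` is a colouring
of the remaining elements; if the latter alone yields nearly equal signatures, an injective
colouring of `W` by colours at which they agree creates `ℓ` differences, and otherwise `W` is too
small to remove enough of the differences. -/
theorem factorial_le_card_extensions {α : Type} [DecidableEq α] {k ℓ : ℕ}
    (E E' W : Finset α) (hW : W ⊆ symmDiff E E') (hℓ : W.card = ℓ) (hk : 3 * ℓ ≤ k)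
    (h : {a // a ∉ W} → Fin k) :
    ℓ.factorial ≤ ((Finset.univ : Finset ({a // a ∈ W} → Fin k)).filter fun g =>
      ℓ ≤ hammingDist
        (signature ((Equiv.piEquivPiSubtypeProd (· ∈ W) (fun _ => Fin k)).symm (g, h)) E)
        (signature ((Equiv.piEquivPiSubtypeProd (· ∈ W) (fun _ => Fin k)).symm (g, h)) E')).card := by
  classical
  set ext : ({a // a ∈ W} → Fin k) → α → Fin k :=
    fun g => (Equiv.piEquivPiSubtypeProd (· ∈ W) (fun _ => Fin k)).symm (g, h) with hext
  have ext_mem : ∀ g a (ha : a ∈ W), ext g a = g ⟨a, ha⟩ := fun g a ha => by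
    simp [hext, Equiv.piEquivPiSubtypeProd, ha]
  have ext_notMem : ∀ g a (ha : a ∉ W), ext g a = h ⟨a, ha⟩ := fun g a ha => by
    simp [hext, Equiv.piEquivPiSubtypeProd, ha]
  -- the number of elements of `E \ W` of a colour depends on `h` only
  have rest : ∀ (E : Finset α) (g g') c, ((E \ W).filter fun e => ext g e = c).card =
      ((E \ W).filter fun e => ext g' e = c).card := by
    intro E g g' c
    congr 1
    apply Finset.filter_congr
    intro e he
    rw [ext_notMem g e (Finset.mem_sdiff.1 he).2, ext_notMem g' e (Finset.mem_sdiff.1 he).2]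
  by_cases hk0 : k = 0
  · have hW0 : W = ∅ := Finset.card_eq_zero.1 (by omega)
    have : ℓ = 0 := by omega
    subst this
    simp
    subst hW0
    simp
  have : NeZero k := ⟨hk0⟩
  let g0 : {a // a ∈ W} → Fin k := fun _ => 0
  set Z : Finset (Fin k) := Finset.univ.filter fun c =>
    ((E \ W).filter fun e => ext g0 e = c).card ≡ ((E' \ W).filter fun e => ext g0 e = c).card [MOD 3]
    with hZ
  by_cases hcard : ℓ ≤ Z.card
  · -- injective colourings of `W` by colours in `Z`
    have hcount : ℓ.factorial ≤ Fintype.card ({a // a ∈ W} ↪ {c // c ∈ Z}) := by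
      rw [Fintype.card_embedding_eq]
      simp only [Fintype.card_coe, hℓ]
      have := Nat.factorial_mul_descFactorial hcard
      have h1 : ℓ.factorial * (Z.card - ℓ).factorial ≤ Z.card.factorial :=
        Nat.le_of_dvd (Nat.factorial_pos _) (Nat.factorial_mul_factorial_dvd_factorial hcard)
      rw [← this, mul_comm] at h1
      exact Nat.le_of_mul_le_mul_left h1 (Nat.factorial_pos _)
    refine le_trans hcount ?_
    rw [← Finset.card_univ]
    refine Finset.card_le_card_of_injOn (fun f a => (f a : Fin k)) ?_ ?_
    · intro f _
      simp only [Finset.coe_filter, Finset.mem_univ, true_and, Set.mem_ofPred_eq]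
      set g : {a // a ∈ W} → Fin k := fun a => (f a : Fin k) with hg
      have hginj : Function.Injective g := fun a b hab => f.injective (Subtype.ext hab)
      have : ℓ = (Finset.univ.image g).card := by
        rw [Finset.card_image_of_injective _ hginj, Finset.card_univ, Fintype.card_coe, hℓ]
      rw [this]
      apply Finset.card_le_card
      intro c hc
      obtain ⟨⟨a, ha⟩, -, rfl⟩ := Finset.mem_image.1 hc
      simp only [Finset.mem_filter, Finset.mem_univ, true_and]
      rw [ne_eq, signature_eq_iff]
      change ¬ ((E.filter fun e => ext g e = g ⟨a, ha⟩).card ≡ (E'.filter fun e => ext g e = g ⟨a, ha⟩).card [MOD 3])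
      have single : ∀ e, e ∈ W → (ext g e = g ⟨a, ha⟩ ↔ e = a) := by
        intro e he
        rw [ext_mem g e he]
        constructor
        · intro h; simpa using hginj h
        · rintro rfl; rfl
      have hEW : ∀ E : Finset α, ((E ∩ W).filter fun e => ext g e = g ⟨a, ha⟩).card =
          if a ∈ E then 1 else 0 := by
        intro E
        split_ifs with haE
        · rw [Finset.card_eq_one]
          refine ⟨a, ?_⟩
          ext e
          simp only [Finset.mem_filter, Finset.mem_inter, Finset.mem_singleton]
          constructor
          · rintro ⟨⟨_, h2⟩, h3⟩; exact (single e h2).1 h3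
          · rintro rfl; exact ⟨⟨haE, ha⟩, (single e ha).2 rfl⟩
        · rw [Finset.card_eq_zero, Finset.filter_eq_empty_iff]
          intro e he h3
          rw [Finset.mem_inter] at he
          exact haE ((single e he.2).1 h3 ▸ he.1)
      rw [card_filter_split E W, card_filter_split E' W, hEW, hEW, rest E g g0, rest E' g g0]
      have hz : g ⟨a, ha⟩ ∈ Z := (f ⟨a, ha⟩).2
      simp only [hZ, Finset.mem_filter, Finset.mem_univ, true_and] at hz
      have haW := hW ha
      rw [Finset.mem_symmDiff] at haW
      unfold Nat.ModEq at hz ⊢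
      rcases haW with ⟨h1, h2⟩ | ⟨h1, h2⟩ <;> simp only [h1, h2, if_true, if_false] <;> omega
    · intro f _ f' _ hff
      ext a
      exact congrArg Fin.val (congrFun hff a)
  · -- every colouring of `W` works
    have hall : ∀ g, ℓ ≤ hammingDist (signature (ext g) E) (signature (ext g) E') := by
      intro g
      have hsub : (Finset.univ \ (Z ∪ Finset.univ.image g)).card ≤
          hammingDist (signature (ext g) E) (signature (ext g) E') := by
        apply Finset.card_le_card
        intro c hc
        simp only [Finset.mem_sdiff, Finset.mem_univ, true_and, Finset.mem_union, not_or,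
          Finset.mem_image, not_exists] at hc
        obtain ⟨hc1, hc2⟩ := hc
        simp only [Finset.mem_filter, Finset.mem_univ, true_and]
        rw [ne_eq, signature_eq_iff]
        have hEW : ∀ E : Finset α, ((E ∩ W).filter fun e => ext g e = c).card = 0 := by
          intro E
          rw [Finset.card_eq_zero, Finset.filter_eq_empty_iff]
          intro e he h3
          rw [Finset.mem_inter] at he
          rw [ext_mem g e he.2] at h3
          exact hc2 _ h3
        rw [card_filter_split E W, card_filter_split E' W, hEW, hEW, rest E g g0, rest E' g g0]
        simpa [hZ] using hc1
      refine le_trans ?_ hsub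
      have h1 := Finset.le_card_sdiff (Z ∪ Finset.univ.image g) (Finset.univ : Finset (Fin k))
      have h2 := Finset.card_union_le Z (Finset.univ.image g)
      have h3 : (Finset.univ.image g).card ≤ ℓ := by
        refine le_trans Finset.card_image_le ?_
        rw [Finset.card_univ, Fintype.card_coe, hℓ]
      rw [Finset.card_univ, Fintype.card_fin] at h1
      omega
    rw [Finset.filter_true_of_mem (fun g _ => hall g), Finset.card_univ, Fintype.card_fun,
      Fintype.card_fin, Fintype.card_coe, hℓ]
    exact le_trans (Nat.factorial_le_pow ℓ) (Nat.pow_le_pow_left (by omega) ℓ)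

/-- Summing `factorial_le_card_extensions` over all colourings of the elements outside `W`. -/
theorem factorial_mul_card_le {α : Type} [Fintype α] [DecidableEq α] {k ℓ : ℕ} (hk : 3 * ℓ ≤ k)
    (E E' : Finset α) (h : ℓ ≤ (symmDiff E E').card) :
    ℓ.factorial * Fintype.card (α → Fin k) ≤ k ^ ℓ *
      ((Finset.univ : Finset (α → Fin k)).filter fun χ =>
        ℓ ≤ hammingDist (signature χ E) (signature χ E')).card := by
  classical
  obtain ⟨W, hW, hℓ⟩ := Finset.exists_subset_card_eq h
  let e := Equiv.piEquivPiSubtypeProd (· ∈ W) (fun _ : α => Fin k)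
  have h1 : ((Finset.univ : Finset (α → Fin k)).filter fun χ =>
        ℓ ≤ hammingDist (signature χ E) (signature χ E')).card =
      ((Finset.univ : Finset (({a // a ∉ W} → Fin k) × ({a // a ∈ W} → Fin k))).filter fun p =>
        ℓ ≤ hammingDist (signature (e.symm (p.2, p.1)) E) (signature (e.symm (p.2, p.1)) E')).card := by
    refine Finset.card_equiv (e.trans (Equiv.prodComm _ _)) ?_
    intro χ
    simp
  have h2 : Fintype.card (α → Fin k) = k ^ ℓ * Fintype.card ({a // a ∉ W} → Fin k) := by
    rw [Fintype.card_congr e, Fintype.card_prod]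
    congr 1
    rw [Fintype.card_fun, Fintype.card_fin, Fintype.card_coe, hℓ]
  rw [h2, mul_left_comm]
  refine Nat.mul_le_mul_left _ ?_
  rw [h1, ← Finset.univ_product_univ, Finset.card_filter, Finset.sum_product]
  simp_rw [← Finset.card_filter]
  calc ℓ.factorial * Fintype.card ({a // a ∉ W} → Fin k)
      = ∑ _ : {a // a ∉ W} → Fin k, ℓ.factorial := by simp [mul_comm]
    _ ≤ _ := Finset.sum_le_sum fun hh _ => factorial_le_card_extensions E E' W hW hℓ hk hh

/-- The weak form `ℓ! ≥ (ℓ / 3) ^ ℓ` of the formula of Stirling. -/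
theorem pow_le_mul_factorial (ℓ : ℕ) : ℓ ^ ℓ ≤ 3 ^ ℓ * ℓ.factorial := by
  have h1 := Real.pow_div_factorial_le_exp (ℓ : ℝ) (by positivity) ℓ
  have h2 : Real.exp ℓ ≤ 3 ^ ℓ := by
    rw [← Real.exp_one_pow]
    exact pow_le_pow_left₀ (by positivity) Real.exp_one_lt_three.le _
  rw [div_le_iff₀ (by positivity)] at h1
  have h3 : (ℓ : ℝ) ^ ℓ ≤ 3 ^ ℓ * ℓ.factorial := le_trans h1 (by gcongr)
  exact_mod_cast h3

/-- A random colouring by `k` colours, where `3 ℓ ≤ k ≤ 6 ℓ`, certifies a difference of size at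
least `ℓ` with probability at least `18 ^ (-ℓ)`.  For `ℓ = 0` there is nothing to certify. -/
theorem card_colourings_le {α : Type} [Fintype α] [DecidableEq α] {k ℓ : ℕ} (hk : 3 * ℓ ≤ k)
    (hk2 : ℓ ≠ 0 → k ≤ 6 * ℓ)
    (E E' : Finset α) (h : ℓ ≤ (symmDiff E E').card) :
    Fintype.card (α → Fin k) ≤ 18 ^ ℓ *
      ((Finset.univ : Finset (α → Fin k)).filter fun χ =>
        ℓ ≤ hammingDist (signature χ E) (signature χ E')).card := by
  have h1 := factorial_mul_card_le hk E E' h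
  have h2 : k ^ ℓ ≤ 18 ^ ℓ * ℓ.factorial := by
    rcases Nat.eq_zero_or_pos ℓ with rfl | hpos
    · simp
    · calc k ^ ℓ ≤ (6 * ℓ) ^ ℓ := Nat.pow_le_pow_left (hk2 (by omega)) ℓ
        _ = 6 ^ ℓ * ℓ ^ ℓ := mul_pow _ _ _
        _ ≤ 6 ^ ℓ * (3 ^ ℓ * ℓ.factorial) := Nat.mul_le_mul_left _ (pow_le_mul_factorial ℓ)
        _ = 18 ^ ℓ * ℓ.factorial := by rw [← mul_assoc, ← mul_pow]; norm_num
  refine Nat.le_of_mul_le_mul_left ?_ (Nat.factorial_pos ℓ)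
  calc _ ≤ _ := h1
    _ ≤ _ := Nat.mul_le_mul_right _ h2
    _ = _ := by ring

end DiverseMatching

/-! ### Perfect matchings as involutions -/

namespace DiverseMatching

open Equiv

/-- The permutation `σ` exchanges the end points of each edge of a perfect matching of `G`, and
fixes the elements that are not vertices of `G`. -/
def IsPM {n : ℕ} (G : Graph n) (σ : Perm (Fin n)) : Prop :=
  (∀ x, σ (σ x) = x) ∧ ∀ x, (x ∈ G.verts → G.Adj x (σ x)) ∧ (x ∉ G.verts → σ x = x)

/-- The edges of the matching given by an involution, as pairs in increasing order. -/
def edges {n : ℕ} (σ : Perm (Fin n)) : Finset (Fin n × Fin n) :=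
  Finset.univ.filter fun e => e.1 < e.2 ∧ σ e.1 = e.2

theorem mem_edges {n : ℕ} (σ : Perm (Fin n)) (e : Fin n × Fin n) :
    e ∈ edges σ ↔ e.1 < e.2 ∧ σ e.1 = e.2 := by simp [edges]

/-- A perfect matching is determined by its edges, even by any superset that is a perfect matching. -/
theorem IsPM.eq_of_edges_subset {n : ℕ} {G : Graph n} {σ τ : Perm (Fin n)} (hσ : IsPM G σ)
    (hτ : IsPM G τ) (h : edges σ ⊆ edges τ) : σ = τ := by
  have key : ∀ x, x < σ x → σ x = τ x := fun x hx =>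
    ((mem_edges _ _).1 (h ((mem_edges _ (x, σ x)).2 ⟨hx, rfl⟩))).2.symm
  ext1 x
  by_cases hx : x ∈ G.verts
  · rcases lt_trichotomy x (σ x) with h1 | h1 | h1
    · exact key x h1
    · exact absurd h1 ((hσ.2 x).1 hx).ne
    · have := key (σ x) (by rwa [hσ.1])
      rw [hσ.1] at this
      rw [← hτ.1 (σ x), ← this]
  · rw [(hσ.2 x).2 hx, (hτ.2 x).2 hx]

theorem exists_perm_of_isPerfectMatchingOf {n : ℕ} {M G : Graph n} (h : IsPerfectMatchingOf M G) :
    ∃ σ, IsPM G σ ∧ ∀ x y, M.Adj x y ↔ x ≠ y ∧ σ x = y := by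
  classical
  obtain ⟨hle, hv, hm⟩ := h
  have hex : ∀ x, ∃ y, (x ∈ G.verts → M.Adj x y) ∧ (x ∉ G.verts → y = x) := by
    intro x
    by_cases hx : x ∈ G.verts
    · obtain ⟨y, hy, -⟩ := hm (hv ▸ hx : x ∈ M.verts)
      exact ⟨y, fun _ => hy, fun h => absurd hx h⟩
    · exact ⟨x, fun h => absurd h hx, fun _ => rfl⟩
  choose f hf using hex
  have hadj : ∀ x y, M.Adj x y → f x = y := by
    intro x y hxy
    have hx : x ∈ M.verts := M.edge_vert hxy
    exact (hm hx).unique ((hf x).1 (hv ▸ hx)) hxy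
  have hff : ∀ x, f (f x) = x := by
    intro x
    by_cases hx : x ∈ G.verts
    · exact hadj _ _ ((hf x).1 hx).symm
    · have := (hf x).2 hx
      rw [this, this]
  refine ⟨⟨f, f, hff, hff⟩, ⟨hff, fun x => ⟨fun hx => hle.2 ((hf x).1 hx), (hf x).2⟩⟩, ?_⟩
  intro x y
  refine ⟨fun hxy => ⟨hxy.ne, hadj x y hxy⟩, ?_⟩
  rintro ⟨hne, rfl⟩
  by_cases hx : x ∈ G.verts
  · exact (hf x).1 hx
  · exact absurd ((hf x).2 hx).symm hne

theorem exists_isPerfectMatchingOf_of_perm {n : ℕ} {G : Graph n} {σ : Perm (Fin n)}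
    (h : IsPM G σ) : ∃ M, IsPerfectMatchingOf M G ∧ ∀ x y, M.Adj x y ↔ x ≠ y ∧ σ x = y := by
  have hadj : ∀ x y, x ≠ y → σ x = y → G.Adj x y := by
    rintro x y hne rfl
    by_cases hx : x ∈ G.verts
    · exact (h.2 x).1 hx
    · exact absurd ((h.2 x).2 hx).symm hne
  let M : Graph n :=
    { verts := G.verts
      Adj := fun x y => x ≠ y ∧ σ x = y
      adj_sub := fun hxy => hxy.1
      edge_vert := fun {x y} hxy => G.edge_vert (hadj x y hxy.1 hxy.2)
      symm := ⟨fun x y hxy => ⟨hxy.1.symm, by rw [← hxy.2, h.1]⟩⟩ }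
  refine ⟨M, ⟨⟨subset_rfl, fun x y hxy => hadj x y hxy.1 hxy.2⟩, rfl, ?_⟩, fun x y => Iff.rfl⟩
  intro x hx
  exact ⟨σ x, ⟨((h.2 x).1 hx).ne, rfl⟩, fun y hy => hy.2.symm⟩

/-- The symmetric difference may be computed with pairs in increasing order in place of edges. -/
theorem ncard_symmDiff_edgeSet {n : ℕ} {M M' : Graph n} {σ σ' : Perm (Fin n)}
    (h : ∀ x y, M.Adj x y ↔ x ≠ y ∧ σ x = y) (h' : ∀ x y, M'.Adj x y ↔ x ≠ y ∧ σ' x = y) :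
    (symmDiff M.edgeSet M'.edgeSet).ncard = (symmDiff (edges σ) (edges σ')).card := by
  have key : ∀ (M : Graph n) (σ : Perm (Fin n)), (∀ x y, M.Adj x y ↔ x ≠ y ∧ σ x = y) →
      ∀ x y, x < y → (s(x, y) ∈ M.edgeSet ↔ (x, y) ∈ edges σ) := by
    intro M σ h x y hxy
    rw [SimpleGraph.Subgraph.mem_edgeSet, h, mem_edges]
    simp [hxy, hxy.ne]
  rw [← Set.ncard_coe_finset, ← Set.InjOn.ncard_image (f := fun e : Fin n × Fin n => s(e.1, e.2))]
  · congr 1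
    ext e
    induction e using Sym2.ind with | _ x y =>
    simp only [Set.mem_symmDiff, Set.mem_image, Finset.mem_coe, Finset.mem_symmDiff, Prod.exists]
    have hlt : ∀ x y, x < y → ((s(x, y) ∈ M.edgeSet ∧ s(x, y) ∉ M'.edgeSet ∨
        s(x, y) ∈ M'.edgeSet ∧ s(x, y) ∉ M.edgeSet) ↔ ((x, y) ∈ edges σ ∧ (x, y) ∉ edges σ' ∨
        (x, y) ∈ edges σ' ∧ (x, y) ∉ edges σ)) := by
      intro x y hxy
      rw [key M σ h x y hxy, key M' σ' h' x y hxy]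
    constructor
    · intro hm
      have hne : x ≠ y := by
        rcases hm with hm | hm
        · exact (SimpleGraph.Subgraph.mem_edgeSet.1 hm.1).ne
        · exact (SimpleGraph.Subgraph.mem_edgeSet.1 hm.1).ne
      rcases lt_or_gt_of_ne hne with hxy | hxy
      · exact ⟨x, y, (hlt x y hxy).1 hm, rfl⟩
      · rw [Sym2.eq_swap] at hm
        exact ⟨y, x, (hlt y x hxy).1 hm, Sym2.eq_swap⟩
    · rintro ⟨a, b, hab, he⟩
      rw [← he]
      have : a < b := by
        rcases hab with hab | hab
        · exact ((mem_edges _ _).1 hab.1).1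
        · exact ((mem_edges _ _).1 hab.1).1
      exact (hlt a b this).2 hab
  · rintro ⟨a, b⟩ hab ⟨c, d⟩ hcd he
    have hlt : ∀ p : Fin n × Fin n, p ∈ (↑(symmDiff (edges σ) (edges σ')) : Set (Fin n × Fin n)) →
        p.1 < p.2 := by
      intro p hp
      rw [Finset.mem_coe, Finset.mem_symmDiff] at hp
      rcases hp with hp | hp
      · exact ((mem_edges _ _).1 hp.1).1
      · exact ((mem_edges _ _).1 hp.1).1
    have h1 := hlt _ hab
    have h2 := hlt _ hcd
    simp only [Sym2.eq_iff] at he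
    rcases he with ⟨rfl, rfl⟩ | ⟨rfl, rfl⟩
    · rfl
    · exact absurd h1 h2.not_gt

/-! ### Determinants of symmetric matrices in characteristic two -/

/-- In characteristic two the terms of a permutation and of its inverse cancel in the determinant of
a symmetric matrix, so that only the involutions remain. -/
theorem det_eq_sum_involutions {n : ℕ} {R : Type} [CommRing R] [CharP R 2]
    (A : Matrix (Fin n) (Fin n) R) (hA : ∀ x y, A x y = A y x) :
    A.det = ∑ σ ∈ Finset.univ.filter (fun σ : Perm (Fin n) => ∀ x, σ (σ x) = x), ∏ x, A x (σ x) := by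
  classical
  rw [Matrix.det_apply]
  have hsign : ∀ σ : Perm (Fin n), Perm.sign σ • ∏ i, A (σ i) i = ∏ x, A x (σ x) := by
    intro σ
    have h1 : ∏ i, A (σ i) i = ∏ x, A x (σ x) := Finset.prod_congr rfl fun x _ => hA _ _
    rw [h1]
    rcases Int.units_eq_one_or (Perm.sign σ) with h | h
    · rw [h, one_smul]
    · rw [h, Units.neg_smul, one_smul, CharTwo.neg_eq]
  simp_rw [hsign]
  have hinv : ∀ (σ : Perm (Fin n)) x, σ⁻¹ (σ x) = x := fun σ x => σ.symm_apply_apply x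
  rw [← Finset.sum_filter_add_sum_filter_not Finset.univ
    (fun σ : Perm (Fin n) => ∀ x, σ (σ x) = x)]
  rw [add_eq_left]
  refine Finset.sum_involution (fun σ _ => σ⁻¹) ?_ ?_ ?_ ?_
  · intro σ _
    have : ∏ x, A x (σ⁻¹ x) = ∏ x, A x (σ x) := by
      rw [← Equiv.prod_comp σ (fun x => A x (σ⁻¹ x))]
      exact Finset.prod_congr rfl fun x _ => by rw [hinv, hA]
    rw [this, CharTwo.add_self_eq_zero]
  · intro σ hσ _ h
    rw [Finset.mem_filter] at hσ
    apply hσ.2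
    intro x
    nth_rw 1 [← h]
    exact hinv σ x
  · intro σ hσ
    rw [Finset.mem_filter] at hσ ⊢
    refine ⟨Finset.mem_univ _, fun h => hσ.2 fun x => ?_⟩
    have := h (σ (σ x))
    rw [hinv, hinv] at this
    exact this.symm
  · intro σ _; exact inv_inv σ

/-- In the term of an involution every edge contributes two equal factors. -/
theorem prod_involution {n : ℕ} {R : Type} [CommRing R]
    (A : Matrix (Fin n) (Fin n) R) (hA : ∀ x y, A x y = A y x) (σ : Perm (Fin n))
    (hσ : ∀ x, σ (σ x) = x) (h1 : ∀ x, σ x = x → A x x = 1) :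
    ∏ x, A x (σ x) = ∏ e ∈ edges σ, A e.1 e.2 ^ 2 := by
  classical
  have e1 : ∏ e ∈ edges σ, A e.1 e.2 = ∏ x ∈ Finset.univ.filter (fun x => x < σ x), A x (σ x) := by
    refine Finset.prod_bij' (fun e _ => e.1) (fun x _ => (x, σ x)) ?_ ?_ ?_ ?_ ?_
    · intro e he
      rw [mem_edges] at he
      simp [he.2, he.1]
    · intro x hx
      rw [Finset.mem_filter] at hx
      exact (mem_edges _ _).2 ⟨hx.2, rfl⟩
    · intro e he
      rw [mem_edges] at he
      simp [he.2]
    · intro x hx; rfl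
    · intro e he
      rw [mem_edges] at he
      simp [he.2]
  have e2 : ∏ x ∈ Finset.univ.filter (fun x => x < σ x), A x (σ x) =
      ∏ x ∈ Finset.univ.filter (fun x => σ x < x), A x (σ x) := by
    refine Finset.prod_bij' (fun x _ => σ x) (fun x _ => σ x) ?_ ?_ ?_ ?_ ?_
    · intro x hx; simpa [hσ] using hx
    · intro x hx; simpa [hσ] using hx
    · intro x hx; exact hσ x
    · intro x hx; exact hσ x
    · intro x hx; rw [hσ, hA]
  rw [Finset.prod_pow, sq]
  nth_rw 2 [e1]
  rw [e2, e1, ← Finset.prod_union]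
  · symm
    apply Finset.prod_subset (Finset.subset_univ _)
    intro x _ hx
    simp only [Finset.mem_union, Finset.mem_filter, Finset.mem_univ, true_and, not_or, not_lt] at hx
    have := le_antisymm hx.1 hx.2
    rw [this]; exact h1 x this
  · rw [Finset.disjoint_filter]
    intro x _ h2 h3
    exact absurd h2 h3.not_gt

open Classical in
/-- The symmetric matrix whose determinant enumerates the perfect matchings of `G`, where `wt` gives
the weights of the pairs. -/
noncomputable def tutteMatrix {n : ℕ} {R : Type} [CommRing R] (G : Graph n) (wt : Fin n × Fin n → R) :
    Matrix (Fin n) (Fin n) R := fun x y =>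
  if x = y then (if x ∈ G.verts then 0 else 1)
  else if G.Adj x y then wt (min x y, max x y) else 0

theorem tutteMatrix_symm {n : ℕ} {R : Type} [CommRing R] (G : Graph n) (wt : Fin n × Fin n → R)
    (x y : Fin n) : tutteMatrix G wt x y = tutteMatrix G wt y x := by
  simp only [tutteMatrix]
  by_cases h : x = y
  · subst h; rfl
  · rw [if_neg h, if_neg (Ne.symm h), G.adj_comm, min_comm, max_comm]

open Classical in
/-- Each perfect matching contributes the square of its weight: involutions that are not perfect
matchings of `G` contribute `0`, as the diagonal entries vanish exactly at the vertices. -/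
theorem det_tutteMatrix {n : ℕ} {R : Type} [CommRing R] [CharP R 2] (G : Graph n)
    (wt : Fin n × Fin n → R) :
    (tutteMatrix G wt).det =
      ∑ σ ∈ Finset.univ.filter (fun σ : Perm (Fin n) => IsPM G σ), ∏ e ∈ edges σ, wt e ^ 2 := by
  rw [det_eq_sum_involutions _ (tutteMatrix_symm G wt)]
  symm
  calc _ = ∑ σ ∈ Finset.univ.filter (fun σ : Perm (Fin n) => IsPM G σ),
        ∏ x, tutteMatrix G wt x (σ x) := by
        refine Finset.sum_congr rfl fun σ hσ => ?_
        rw [Finset.mem_filter] at hσ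
        obtain ⟨-, hσ1, hσ2⟩ := hσ
        rw [prod_involution _ (tutteMatrix_symm G wt) σ hσ1]
        · refine Finset.prod_congr rfl fun e he => ?_
          rw [mem_edges] at he
          obtain ⟨h1, h2⟩ := he
          have hv : e.1 ∈ G.verts := by
            by_contra hv
            rw [(hσ2 e.1).2 hv] at h2
            exact h1.ne h2
          have := (hσ2 e.1).1 hv
          rw [h2] at this
          rw [tutteMatrix, if_neg h1.ne, if_pos this, min_eq_left h1.le, max_eq_right h1.le]
        · intro x hx
          have hv : x ∉ G.verts := fun hv => ((hσ2 x).1 hv).ne hx.symm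
          rw [tutteMatrix, if_pos rfl, if_neg hv]
    _ = _ := by
        apply Finset.sum_subset
        · intro σ hσ
          rw [Finset.mem_filter] at hσ ⊢
          exact ⟨hσ.1, hσ.2.1⟩
        · intro σ hσ hσ'
          rw [Finset.mem_filter] at hσ hσ'
          by_contra hne
          refine hσ' ⟨Finset.mem_univ _, hσ.2, fun x => ?_⟩
          have hx : tutteMatrix G wt x (σ x) ≠ 0 :=
            fun h0 => hne (Finset.prod_eq_zero (Finset.mem_univ x) h0)
          rw [tutteMatrix] at hx
          split_ifs at hx with h1 h2 h3
          · exact absurd rfl hx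
          · exact ⟨fun h => absurd h h2, fun _ => h1.symm⟩
          · exact ⟨fun _ => h3, fun h => absurd (G.edge_vert h3) h⟩
          · exact absurd rfl hx

end DiverseMatching

/-! ### Testing for a perfect matching of given signatures -/

namespace DiverseMatching

open Equiv

/-- The value at `u` of the character of `(ℤ/3)^k` given by `s`, where `ω` is a cube root of
unity. -/
def pairing {F : Type} [CommRing F] (ω : F) {k : ℕ} (s u : Fin k → Fin 3) : F :=
  ∏ c, ω ^ ((s c : ℕ) * (u c : ℕ))

theorem pow_three_eq_one {F : Type} [CommRing F] {ω : F} (hω : ω ^ 2 + ω + 1 = 0) : ω ^ 3 = 1 := by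
  linear_combination (ω - 1) * hω

/-- Orthogonality of the characters of `ℤ/3`.  Weights of edges enter the determinant squared, hence
the square; no factor `1 / 3` is needed, because `3 = 1` in characteristic two. -/
theorem sum_three_pow {F : Type} [CommRing F] [CharP F 2] {ω : F} (hω : ω ^ 2 + ω + 1 = 0)
    (u m : ℕ) : ∑ d : Fin 3, ω ^ ((d : ℕ) * u) * ((ω ^ (d : ℕ)) ^ 2) ^ m =
      if m % 3 = u % 3 then 1 else 0 := by
  have h3 := pow_three_eq_one hω
  have h2 : (1 : F) + 1 = 0 := CharTwo.add_self_eq_zero 1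
  have hpow : ∀ a, ω ^ a = ω ^ (a % 3) := by
    intro a
    conv_lhs => rw [← Nat.div_add_mod a 3, pow_add, pow_mul, h3, one_pow, one_mul]
  simp only [← pow_mul, ← pow_add]
  rw [Fin.sum_univ_three, hpow ((1 : Fin 3) * u + _), hpow ((2 : Fin 3) * u + _)]
  have e0 : ((0 : Fin 3) : ℕ) = 0 := rfl
  have e1 : ((1 : Fin 3) : ℕ) = 1 := rfl
  have e2 : ((2 : Fin 3) : ℕ) = 2 := rfl
  rw [e0, e1, e2]
  have hu := Nat.mod_lt u (by norm_num : 3 > 0)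
  have hm := Nat.mod_lt m (by norm_num : 3 > 0)
  generalize hu' : u % 3 = u' at *
  generalize hm' : m % 3 = m' at *
  have f1 : (1 * u + 1 * 2 * m) % 3 = (u' + 2 * m') % 3 := by omega
  have f2 : (2 * u + 2 * 2 * m) % 3 = (2 * u' + m') % 3 := by omega
  rw [f1, f2]
  interval_cases u' <;> interval_cases m' <;> simp <;>
    first | linear_combination h2 | linear_combination hω

/-- Orthogonality of the characters of `(ℤ/3)^k`. -/
theorem sum_pairing {F : Type} [CommRing F] [CharP F 2] {ω : F} (hω : ω ^ 2 + ω + 1 = 0)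
    {α : Type} {k : ℕ} (χ : α → Fin k) (E : Finset α) (u : Fin k → Fin 3) :
    ∑ s : Fin k → Fin 3, pairing ω s u * ∏ e ∈ E, (ω ^ (s (χ e) : ℕ)) ^ 2 =
      if signature χ E = u then 1 else 0 := by
  classical
  have h1 : ∀ s : Fin k → Fin 3, pairing ω s u * ∏ e ∈ E, (ω ^ (s (χ e) : ℕ)) ^ 2 =
      ∏ c, ω ^ ((s c : ℕ) * (u c : ℕ)) *
        ((ω ^ (s c : ℕ)) ^ 2) ^ (E.filter fun e => χ e = c).card := by
    intro s
    rw [Finset.prod_mul_distrib, pairing]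
    congr 1
    rw [← Finset.prod_fiberwise_of_maps_to (g := χ) (t := Finset.univ) fun _ _ => Finset.mem_univ _]
    refine Finset.prod_congr rfl fun c _ => ?_
    rw [← Finset.prod_const]
    refine Finset.prod_congr rfl fun e he => ?_
    rw [(Finset.mem_filter.1 he).2]
  simp_rw [h1]
  have h2 := Finset.prod_univ_sum (fun _ : Fin k => (Finset.univ : Finset (Fin 3)))
    (fun c d => ω ^ ((d : ℕ) * (u c : ℕ)) * ((ω ^ (d : ℕ)) ^ 2) ^ (E.filter fun e => χ e = c).card)
  rw [Fintype.piFinset_univ] at h2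
  rw [← h2]
  simp_rw [sum_three_pow hω]
  rw [Finset.prod_ite_zero]
  simp only [Finset.prod_const_one]
  have h3 : (∀ i ∈ Finset.univ, (E.filter fun e => χ e = i).card % 3 = (u i : ℕ) % 3) ↔
      signature χ E = u := by
    rw [funext_iff]
    refine ⟨fun h c => ?_, fun h c _ => ?_⟩
    · have := h c (Finset.mem_univ _)
      rw [Nat.mod_eq_of_lt (u c).2] at this
      simpa [signature, Fin.ext_iff] using this
    · rw [← h c]
      simp [signature]
  simp only [h3]

/-- The sum over all pairs of characters that filters out, of all perfect matchings of `G`, those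
whose signatures with respect to `χ` and `χ'` are `u` and `v`. -/
noncomputable def testValue {F : Type} [CommRing F] (ω : F) {n k : ℕ} (G : Graph n)
    (ρ : Fin n × Fin n → F) (χ χ' : Fin n × Fin n → Fin k) (u v : Fin k → Fin 3) : F :=
  ∑ s : Fin k → Fin 3, ∑ s' : Fin k → Fin 3, pairing ω s u * pairing ω s' v *
    (tutteMatrix G fun e => ρ e * ω ^ (s (χ e) : ℕ) * ω ^ (s' (χ' e) : ℕ)).det

open Classical in
/-- The perfect matchings of `G` with given signatures. -/
noncomputable def matchingsWith {n k : ℕ} (G : Graph n) (χ χ' : Fin n × Fin n → Fin k)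
    (u v : Fin k → Fin 3) : Finset (Perm (Fin n)) :=
  Finset.univ.filter fun σ => IsPM G σ ∧ signature χ (edges σ) = u ∧ signature χ' (edges σ) = v

/-- The test value is the square of the sum of the weights of the matchings with the given
signatures; in characteristic two, a sum of squares is the square of the sum. -/
theorem testValue_eq {F : Type} [CommRing F] [CharP F 2] {ω : F} (hω : ω ^ 2 + ω + 1 = 0) {n k : ℕ}
    (G : Graph n) (ρ : Fin n × Fin n → F) (χ χ' : Fin n × Fin n → Fin k) (u v : Fin k → Fin 3) :
    testValue ω G ρ χ χ' u v = (∑ σ ∈ matchingsWith G χ χ' u v, ∏ e ∈ edges σ, ρ e) ^ 2 := by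
  classical
  have h1 : testValue ω G ρ χ χ' u v =
      ∑ σ ∈ Finset.univ.filter (fun σ : Perm (Fin n) => IsPM G σ), (∏ e ∈ edges σ, ρ e) ^ 2 *
        ((∑ s : Fin k → Fin 3, pairing ω s u * ∏ e ∈ edges σ, (ω ^ (s (χ e) : ℕ)) ^ 2) *
        (∑ s : Fin k → Fin 3, pairing ω s v * ∏ e ∈ edges σ, (ω ^ (s (χ' e) : ℕ)) ^ 2)) := by
    simp_rw [testValue, det_tutteMatrix, Finset.sum_mul_sum, Finset.mul_sum]
    symm
    rw [Finset.sum_comm]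
    refine Finset.sum_congr rfl fun s _ => ?_
    rw [Finset.sum_comm]
    refine Finset.sum_congr rfl fun s' _ => Finset.sum_congr rfl fun σ _ => ?_
    simp only [mul_pow, Finset.prod_mul_distrib, Finset.prod_pow]
    ring
  rw [h1, CharTwo.sum_sq]
  simp_rw [sum_pairing hω]
  rw [matchingsWith, ← Finset.filter_filter, Finset.sum_filter (fun σ => _ ∧ _)]
  refine Finset.sum_congr rfl fun σ _ => ?_
  by_cases h2 : signature χ (edges σ) = u <;> by_cases h3 : signature χ' (edges σ) = v <;>
    simp [h2, h3]

/-- The polynomial, in one variable for each pair, that enumerates a set of matchings. -/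
noncomputable def matchingPoly (F : Type) [CommRing F] {n : ℕ} (S : Finset (Perm (Fin n))) :
    MvPolynomial (Fin (n * n)) F :=
  ∑ σ ∈ S, ∏ e ∈ edges σ, MvPolynomial.X (finProdFinEquiv e)

theorem eval_matchingPoly {F : Type} [CommRing F] {n : ℕ} (S : Finset (Perm (Fin n)))
    (r : Fin (n * n) → F) : MvPolynomial.eval r (matchingPoly F S) =
      ∑ σ ∈ S, ∏ e ∈ edges σ, r (finProdFinEquiv e) := by
  simp [matchingPoly]

theorem card_edges_le {n : ℕ} (σ : Perm (Fin n)) : (edges σ).card ≤ n := by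
  calc (edges σ).card ≤ (Finset.univ : Finset (Fin n)).card := by
        refine Finset.card_le_card_of_injOn (fun e => e.1) (fun _ _ => Finset.mem_coe.2 (Finset.mem_univ _)) ?_
        intro e he e' he' h
        have h1 := (mem_edges _ _).1 (Finset.mem_coe.1 he)
        have h2 := (mem_edges _ _).1 (Finset.mem_coe.1 he')
        refine Prod.ext h ?_
        rw [← h1.2, ← h2.2]
        exact congrArg σ h
    _ = n := by simp

theorem totalDegree_matchingPoly_le (F : Type) [Field F] {n : ℕ} (S : Finset (Perm (Fin n))) :
    (matchingPoly F S).totalDegree ≤ n := by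
  refine MvPolynomial.totalDegree_finsetSum_le fun σ _ => ?_
  refine le_trans (MvPolynomial.totalDegree_finsetProd _ _) ?_
  refine le_trans (Finset.sum_le_card_nsmul _ _ 1 fun e _ => ?_) (by simpa using card_edges_le σ)
  exact (MvPolynomial.totalDegree_X _).le

/-- Different matchings have different monomials. -/
theorem matchingPoly_ne_zero (F : Type) [Field F] {n : ℕ} (G : Graph n) {S : Finset (Perm (Fin n))}
    (hS : ∀ σ ∈ S, IsPM G σ) {σ₀ : Perm (Fin n)} (h₀ : σ₀ ∈ S) : matchingPoly F S ≠ 0 := by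
  classical
  -- evaluation at the indicator vector of a set of pairs keeps the matchings inside that set
  intro h
  have h1 : MvPolynomial.eval
      (fun i => if finProdFinEquiv.symm i ∈ edges σ₀ then (1 : F) else 0) (matchingPoly F S) = 1 := by
    rw [eval_matchingPoly, Finset.sum_eq_single_of_mem σ₀ h₀]
    · refine Finset.prod_eq_one fun e he => ?_
      simp [he]
    · intro σ hσ hne
      obtain ⟨e, he, he'⟩ : ∃ e ∈ edges σ, e ∉ edges σ₀ := by
        by_contra hcon
        push Not at hcon
        exact hne ((hS σ hσ).eq_of_edges_subset (hS σ₀ h₀) hcon)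
      exact Finset.prod_eq_zero he (by simp [he'])
  rw [h, map_zero] at h1
  exact zero_ne_one h1

/-- For random weights from `F` the test overlooks a matching with probability at most
`n / |F|`. -/
theorem card_testValue_eq_zero_le {F : Type} [Field F] [Fintype F] [DecidableEq F] [CharP F 2]
    {ω : F} (hω : ω ^ 2 + ω + 1 = 0) {n k : ℕ} (G : Graph n) (χ χ' : Fin n × Fin n → Fin k)
    (u v : Fin k → Fin 3) {σ₀ : Perm (Fin n)} (h₀ : σ₀ ∈ matchingsWith G χ χ' u v) :
    (Finset.univ.filter fun r : Fin (n * n) → F =>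
      testValue ω G (fun e => r (finProdFinEquiv e)) χ χ' u v = 0).card * Fintype.card F ≤
    n * Fintype.card (Fin (n * n) → F) := by
  classical
  have hne : matchingPoly F (matchingsWith G χ χ' u v) ≠ 0 :=
    matchingPoly_ne_zero F G (fun σ hσ => (Finset.mem_filter.1 hσ).2.1) h₀
  have h1 := MvPolynomial.schwartz_zippel_totalDegree hne (Finset.univ : Finset F)
  rw [Fintype.piFinset_univ] at h1
  have hF : 0 < Fintype.card F := Fintype.card_pos
  have h2 : (Finset.univ.filter fun r : Fin (n * n) → F =>
      testValue ω G (fun e => r (finProdFinEquiv e)) χ χ' u v = 0) =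
      Finset.univ.filter fun r : Fin (n * n) → F =>
        MvPolynomial.eval r (matchingPoly F (matchingsWith G χ χ' u v)) = 0 := by
    refine Finset.filter_congr fun r _ => ?_
    rw [testValue_eq hω, eval_matchingPoly, pow_eq_zero_iff two_ne_zero]
  rw [h2, Fintype.card_fun, Fintype.card_fin]
  rw [Finset.card_univ, div_le_div_iff₀ (by positivity) (by positivity)] at h1
  have h3 : (((Finset.univ.filter fun r : Fin (n * n) → F =>
        MvPolynomial.eval r (matchingPoly F (matchingsWith G χ χ' u v)) = 0).card *
          Fintype.card F : ℕ) : ℚ≥0) ≤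
      (((matchingPoly F (matchingsWith G χ χ' u v)).totalDegree * Fintype.card F ^ (n * n) : ℕ) : ℚ≥0) := by
    push_cast; exact h1
  exact le_trans (by exact_mod_cast h3) (Nat.mul_le_mul_right _ (totalDegree_matchingPoly_le F _))

end DiverseMatching

/-! ### Reachable signatures -/

namespace DiverseMatching

open Equiv

/-- `Reachable ω G ℓ ρ χ i b v` is what dynamic programming with the test computes after `i`
stages: there are tests that succeed for the stages before `i`, with signatures certifying that
consecutive matchings differ in `ℓ` edges, the last of them with signature `v` for the colouring
`b`. -/
def Reachable {F : Type} [CommRing F] (ω : F) {n k N : ℕ} (G : ℕ → Graph n) (ℓ : ℕ)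
    (ρ : Fin n × Fin n → F) (χ : Fin N → Fin n × Fin n → Fin k) :
    ℕ → Fin N → (Fin k → Fin 3) → Prop
  | 0, _, _ => True
  | i + 1, b, v => ∃ a u, testValue ω (G i) ρ (χ a) (χ b) u v ≠ 0 ∧
      ∃ w, Reachable ω G ℓ ρ χ i a w ∧ ℓ ≤ hammingDist w u

/-- Whatever the random choices are, a reachable signature comes from matchings that are as
diverse as required: a nonzero test value exhibits a matching with the given signatures, and
signatures at distance `ℓ` prove a difference of `ℓ` edges.  So the error is one-sided. -/
theorem Reachable.sound {F : Type} [CommRing F] [CharP F 2] {ω : F} (hω : ω ^ 2 + ω + 1 = 0)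
    {n k N : ℕ} {G : ℕ → Graph n} {ℓ : ℕ} {ρ : Fin n × Fin n → F}
    {χ : Fin N → Fin n × Fin n → Fin k} (i : ℕ) : ∀ (b : Fin N) (v : Fin k → Fin 3),
    Reachable ω G ℓ ρ χ i b v → ∃ σ : ℕ → Perm (Fin n), (∀ j < i, IsPM (G j) (σ j)) ∧
      (∀ j, j + 1 < i → ℓ ≤ (symmDiff (edges (σ j)) (edges (σ (j + 1)))).card) ∧
      (i ≠ 0 → signature (χ b) (edges (σ (i - 1))) = v) := by
  classical
  induction i with
  | zero => intro b v _; exact ⟨fun _ => 1, by simp, by simp, by simp⟩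
  | succ i ih =>
    rintro b v ⟨a, u, htest, w, hw, hdist⟩
    obtain ⟨σ, h1, h2, h3⟩ := ih a w hw
    rw [testValue_eq hω] at htest
    have hsum : ∑ σ ∈ matchingsWith (G i) (χ a) (χ b) u v, ∏ e ∈ edges σ, ρ e ≠ 0 :=
      fun h => htest (by rw [h, zero_pow two_ne_zero])
    obtain ⟨σ', hσ', -⟩ := Finset.exists_ne_zero_of_sum_ne_zero hsum
    obtain ⟨-, hP, hu, hv⟩ := Finset.mem_filter.1 hσ'
    refine ⟨Function.update σ i σ', ?_, ?_, ?_⟩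
    · intro j hj
      rcases Nat.lt_succ_iff_lt_or_eq.1 hj with h | rfl
      · rw [Function.update_of_ne h.ne]; exact h1 j h
      · rw [Function.update_self]; exact hP
    · intro j hj
      rw [Function.update_of_ne (by omega)]
      rcases Nat.lt_succ_iff_lt_or_eq.1 hj with h | h
      · rw [Function.update_of_ne h.ne]; exact h2 j h
      · rw [h, Function.update_self]
        have h3' := h3 (by omega)
        rw [show i - 1 = j by omega] at h3'
        refine le_trans ?_ (hammingDist_signature_le (χ a) _ _)
        rw [h3', hu]; exact hdist
    · intro _
      rw [Nat.add_sub_cancel, Function.update_self]; exact hv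

/-- A solution is found if the colouring `χ (a (j + 1))` certifies the difference between the stages
`j` and `j + 1`, and no test that is needed for the solution fails. -/
theorem Reachable.complete {F : Type} [CommRing F] {ω : F}
    {n k N : ℕ} {G : ℕ → Graph n} {ℓ : ℕ} {ρ : Fin n × Fin n → F}
    {χ : Fin N → Fin n × Fin n → Fin k} (hk : ℓ ≤ k) (σ : ℕ → Perm (Fin n)) (a : ℕ → Fin N)
    (i : ℕ)
    (hdist : ∀ j, j + 1 < i →
      ℓ ≤ hammingDist (signature (χ (a (j + 1))) (edges (σ j)))
        (signature (χ (a (j + 1))) (edges (σ (j + 1)))))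
    (htest : ∀ j < i, testValue ω (G j) ρ (χ (a j)) (χ (a (j + 1)))
      (signature (χ (a j)) (edges (σ j))) (signature (χ (a (j + 1))) (edges (σ j))) ≠ 0) :
    ∃ v, Reachable ω G ℓ ρ χ i (a i) v ∧ (i ≠ 0 → v = signature (χ (a i)) (edges (σ (i - 1)))) := by
  induction i with
  | zero => exact ⟨fun _ => 0, trivial, fun h => absurd rfl h⟩
  | succ i ih =>
    obtain ⟨v, hv, hv'⟩ := ih (fun j hj => hdist j (by omega)) (fun j hj => htest j (by omega))
    refine ⟨_, ⟨a i, _, htest i (by omega), ?_⟩, fun _ => rfl⟩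
    by_cases hi : i = 0
    · subst hi
      -- before the first stage all signatures are reachable, also one that differs everywhere
      refine ⟨fun c => signature (χ (a 0)) (edges (σ 0)) c + 1, trivial, le_trans hk (le_of_eq ?_)⟩
      rw [hammingDist, Finset.filter_true_of_mem, Finset.card_univ, Fintype.card_fin]
      intro c _
      generalize signature (χ (a 0)) (edges (σ 0)) c = y
      revert y; decide
    · refine ⟨v, hv, ?_⟩
      rw [hv' hi]
      obtain ⟨j, rfl⟩ : ∃ j, i = j + 1 := ⟨i - 1, by omega⟩
      exact hdist j (by omega)

/-- The graphs of an instance as an infinite sequence. -/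
def Instance.graph (J : Instance) (i : ℕ) : Graph J.n := if h : i < J.τ then J.G ⟨i, h⟩ else ⊥

theorem Instance.isYes_iff (J : Instance) : J.IsYes ↔ ∃ σ : ℕ → Perm (Fin J.n),
    (∀ j < J.τ, IsPM (J.graph j) (σ j)) ∧
    ∀ j, j + 1 < J.τ → J.ℓ ≤ (symmDiff (edges (σ j)) (edges (σ (j + 1)))).card := by
  constructor
  · rintro ⟨M, h1, h2⟩
    choose σ hσ hσ' using fun i => exists_perm_of_isPerfectMatchingOf (h1 i)
    refine ⟨fun j => if h : j < J.τ then σ ⟨j, h⟩ else 1, ?_, ?_⟩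
    · intro j hj
      simp only [Instance.graph, dif_pos hj]
      exact hσ _
    · intro j hj
      simp only [dif_pos hj, dif_pos (show j < J.τ by omega)]
      rw [← ncard_symmDiff_edgeSet (hσ' _) (hσ' _)]
      exact h2 _ _ rfl
  · rintro ⟨σ, h1, h2⟩
    have h1' : ∀ i : Fin J.τ, IsPM (J.G i) (σ i) := by
      intro i
      have := h1 i i.2
      rwa [Instance.graph, dif_pos i.2] at this
    choose M hM hM' using fun i => exists_isPerfectMatchingOf_of_perm (h1' i)
    refine ⟨M, hM, ?_⟩
    intro i j hij
    rw [ncard_symmDiff_edgeSet (hM' i) (hM' j), hij]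
    exact h2 _ (by have := j.2; omega)

/-! ### The error probability -/

theorem pow_one_sub_le {p : ℝ} (hp : 0 < p) (hp1 : p ≤ 1) {N : ℕ} (hN : 0 < N) :
    (1 - p) ^ N ≤ 1 / (p * N) := by
  have h1 : (1 - p) ^ N * (1 + p) ^ N ≤ 1 := by
    rw [← mul_pow]
    exact pow_le_one₀ (by nlinarith) (by nlinarith)
  have h2 : 1 + (N : ℝ) * p ≤ (1 + p) ^ N := one_add_mul_le_pow (by linarith) N
  have h3 : 0 ≤ (1 - p) ^ N := pow_nonneg (by linarith) N
  rw [le_div_iff₀ (by positivity)]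
  nlinarith

/-- Independent trials, by counting: if a property holds for at least a fraction `p` of all elements
then it fails for all entries of at most a fraction `1 / (p * N)` of all `N`-tuples. -/
theorem card_forall_not_le {β : Type} [Fintype β] [DecidableEq β] (P : β → Prop)
    [DecidablePred P] {p : ℝ} (hp : 0 < p) (hp1 : p ≤ 1) {N : ℕ} (hN : 0 < N)
    (h : p * Fintype.card β ≤ (Finset.univ.filter P).card) :
    ((Finset.univ.filter fun χ : Fin N → β => ∀ a, ¬ P (χ a)).card : ℝ) ≤
      1 / (p * N) * Fintype.card (Fin N → β) := by
  have h1 : (Finset.univ.filter fun χ : Fin N → β => ∀ a, ¬ P (χ a)) =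
      Fintype.piFinset fun _ => Finset.univ.filter fun x => ¬ P x := by
    ext χ; simp
  have h2 : ((Finset.univ.filter fun x => ¬ P x).card : ℝ) ≤ (1 - p) * Fintype.card β := by
    have := Finset.card_filter_add_card_filter_not (s := (Finset.univ : Finset β)) P
    rw [Finset.card_univ] at this
    have h3 : ((Finset.univ.filter P).card : ℝ) + (Finset.univ.filter fun x => ¬ P x).card =
      Fintype.card β := by exact_mod_cast this
    linarith
  rw [h1, Fintype.card_piFinset, Finset.prod_const, Finset.card_univ, Fintype.card_fin,
    Fintype.card_fun, Fintype.card_fin]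
  push_cast
  calc _ ≤ ((1 - p) * Fintype.card β) ^ N := pow_le_pow_left₀ (by positivity) h2 N
    _ = (1 - p) ^ N * (Fintype.card β : ℝ) ^ N := mul_pow _ _ _
    _ ≤ _ := mul_le_mul_of_nonneg_right (pow_one_sub_le hp hp1 hN) (by positivity)

open Classical in
/-- For all but a small fraction of the random choices, the dynamic programme gives the correct
answer. -/
theorem card_correct_ge (J : Instance) {F : Type} [Field F] [Fintype F] [CharP F 2]
    {ω : F} (hω : ω ^ 2 + ω + 1 = 0) {k N c : ℕ} (hc : 0 < c)
    (hk : 3 * J.ℓ ≤ k) (hk2 : J.ℓ ≠ 0 → k ≤ 6 * J.ℓ)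
    (hN : N = c * (J.τ + 1) * 18 ^ J.ℓ)
    (hF : c * (J.n + 1) * (J.τ + 1) ≤ Fintype.card F) :
    (1 - 2 / (c : ℝ)) *
      Fintype.card ((Fin N → Fin J.n × Fin J.n → Fin k) × (Fin (J.n * J.n) → F)) ≤
    (Finset.univ.filter fun x : (Fin N → Fin J.n × Fin J.n → Fin k) × (Fin (J.n * J.n) → F) =>
      (J.IsYes ↔ ∃ b v, Reachable ω J.graph J.ℓ (fun e => x.2 (finProdFinEquiv e)) x.1
        J.τ b v)).card := by
  have hNpos : 0 < N := by rw [hN]; positivity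
  have : NeZero N := ⟨hNpos.ne'⟩
  have hcR : (0 : ℝ) < c := by exact_mod_cast hc
  by_cases hyes : J.IsYes
  swap
  · rw [Finset.filter_true_of_mem, Finset.card_univ]
    · have : (0 : ℝ) ≤ 2 / c * Fintype.card ((Fin N → Fin J.n × Fin J.n → Fin k) × (Fin (J.n * J.n) → F)) := by
        positivity
      linarith
    · intro x _
      refine ⟨fun h => absurd h hyes, ?_⟩
      rintro ⟨b, v, h⟩
      obtain ⟨σ, h1, h2, -⟩ := h.sound hω
      exact absurd (J.isYes_iff.2 ⟨σ, h1, h2⟩) hyes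
  obtain ⟨σ, h1, h2⟩ := J.isYes_iff.1 hyes
  set Ω₁ := Fin N → Fin J.n × Fin J.n → Fin k
  set Ω₂ := Fin (J.n * J.n) → F
  set goodCol : ℕ → (Fin J.n × Fin J.n → Fin k) → Prop := fun j χ =>
    J.ℓ ≤ hammingDist (signature χ (edges (σ j))) (signature χ (edges (σ (j + 1))))
  -- the colouring used between the stages `j - 1` and `j`
  set pick : Ω₁ → ℕ → Fin N := fun χ j =>
    if h : ∃ a, goodCol (j - 1) (χ a) then h.choose else 0 with hpick
  set bad₁ : Finset Ω₁ := (Finset.range J.τ).biUnion fun j =>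
    if j + 1 < J.τ then Finset.univ.filter fun χ => ∀ a, ¬ goodCol j (χ a) else ∅ with hbad₁
  set bad₂ : Ω₁ → Finset Ω₂ := fun χ => (Finset.range J.τ).biUnion fun j =>
    Finset.univ.filter fun r => testValue ω (J.graph j) (fun e => r (finProdFinEquiv e))
      (χ (pick χ j)) (χ (pick χ (j + 1))) (signature (χ (pick χ j)) (edges (σ j)))
      (signature (χ (pick χ (j + 1))) (edges (σ j))) = 0 with hbad₂
  have hb1 : (bad₁.card : ℝ) ≤ 1 / c * Fintype.card Ω₁ := by
    have step : ∀ j ∈ Finset.range J.τ, (((if j + 1 < J.τ then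
        Finset.univ.filter fun χ : Ω₁ => ∀ a, ¬ goodCol j (χ a) else ∅ : Finset Ω₁).card : ℕ) : ℝ) ≤
        1 / (c * (J.τ + 1)) * Fintype.card Ω₁ := by
      intro j hj
      split_ifs with hj'
      · have hcol := card_colourings_le hk hk2 _ _ (h2 j hj')
        have hcol' : ((18 : ℝ) ^ J.ℓ)⁻¹ * Fintype.card (Fin J.n × Fin J.n → Fin k) ≤
            (Finset.univ.filter (goodCol j)).card := by
          rw [inv_mul_le_iff₀ (by positivity)]
          exact_mod_cast hcol
        refine le_trans (card_forall_not_le (goodCol j) (by positivity)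
          (inv_le_one_of_one_le₀ (one_le_pow₀ (by norm_num))) hNpos hcol') ?_
        refine mul_le_mul_of_nonneg_right (le_of_eq ?_) (by positivity)
        rw [hN]; push_cast
        field_simp
      · simp only [Finset.card_empty, Nat.cast_zero]; positivity
    calc (bad₁.card : ℝ) ≤ ∑ j ∈ Finset.range J.τ, (((if j + 1 < J.τ then
        Finset.univ.filter fun χ : Ω₁ => ∀ a, ¬ goodCol j (χ a) else ∅ : Finset Ω₁).card : ℕ) : ℝ) := by
          exact_mod_cast Finset.card_biUnion_le
      _ ≤ ∑ j ∈ Finset.range J.τ, 1 / (c * (J.τ + 1)) * (Fintype.card Ω₁ : ℝ) := Finset.sum_le_sum step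
      _ = (J.τ / (J.τ + 1)) * (1 / c * Fintype.card Ω₁) := by
          rw [Finset.sum_const, Finset.card_range, nsmul_eq_mul]; field_simp
      _ ≤ 1 * (1 / c * Fintype.card Ω₁) := by
          refine mul_le_mul_of_nonneg_right ?_ (by positivity)
          rw [div_le_one (by positivity)]; linarith
      _ = _ := one_mul _
  have hb2 : ∀ χ, ((bad₂ χ).card : ℝ) ≤ 1 / c * Fintype.card Ω₂ := by
    intro χ
    have hFpos : (0 : ℝ) < Fintype.card F := by exact_mod_cast Fintype.card_pos
    have hF' : (c : ℝ) * (J.n + 1) * (J.τ + 1) ≤ Fintype.card F := by exact_mod_cast hF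
    have step : ∀ j ∈ Finset.range J.τ, (((Finset.univ.filter fun r : Ω₂ =>
        testValue ω (J.graph j) (fun e => r (finProdFinEquiv e))
        (χ (pick χ j)) (χ (pick χ (j + 1))) (signature (χ (pick χ j)) (edges (σ j)))
        (signature (χ (pick χ (j + 1))) (edges (σ j))) = 0).card : ℕ) : ℝ) ≤
        1 / (c * (J.τ + 1)) * Fintype.card Ω₂ := by
      intro j hj
      have hmem : σ j ∈ matchingsWith (J.graph j) (χ (pick χ j)) (χ (pick χ (j + 1)))
          (signature (χ (pick χ j)) (edges (σ j))) (signature (χ (pick χ (j + 1))) (edges (σ j))) :=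
        Finset.mem_filter.2 ⟨Finset.mem_univ _, h1 j (Finset.mem_range.1 hj), rfl, rfl⟩
      have h3 := card_testValue_eq_zero_le hω _ _ _ _ _ hmem
      have h4 : (((Finset.univ.filter fun r : Ω₂ =>
        testValue ω (J.graph j) (fun e => r (finProdFinEquiv e))
        (χ (pick χ j)) (χ (pick χ (j + 1))) (signature (χ (pick χ j)) (edges (σ j)))
        (signature (χ (pick χ (j + 1))) (edges (σ j))) = 0).card : ℕ) : ℝ) * Fintype.card F ≤
        J.n * Fintype.card Ω₂ := by exact_mod_cast h3
      rw [← le_div_iff₀ hFpos] at h4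
      refine le_trans h4 ?_
      rw [div_le_iff₀ hFpos]
      have h5 : (J.n : ℝ) ≤ 1 / (c * (J.τ + 1)) * Fintype.card F := by
        rw [one_div, le_inv_mul_iff₀ (by positivity)]
        have : (0 : ℝ) ≤ c * (J.τ + 1) := by positivity
        nlinarith
      calc (J.n : ℝ) * Fintype.card Ω₂ ≤ (1 / (c * (J.τ + 1)) * Fintype.card F) * Fintype.card Ω₂ :=
            mul_le_mul_of_nonneg_right h5 (by positivity)
        _ = _ := by ring
    calc ((bad₂ χ).card : ℝ) ≤ ∑ j ∈ Finset.range J.τ, (((Finset.univ.filter fun r : Ω₂ =>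
        testValue ω (J.graph j) (fun e => r (finProdFinEquiv e))
        (χ (pick χ j)) (χ (pick χ (j + 1))) (signature (χ (pick χ j)) (edges (σ j)))
        (signature (χ (pick χ (j + 1))) (edges (σ j))) = 0).card : ℕ) : ℝ) := by
          exact_mod_cast Finset.card_biUnion_le
      _ ≤ ∑ j ∈ Finset.range J.τ, 1 / (c * (J.τ + 1)) * (Fintype.card Ω₂ : ℝ) := Finset.sum_le_sum step
      _ = (J.τ / (J.τ + 1)) * (1 / c * Fintype.card Ω₂) := by
          rw [Finset.sum_const, Finset.card_range, nsmul_eq_mul]; field_simp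
      _ ≤ 1 * (1 / c * Fintype.card Ω₂) := by
          refine mul_le_mul_of_nonneg_right ?_ (by positivity)
          rw [div_le_one (by positivity)]; linarith
      _ = _ := one_mul _
  -- choices outside the two bad events are fine
  have hgood : ∀ x : Ω₁ × Ω₂, x.1 ∉ bad₁ → x.2 ∉ bad₂ x.1 →
      ∃ b v, Reachable ω J.graph J.ℓ (fun e => x.2 (finProdFinEquiv e)) x.1 J.τ b v := by
    rintro ⟨χ, r⟩ hx1 hx2
    simp only [hbad₁, Finset.mem_biUnion, Finset.mem_range, not_exists, not_and] at hx1
    simp only [hbad₂, Finset.mem_biUnion, Finset.mem_range, not_exists, not_and,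
      Finset.mem_filter, Finset.mem_univ, true_and] at hx2
    obtain ⟨v, hv, -⟩ := Reachable.complete (ω := ω) (G := J.graph)
      (ρ := fun e => r (finProdFinEquiv e)) (χ := χ) (show J.ℓ ≤ k by omega) σ (pick χ) J.τ
      (by
        intro j hj
        have h3 := hx1 j (by omega)
        rw [if_pos hj, Finset.mem_filter] at h3
        simp only [Finset.mem_univ, true_and, not_forall, not_not] at h3
        have h4 : ∃ a, goodCol (j + 1 - 1) (χ a) := h3
        have h5 : pick χ (j + 1) = h4.choose := by simp only [hpick, dif_pos h4]
        rw [h5]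
        exact h4.choose_spec)
      (fun j hj => hx2 j hj)
    exact ⟨_, v, hv⟩
  have hcount : (Finset.univ : Finset (Ω₁ × Ω₂)) ⊆
      (Finset.univ.filter fun x : Ω₁ × Ω₂ => (J.IsYes ↔ ∃ b v,
        Reachable ω J.graph J.ℓ (fun e => x.2 (finProdFinEquiv e)) x.1 J.τ b v)) ∪
      (bad₁ ×ˢ Finset.univ ∪ (Finset.univ : Finset Ω₁).biUnion fun χ => {χ} ×ˢ bad₂ χ) := by
    intro x _
    by_cases hx1 : x.1 ∈ bad₁
    · simp [hx1]
    by_cases hx2 : x.2 ∈ bad₂ x.1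
    · refine Finset.mem_union_right _ (Finset.mem_union_right _ ?_)
      rw [Finset.mem_biUnion]
      exact ⟨x.1, Finset.mem_univ _, by simp [hx2]⟩
    · exact Finset.mem_union_left _ (Finset.mem_filter.2
        ⟨Finset.mem_univ _, ⟨fun _ => hgood x hx1 hx2, fun _ => hyes⟩⟩)
  have h3 := Finset.card_le_card hcount
  have h4 := h3.trans (Finset.card_union_le _ _)
  have h5 := Finset.card_union_le (bad₁ ×ˢ (Finset.univ : Finset Ω₂))
    ((Finset.univ : Finset Ω₁).biUnion fun χ => {χ} ×ˢ bad₂ χ)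
  have h6 : (((Finset.univ : Finset Ω₁).biUnion fun χ => {χ} ×ˢ bad₂ χ).card : ℝ) ≤
      Fintype.card Ω₁ * (1 / c * Fintype.card Ω₂) := by
    calc _ ≤ ∑ χ : Ω₁, ((bad₂ χ).card : ℝ) := by
          have : ((Finset.univ : Finset Ω₁).biUnion fun χ => {χ} ×ˢ bad₂ χ).card ≤
              ∑ χ : Ω₁, (bad₂ χ).card := by
            refine le_trans Finset.card_biUnion_le (le_of_eq ?_)
            simp
          exact_mod_cast this
      _ ≤ ∑ χ : Ω₁, (1 / c * Fintype.card Ω₂ : ℝ) := Finset.sum_le_sum fun χ _ => hb2 χ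
      _ = _ := by rw [Finset.sum_const, Finset.card_univ, nsmul_eq_mul]
  have h7 : ((bad₁ ×ˢ (Finset.univ : Finset Ω₂)).card : ℝ) ≤
      (1 / c * Fintype.card Ω₁) * Fintype.card Ω₂ := by
    rw [Finset.card_product, Finset.card_univ]; push_cast
    exact mul_le_mul_of_nonneg_right hb1 (by positivity)
  have h8 := h4.trans (Nat.add_le_add_left h5 _)
  rw [Finset.card_univ] at h8
  have h9 := (Nat.cast_le (α := ℝ)).2 h8
  push_cast at h9
  rw [Fintype.card_prod] at h9 ⊢
  push_cast at h9 ⊢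
  have h10 : (1 - 2 / (c : ℝ)) * (Fintype.card Ω₁ * Fintype.card Ω₂) =
    Fintype.card Ω₁ * Fintype.card Ω₂ - (1 / c * Fintype.card Ω₁) * Fintype.card Ω₂ -
      Fintype.card Ω₁ * (1 / c * Fintype.card Ω₂) := by ring
  rw [h10]
  linarith only [h9, h6, h7]

end DiverseMatching

/-! ### Coin tosses as random choices -/

namespace RandRAM

open MeasureTheory

instance : IsProbabilityMeasure fairCoins := by unfold fairCoins; infer_instance

/-- Any given outcomes of the first `T` tosses have probability `2 ^ (-T)`. -/
theorem fairCoins_real_cylinder (T : ℕ) (x : Fin T → Bool) :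
    fairCoins.real {ω | ∀ i : Fin T, ω i = x i} = ((2 : ℝ) ^ T)⁻¹ := by
  let y : ℕ → Bool := fun i => if h : i < T then x ⟨i, h⟩ else false
  have h1 : {ω : ℕ → Bool | ∀ i : Fin T, ω i = x i} =
      Set.pi (Finset.range T : Set ℕ) (fun i => {y i}) := by
    ext ω
    simp only [Set.mem_ofPred_eq, Set.mem_pi, Finset.coe_range, Set.mem_Iio, Set.mem_singleton_iff]
    constructor
    · intro h i hi
      simp only [y, dif_pos hi]
      exact h ⟨i, hi⟩
    · intro h i
      have := h i i.2
      simpa [y] using this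
  have h2 : ∀ b : Bool, (PMF.uniformOfFintype Bool).toMeasure {b} = 2⁻¹ := by
    intro b
    rw [PMF.toMeasure_apply_singleton _ _ (measurableSet_singleton b), PMF.uniformOfFintype_apply]
    simp
  rw [h1, measureReal_def, fairCoins, Measure.infinitePi_pi _ (fun i _ => measurableSet_singleton _)]
  simp_rw [h2]
  simp

/-- Finitely many coin tosses that are in bijection with a finite set yield a uniformly distributed
element of that set. -/
theorem fairCoins_real_preimage {α : Type} [Fintype α] {T : ℕ} (D : (Fin T → Bool) → α)
    (hD : Function.Bijective D) (S : Finset α) :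
    fairCoins.real {ω | D (fun i => ω i) ∈ S} = (S.card : ℝ) / Fintype.card α := by
  classical
  have h1 : {ω : ℕ → Bool | D (fun i => ω i) ∈ S} =
      ⋃ x ∈ (Finset.univ.filter fun x => D x ∈ S), {ω : ℕ → Bool | ∀ i : Fin T, ω i = x i} := by
    ext ω
    simp only [Set.mem_ofPred_eq, Set.mem_iUnion, Finset.mem_filter, Finset.mem_univ, true_and,
      exists_prop]
    constructor
    · intro h; exact ⟨_, h, fun i => rfl⟩
    · rintro ⟨x, hx, h⟩
      have : (fun i : Fin T => ω i) = x := funext h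
      rwa [this]
  have hmeas : ∀ x : Fin T → Bool, MeasurableSet {ω : ℕ → Bool | ∀ i : Fin T, ω i = x i} := by
    intro x
    rw [Set.ofPred_forall]
    refine MeasurableSet.iInter fun i => ?_
    have h := measurable_pi_apply (X := fun _ : ℕ => Bool) (i : ℕ) (measurableSet_singleton (x i))
    exact h
  have hcard : (Finset.univ.filter fun x => D x ∈ S).card = S.card := by
    refine Finset.card_nbij D (fun x hx => (Finset.mem_filter.1 hx).2) hD.1.injOn ?_
    intro a ha
    obtain ⟨x, rfl⟩ := hD.2 a
    exact ⟨x, by simpa using ha, rfl⟩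
  rw [h1, measureReal_biUnion_finset _ (fun x _ => hmeas x)]
  · simp_rw [fairCoins_real_cylinder]
    rw [Finset.sum_const, hcard, nsmul_eq_mul, ← Fintype.card_of_bijective hD, Fintype.card_fun]
    simp [div_eq_mul_inv]
  · intro x _ y _ hxy
    rw [Function.onFun, Set.disjoint_left]
    intro ω h2 h3
    exact hxy (funext fun i => (h2 i).symm.trans (h3 i))

/-- The number with the binary digits `f 0, …, f (b - 1)`, the leading one first. -/
def bitsNum : ℕ → (ℕ → Bool) → ℕ
  | 0, _ => 0
  | b + 1, f => 2 * bitsNum b f + if f b then 1 else 0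

theorem bitsNum_lt (b : ℕ) (f : ℕ → Bool) : bitsNum b f < 2 ^ b := by
  induction b with
  | zero => simp [bitsNum]
  | succ b ih => rw [bitsNum]; split_ifs <;> omega

theorem bitsNum_inj {b : ℕ} {f g : ℕ → Bool} (h : bitsNum b f = bitsNum b g) :
    ∀ t < b, f t = g t := by
  induction b with
  | zero => intro t ht; omega
  | succ b ih =>
    intro t ht
    rw [bitsNum, bitsNum] at h
    rcases Nat.lt_succ_iff_lt_or_eq.1 ht with h1 | rfl
    · exact ih (by split_ifs at h <;> omega) t h1
    · cases hf : f t <;> cases hg : g t <;> simp [hf, hg] at h ⊢ <;> omega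

/-- The random choices made with the coin tosses `ω`: `L₁` numbers of `b` bits each and then `L₂`
numbers of `m` bits each. -/
def draw (L₁ b L₂ m : ℕ) (ω : ℕ → Bool) : (Fin L₁ → Fin (2 ^ b)) × (Fin L₂ → Fin (2 ^ m)) :=
  (fun e => ⟨bitsNum b fun t => ω (b * e + t), bitsNum_lt _ _⟩,
    fun e => ⟨bitsNum m fun t => ω (b * L₁ + (m * e + t)), bitsNum_lt _ _⟩)

/-- The random choices are uniformly distributed, as they depend bijectively on the first
`b L₁ + m L₂` coin tosses. -/
theorem draw_uniform (L₁ b L₂ m : ℕ) (S : Finset ((Fin L₁ → Fin (2 ^ b)) × (Fin L₂ → Fin (2 ^ m)))) :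
    fairCoins.real {ω | draw L₁ b L₂ m ω ∈ S} = (S.card : ℝ) /
      Fintype.card ((Fin L₁ → Fin (2 ^ b)) × (Fin L₂ → Fin (2 ^ m))) := by
  let ext : (Fin (b * L₁ + m * L₂) → Bool) → ℕ → Bool := fun x i =>
    if h : i < b * L₁ + m * L₂ then x ⟨i, h⟩ else false
  have hidx : ∀ {b L e t : ℕ}, e < L → t < b → b * e + t < b * L := by
    intro b L e t he ht
    calc b * e + t < b * e + b := by omega
      _ = b * (e + 1) := by ring
      _ ≤ b * L := Nat.mul_le_mul_left b he
  have hdraw : ∀ ω : ℕ → Bool, draw L₁ b L₂ m (ext fun i => ω i) = draw L₁ b L₂ m ω := by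
    intro ω
    have hb : ∀ b (f g : ℕ → Bool), (∀ t < b, f t = g t) → bitsNum b f = bitsNum b g := by
      intro b f g h
      induction b with
      | zero => rfl
      | succ b ih => rw [bitsNum, bitsNum, ih fun t ht => h t (by omega), h b (by omega)]
    refine Prod.ext (funext fun e => Fin.ext (hb _ _ _ fun t ht => ?_))
      (funext fun e => Fin.ext (hb _ _ _ fun t ht => ?_))
    · have := hidx e.2 ht
      exact dif_pos (by omega)
    · have := hidx e.2 ht
      exact dif_pos (by omega)
  have hinj : Function.Injective fun x => draw L₁ b L₂ m (ext x) := by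
    intro x y hxy
    funext i
    have h1 := congrArg Prod.fst hxy
    have h2 := congrArg Prod.snd hxy
    have hext : ∀ x, ext x i = x i := fun x => dif_pos i.2
    rw [← hext x, ← hext y]
    by_cases hi : (i : ℕ) < b * L₁
    · have hb : 0 < b := Nat.pos_of_ne_zero (by rintro rfl; simp at hi)
      have h3 := congrArg Fin.val (congrFun h1 ⟨i / b, Nat.div_lt_of_lt_mul hi⟩)
      have h4 := bitsNum_inj h3 (i % b) (Nat.mod_lt _ hb)
      simpa only [Nat.div_add_mod] using h4
    · obtain ⟨r, hr⟩ : ∃ r, (i : ℕ) = b * L₁ + r := ⟨i - b * L₁, by omega⟩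
      have hr' : r < m * L₂ := by have := i.2; omega
      have hm : 0 < m := Nat.pos_of_ne_zero (by rintro rfl; simp at hr')
      have h3 := congrArg Fin.val (congrFun h2 ⟨r / m, Nat.div_lt_of_lt_mul hr'⟩)
      have h4 := bitsNum_inj h3 (r % m) (Nat.mod_lt _ hm)
      simpa only [Nat.div_add_mod, ← hr] using h4
  have hbij : Function.Bijective fun x => draw L₁ b L₂ m (ext x) := by
    rw [Fintype.bijective_iff_injective_and_card]
    refine ⟨hinj, ?_⟩
    simp [Fintype.card_prod, ← pow_mul, pow_add]
  rw [← fairCoins_real_preimage _ hbij S]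
  simp_rw [hdraw]

end RandRAM

/-! ### Rules for loops -/

namespace RandRAM

@[simp] theorem Expr.eval_var (r : ℕ) (s : Config) : (Expr.var r).eval s = s.reg r := rfl

@[simp] theorem Expr.eval_load (A : ℕ) (i : Expr) (s : Config) :
    (Expr.load A i).eval s = s.mem A (i.eval s) := rfl

instance : Add Expr := ⟨.add⟩
instance : Sub Expr := ⟨.sub⟩
instance : Mul Expr := ⟨.mul⟩
instance (k : ℕ) : OfNat Expr k := ⟨.lit k⟩

@[simp] theorem Expr.eval_add (a b : Expr) (s : Config) : (a + b).eval s = a.eval s + b.eval s := rfl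

@[simp] theorem Expr.eval_sub (a b : Expr) (s : Config) : (a - b).eval s = a.eval s - b.eval s := rfl

@[simp] theorem Expr.eval_mul (a b : Expr) (s : Config) :
    (a * b).eval s = min (a.eval s) (s.reg 1) * b.eval s := rfl

@[simp] theorem Expr.eval_ofNat (k : ℕ) (s : Config) :
    (no_index (OfNat.ofNat k : Expr)).eval s = k := rfl

@[simp] theorem Expr.eval_zero (s : Config) : (0 : Expr).eval s = 0 := rfl

@[simp] theorem Expr.eval_one (s : Config) : (1 : Expr).eval s = 1 := rfl

@[simp] theorem Expr.eval_lit (k : ℕ) (s : Config) : (Expr.lit k).eval s = k := rfl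

@[simp] theorem Stmt.eval_assign (r : ℕ) (e : Expr) (s : Config) :
    (Stmt.assign r e).eval s = s.setReg r (e.eval s) := rfl

@[simp] theorem Stmt.eval_store (A : ℕ) (i e : Expr) (s : Config) :
    (Stmt.store A i e).eval s = s.setMem A (i.eval s) (e.eval s) := rfl

@[simp] theorem Stmt.eval_flip (r : ℕ) (s : Config) : (Stmt.flip r).eval s = s.toss r := rfl

@[simp] theorem Stmt.eval_seq (p q : Stmt) (s : Config) : (p.seq q).eval s = q.eval (p.eval s) := rfl

@[simp] theorem Stmt.eval_ite (e : Expr) (p q : Stmt) (s : Config) :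
    (Stmt.ite e p q).eval s = if e.eval s ≠ 0 then p.eval s else q.eval s := rfl

@[simp] theorem Stmt.eval_skip (s : Config) : Stmt.skip.eval s = s := rfl

/-- `s` differs from `s₀` at most in the registers `R` and in the arrays `A`. -/
def Frame (R A : List ℕ) (s₀ s : Config) : Prop :=
  (∀ r, r ∉ R → s.reg r = s₀.reg r) ∧ ∀ a, a ∉ A → s.mem a = s₀.mem a

theorem Frame.refl (R A : List ℕ) (s : Config) : Frame R A s s := ⟨fun _ _ => rfl, fun _ _ => rfl⟩

theorem Frame.trans {R A R' A' : List ℕ} {s s' s'' : Config} (h : Frame R A s s')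
    (h' : Frame R' A' s' s'') : Frame (R ++ R') (A ++ A') s s'' := by
  refine ⟨fun r hr => ?_, fun a ha => ?_⟩
  · simp at hr; rw [h'.1 r hr.2, h.1 r hr.1]
  · simp at ha; rw [h'.2 a ha.2, h.2 a ha.1]

theorem Frame.mono {R A R' A' : List ℕ} {s s' : Config} (h : Frame R A s s')
    (hR : R ⊆ R') (hA : A ⊆ A') : Frame R' A' s s' :=
  ⟨fun r hr => h.1 r fun hr' => hr (hR hr'), fun a ha => h.2 a fun ha' => ha (hA ha')⟩

theorem Stmt.frame (p : Stmt) (s : Config) : Frame p.regs p.arrs s (p.eval s) :=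
  ⟨p.eval_reg s, p.eval_mem s⟩

/-- The statement tosses no coins. -/
def Stmt.noFlip : Stmt → Bool
  | .assign _ _ => true
  | .store _ _ _ => true
  | .flip _ => false
  | .seq p q => p.noFlip && q.noFlip
  | .ite _ p q => p.noFlip && q.noFlip
  | .loop _ _ p => p.noFlip
  | .skip => true

/-- Replace the outcomes of the coin tosses that have not been made yet. -/
def Config.withCoins (s : Config) (ω : ℕ → Bool) : Config := { s with coins := ω }

theorem Expr.eval_withCoins (e : Expr) (s : Config) (ω : ℕ → Bool) :
    e.eval (s.withCoins ω) = e.eval s := by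
  induction e with
  | var | lit => rfl
  | add a b iha ihb => rw [Expr.eval, Expr.eval, iha, ihb]
  | sub a b iha ihb => rw [Expr.eval, Expr.eval, iha, ihb]
  | mul a b iha ihb => rw [Expr.eval, Expr.eval, iha, ihb]; rfl
  | load A i ih => rw [Expr.eval, Expr.eval, ih]; rfl

/-- A statement without coin tosses has the same effect for all outcomes of the tosses to come. -/
theorem Stmt.eval_withCoins (p : Stmt) (hp : p.noFlip) (ω : ℕ → Bool) : ∀ s : Config,
    p.eval (s.withCoins ω) = (p.eval s).withCoins ω := by
  induction p with
  | assign r e => intro s; rw [Stmt.eval, Stmt.eval, Expr.eval_withCoins]; rfl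
  | store A i e => intro s; rw [Stmt.eval, Stmt.eval, Expr.eval_withCoins, Expr.eval_withCoins]; rfl
  | flip r => simp [Stmt.noFlip] at hp
  | seq p q ihp ihq =>
    intro s
    simp only [Stmt.noFlip, Bool.and_eq_true] at hp
    rw [Stmt.eval, Stmt.eval, ihp hp.1, ihq hp.2]
  | ite e p q ihp ihq =>
    intro s
    simp only [Stmt.noFlip, Bool.and_eq_true] at hp
    rw [Stmt.eval, Stmt.eval, Expr.eval_withCoins]
    split_ifs
    · exact ihp hp.1 s
    · exact ihq hp.2 s
  | loop i e p ih =>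
    intro s
    rw [Stmt.eval, Stmt.eval, Expr.eval_withCoins, show (s.withCoins ω).reg 1 = s.reg 1 from rfl]
    generalize min (e.eval s) (s.reg 1) = n
    induction n with
    | zero => rfl
    | succ n ihn => rw [iterUp, iterUp, ihn]; exact ih hp ((iterUp _ n s).setReg i n)
  | skip => intro s; rfl

theorem Stmt.eval_coins (p : Stmt) (hp : p.noFlip) (s : Config) : (p.eval s).coins = s.coins := by
  have h := p.eval_withCoins hp s.coins s
  replace h := congrArg Config.coins h
  exact h

/-- Induction on the rounds of a loop. -/
theorem Stmt.eval_loop {i : ℕ} {e : Expr} {p : Stmt} {s₀ : Config} {n : ℕ}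
    (hn : min (e.eval s₀) (s₀.reg 1) = n) (I : ℕ → Config → Prop) (h0 : I 0 s₀)
    (hI : ∀ j s, I j s → I j (s.setReg i j))
    (hstep : ∀ j < n, ∀ s, Frame (i :: p.regs) p.arrs s₀ s → s.reg i = j → I j s →
      I (j + 1) (p.eval s)) :
    I n ((Stmt.loop i e p).eval s₀) := by
  rw [Stmt.eval, hn]
  suffices h : ∀ m ≤ n, I m (iterUp (fun j s' => p.eval (s'.setReg i j)) m s₀) ∧
      Frame (i :: p.regs) p.arrs s₀ (iterUp (fun j s' => p.eval (s'.setReg i j)) m s₀) from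
    (h n le_rfl).1
  intro m
  induction m with
  | zero => intro _; exact ⟨h0, Frame.refl _ _ _⟩
  | succ m ih =>
    intro hm
    obtain ⟨h1, h2⟩ := ih (by omega)
    rw [iterUp]
    set s := iterUp (fun j s' => p.eval (s'.setReg i j)) m s₀
    have h3 : Frame (i :: p.regs) p.arrs s₀ (s.setReg i m) := by
      refine ⟨fun r hr => ?_, h2.2⟩
      rw [Config.setReg_reg, if_neg (by simp at hr; exact hr.1), h2.1 r hr]
    refine ⟨hstep m (by omega) _ h3 (by simp) (hI m s h1), ?_⟩
    exact (h3.trans (p.frame _)).mono (by simp) (by simp)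

theorem mul_add_inj {M a b a' b' : ℕ} (hb : b < M) (hb' : b' < M) :
    M * a + b = M * a' + b' ↔ a = a' ∧ b = b' := by
  constructor
  · intro h
    have h1 : (M * a + b) / M = (M * a' + b') / M := by rw [h]
    rw [Nat.mul_add_div (by omega), Nat.mul_add_div (by omega), Nat.div_eq_of_lt hb,
      Nat.div_eq_of_lt hb'] at h1
    have : a = a' := by omega
    subst this
    exact ⟨rfl, by omega⟩
  · rintro ⟨rfl, rfl⟩; rfl

theorem mul_add_lt {M P a b : ℕ} (ha : a < P) (hb : b < M) : M * a + b < M * P :=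
  calc M * a + b < M * a + M := by omega
    _ = M * (a + 1) := by ring
    _ ≤ M * P := Nat.mul_le_mul_left M ha

/-- A loop that fills an array from left to right, where each entry may depend on earlier ones. -/
theorem Stmt.eval_fill {i A : ℕ} {e : Expr} {p : Stmt} {s₀ : Config} {n : ℕ}
    (hn : min (e.eval s₀) (s₀.reg 1) = n) (Post : ℕ → ℕ → Prop)
    (hstep : ∀ j < n, ∀ s, Frame (i :: p.regs) p.arrs s₀ s → s.reg i = j →
      (∀ j' < j, Post j' (s.mem A j')) →
      ∃ v, Post j v ∧ (p.eval s).mem A = Function.update (s.mem A) j v) :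
    ∀ j < n, Post j (((Stmt.loop i e p).eval s₀).mem A j) := by
  refine Stmt.eval_loop hn (fun m s => ∀ j < m, Post j (s.mem A j)) (by simp) (fun _ _ h => h) ?_
  intro j hj s hs hi hI j' hj'
  obtain ⟨v, hv, hm⟩ := hstep j hj s hs hi hI
  rw [hm]
  rcases Nat.lt_succ_iff_lt_or_eq.1 hj' with h | rfl
  · rw [Function.update_of_ne h.ne]; exact hI j' h
  · rw [Function.update_self]; exact hv

/-- Two nested loops that fill a two-dimensional array row by row, where each entry may depend on
earlier ones. -/
theorem Stmt.eval_fill₂ {i j A r : ℕ} {e : Expr} {p : Stmt} {s₀ : Config} {P M : ℕ}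
    (hP : min (e.eval s₀) (s₀.reg 1) = P) (hr : min (s₀.reg r) (s₀.reg 1) = M)
    (hr' : r ∉ i :: j :: p.regs) (h1 : 1 ∉ i :: j :: p.regs) (hi : i ∉ j :: p.regs)
    (Post : ℕ → ℕ → ℕ → Prop)
    (hstep : ∀ a < P, ∀ b < M, ∀ s, Frame (i :: j :: p.regs) p.arrs s₀ s → s.reg i = a →
      s.reg j = b →
      (∀ a' b', b' < M → (a' < a ∨ a' = a ∧ b' < b) → Post a' b' (s.mem A (M * a' + b'))) →
      ∃ v, Post a b v ∧ (p.eval s).mem A = Function.update (s.mem A) (M * a + b) v) :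
    ∀ a < P, ∀ b < M,
      Post a b (((Stmt.loop i e (.loop j (.var r) p)).eval s₀).mem A (M * a + b)) := by
  refine Stmt.eval_loop hP (fun m s => ∀ a < m, ∀ b < M, Post a b (s.mem A (M * a + b))) (by simp)
    (fun _ _ h => h) ?_
  intro a ha s hs hia hI
  have hinner := Stmt.eval_loop (i := j) (e := .var r) (p := p) (s₀ := s) (n := M)
    (by rw [Expr.eval_var, hs.1 r hr', hs.1 1 h1, hr])
    (fun m s' => ∀ a' b', b' < M → (a' < a ∨ a' = a ∧ b' < m) → Post a' b' (s'.mem A (M * a' + b')))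
    (by intro a' b' hb' h; exact hI a' (by omega) b' hb') (fun _ _ h => h) ?_
  · intro a' ha' b' hb'
    refine hinner a' b' hb' ?_
    rcases Nat.lt_succ_iff_lt_or_eq.1 ha' with h | h
    · exact Or.inl h
    · exact Or.inr ⟨h, hb'⟩
  · intro b hb s' hs' hjb hI' a' b' hb' h
    obtain ⟨v, hv, hm⟩ := hstep a ha b hb s' ((hs.trans hs').mono (by simp [Stmt.regs])
      (by simp [Stmt.arrs])) (by rw [hs'.1 i hi, hia]) hjb hI'
    rw [hm]
    by_cases hab : a' = a ∧ b' = b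
    · rw [hab.1, hab.2, Function.update_self]; exact hv
    · rw [Function.update_of_ne (fun h => hab ((mul_add_inj hb' hb).1 h))]
      exact hI' a' b' hb' (by omega)

end RandRAM

namespace DiverseMatching

open RandRAM

local prefix:max "♯" => Expr.var
local infixr:60 " ;; " => Stmt.seq

-- Registers.  Register `0` receives the answer, `1` holds the bound on the loops, and `2` to `11` hold
-- the parameters; `12`, `13` and `99` are used while the parameters are computed.  After that, `20` to
-- `23` serve the tables; `30` holds the position of the code of the current graph, `31` and `32` a
-- colouring and a signature for the preceding stage, `33` and `34` those for the next stage, `35` and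
-- `36` a pair of characters; `37` to `40` serve the Tutte matrix, `41` its determinant, `42` the test
-- value, `43` to `47` the search of the dynamic program, and `50` to `54` the elimination.
-- Conditions are expressions that may vanish: since subtraction is truncated, `a + 1 - b` expresses
-- that `b ≤ a`, and `(a - b) + (b - a)` that `a ≠ b`.
local notation "rℓ" => (2 : ℕ)
local notation "rτ" => (3 : ℕ)
local notation "rn" => (4 : ℕ)
local notation "rk" => (5 : ℕ)
local notation "rb" => (6 : ℕ)
local notation "rK" => (7 : ℕ)
local notation "rN" => (8 : ℕ)
local notation "rW" => (9 : ℕ)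
local notation "rm" => (10 : ℕ)
local notation "rQ" => (11 : ℕ)

-- the arrays
local notation "aIn" => (0 : ℕ)
local notation "aCol" => (1 : ℕ)
local notation "aRho" => (2 : ℕ)
local notation "aHalf" => (3 : ℕ)
local notation "aPar" => (4 : ℕ)
local notation "aAdd" => (5 : ℕ)
local notation "aMul" => (6 : ℕ)
local notation "aInv" => (7 : ℕ)
local notation "aPow" => (8 : ℕ)
local notation "aQuo" => (9 : ℕ)
local notation "aRem" => (10 : ℕ)
local notation "aTmp" => (11 : ℕ)
local notation "aDig" => (12 : ℕ)
local notation "aPair" => (13 : ℕ)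
local notation "aMat" => (14 : ℕ)
local notation "aCur" => (15 : ℕ)
local notation "aNext" => (16 : ℕ)

/-! ### Tables for the arithmetic of the field -/

/-- The parameters of the algorithm: the diversity `ℓ`, the number `τ` of stages, the number `n` of
potential vertices, the number `k = 2 ^ b` of colours, the number `N` of colourings, the size
parameter `q` of the field with `2 ^ (2 q)` elements, and a bound `B` on all loops. -/
structure Params where
  (ℓ τ n k b N q B : ℕ)

/-- The number of signatures. -/
def Params.K (P : Params) : ℕ := 3 ^ P.k

/-- The number of field elements. -/
def Params.Q (P : Params) : ℕ := 2 ^ (2 * P.q)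

/-- The number of the field element that is a cube root of unity. -/
def Params.w (P : Params) : ℕ := 2 ^ P.q

/-- The registers hold the parameters, and the bound on the loops suffices. -/
structure Params.Holds (P : Params) (s : Config) : Prop where
  B : s.reg 1 = P.B
  ℓ : s.reg rℓ = P.ℓ
  τ : s.reg rτ = P.τ
  n : s.reg rn = P.n
  k : s.reg rk = P.k
  b : s.reg rb = P.b
  K : s.reg rK = P.K
  N : s.reg rN = P.N
  w : s.reg rW = P.w
  m : s.reg rm = 2 * P.q
  Q : s.reg rQ = P.Q
  eight_le : 8 ≤ P.B
  τ_le : P.τ ≤ P.B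
  n_le : P.n ≤ P.B
  k_le : P.k ≤ P.B
  b_le : P.b ≤ P.B
  K_le : P.K ≤ P.B
  N_le : P.N ≤ P.B
  m_le : 2 * P.q ≤ P.B
  Q_le : P.Q ≤ P.B
  nn_le : P.n * P.n ≤ P.B
  Nnn_le : P.n * P.n * P.N ≤ P.B

/-- The registers below `12` are reserved for the parameters. -/
theorem Params.Holds.frame {P : Params} {R A : List ℕ} {s s' : Config} (h : P.Holds s)
    (hs : Frame R A s s') (hR : ∀ r ∈ R, 12 ≤ r) : P.Holds s' := by
  have key : ∀ r < 12, s'.reg r = s.reg r := fun r hr => hs.1 r fun h' => by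
    have := hR r h'; omega
  constructor
  all_goals first
    | exact (key _ (by norm_num)).trans h.B
    | exact (key _ (by norm_num)).trans h.ℓ
    | exact (key _ (by norm_num)).trans h.τ
    | exact (key _ (by norm_num)).trans h.n
    | exact (key _ (by norm_num)).trans h.k
    | exact (key _ (by norm_num)).trans h.b
    | exact (key _ (by norm_num)).trans h.K
    | exact (key _ (by norm_num)).trans h.N
    | exact (key _ (by norm_num)).trans h.w
    | exact (key _ (by norm_num)).trans h.m
    | exact (key _ (by norm_num)).trans h.Q
    | exact h.eight_le
    | exact h.τ_le
    | exact h.n_le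
    | exact h.k_le
    | exact h.b_le
    | exact h.K_le
    | exact h.N_le
    | exact h.m_le
    | exact h.Q_le
    | exact h.nn_le
    | exact h.Nnn_le

/-- The field `F` of characteristic two consists of the values at `g` of the polynomials with
coefficients in `{0, 1}` of degree less than `2 q`, where `g ^ q` is a cube root of unity. -/
structure FieldCode (F : Type) [Field F] (g : F) (q : ℕ) : Prop where
  char : CharP F 2
  pos : 0 < q
  rel : g ^ (2 * q) = g ^ q + 1
  bij : Function.Bijective fun a : Fin (2 ^ (2 * q)) => binVal g a

section FieldCode
variable {F : Type} [Field F] {g : F} {q : ℕ}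

theorem FieldCode.inj (h : FieldCode F g q) {a b : ℕ} (ha : a < 2 ^ (2 * q)) (hb : b < 2 ^ (2 * q))
    (hab : binVal g a = binVal g b) : a = b :=
  congrArg Fin.val (@h.bij.1 ⟨a, ha⟩ ⟨b, hb⟩ hab)

theorem FieldCode.surj (h : FieldCode F g q) (y : F) : ∃ a < 2 ^ (2 * q), binVal g a = y := by
  obtain ⟨a, ha⟩ := h.bij.2 y
  exact ⟨a, a.2, ha⟩

theorem FieldCode.one_lt (h : FieldCode F g q) : 1 < 2 ^ q :=
  Nat.one_lt_two_pow h.pos.ne'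

theorem FieldCode.pow_lt (h : FieldCode F g q) : 2 ^ q + 1 < 2 ^ (2 * q) := by
  have := h.one_lt
  rw [two_mul, pow_add]
  nlinarith

theorem FieldCode.omega (h : FieldCode F g q) : (g ^ q) ^ 2 + g ^ q + 1 = 0 := by
  have := h.char
  have h2 : ∀ y : F, y + y = 0 := CharTwo.add_self_eq_zero
  have := h.rel
  rw [mul_comm, pow_mul] at this
  linear_combination this + h2 (g ^ q) + h2 1

theorem FieldCode.binVal_w (q : ℕ) : binVal g (2 ^ q) = g ^ q := binVal_two_pow g q

theorem FieldCode.binVal_w_add_one (h : FieldCode F g q) : binVal g (2 ^ q + 1) = g ^ q + 1 := by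
  rw [binVal_two_pow_add g q 1 h.one_lt, binVal_one]

end FieldCode

/-- Code that tabulates quotients and remainders modulo `d` of the numbers below the content of
`r`. -/
def divTable (d Aq Ar r : ℕ) : Stmt :=
  .assign 21 0 ;; .assign 22 0 ;;
  .loop 20 ♯r (.store Aq ♯20 ♯21 ;; .store Ar ♯20 ♯22 ;; .assign 22 (♯22 + 1) ;;
    .ite (.lit d - ♯22) .skip (.assign 22 0 ;; .assign 21 (♯21 + 1)))

theorem divTable_spec {d Aq Ar r : ℕ} (hd : 0 < d) (ha : Aq ≠ Ar) (hr : r < 12)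
    (s : Config) (hB : s.reg r ≤ s.reg 1) :
    ∀ a < s.reg r, ((divTable d Aq Ar r).eval s).mem Aq a = a / d ∧
      ((divTable d Aq Ar r).eval s).mem Ar a = a % d := by
  unfold divTable
  rw [Stmt.eval_seq, Stmt.eval_seq]
  have := Stmt.eval_loop (i := 20) (e := ♯r)
    (p := .store Aq ♯20 ♯21 ;; .store Ar ♯20 ♯22 ;; .assign 22 (♯22 + 1) ;;
      .ite (.lit d - ♯22) .skip (.assign 22 0 ;; .assign 21 (♯21 + 1)))
    (s₀ := (Stmt.assign 22 0).eval ((Stmt.assign 21 0).eval s)) (n := s.reg r)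
    (by simp [show r ≠ 21 by omega, show r ≠ 22 by omega, hB])
    (fun j s' => s'.reg 21 = j / d ∧ s'.reg 22 = j % d ∧
      ∀ a < j, s'.mem Aq a = a / d ∧ s'.mem Ar a = a % d)
    (by simp) (by intro j s' h; simpa using h) ?_
  · exact this.2.2
  intro j hj s' _ hs' ⟨h1, h2, h3⟩
  have hmod := Nat.mod_lt j hd
  have hdm := Nat.div_add_mod j d
  have hmem : ∀ a < j + 1, Function.update (s'.mem Aq) j (j / d) a = a / d ∧
      Function.update (s'.mem Ar) j (j % d) a = a % d := by
    intro a ha'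
    rcases Nat.lt_succ_iff_lt_or_eq.1 ha' with h | rfl
    · rw [Function.update_of_ne h.ne, Function.update_of_ne h.ne]; exact h3 a h
    · simp
  by_cases hlast : j % d + 1 < d
  · have e1 : (j + 1) / d = j / d := by
      rw [← hdm, add_assoc, Nat.mul_add_div hd, Nat.mul_add_div hd, Nat.div_eq_of_lt hlast,
        Nat.div_eq_of_lt hmod]
    have e2 : (j + 1) % d = j % d + 1 := by
      have := Nat.div_add_mod (j + 1) d
      rw [e1] at this; omega
    have e3 : d - (j % d + 1) ≠ 0 := by omega
    simp only [Stmt.eval_seq, Stmt.eval_store, Stmt.eval_assign, Stmt.eval_ite, Stmt.eval_skip]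
    simp only [Expr.eval_var, Expr.eval_sub, Expr.eval_add, Expr.eval_lit, Expr.eval_one,
      Config.setReg_reg, Config.setMem_reg, h1, h2, hs', if_true, e3, ne_eq, not_false_eq_true,
      Config.setReg_mem, Config.setMem_mem, e1, e2]
    simpa [ha, ha.symm, h1] using hmem
  · have e2 : (j + 1) % d = 0 := by
      have : j % d + 1 = d := by omega
      rw [← hdm, add_assoc, this]; simp
    have e1 : (j + 1) / d = j / d + 1 := by
      have h4 := Nat.div_add_mod (j + 1) d
      rw [e2] at h4
      have : d * ((j + 1) / d) = d * (j / d + 1) := by rw [mul_add]; omega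
      exact Nat.eq_of_mul_eq_mul_left hd this
    have e3 : d - (j % d + 1) = 0 := by omega
    simp only [Stmt.eval_seq, Stmt.eval_store, Stmt.eval_assign, Stmt.eval_ite, Stmt.eval_skip]
    simp only [Expr.eval_var, Expr.eval_sub, Expr.eval_add, Expr.eval_lit, Expr.eval_one,
      Config.setReg_reg, Config.setMem_reg, h1, h2, hs', if_true, e3, ne_eq, not_true_eq_false,
      Config.setReg_mem, Config.setMem_mem, e1, e2, if_false, Expr.eval_zero]
    simpa [ha, ha.symm, h1] using hmem

/-- Code for the addition table: the sum of `a` and `b` is `g` times the sum of `a / 2` and `b / 2`,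
plus the exclusive or of the parities. -/
def addTable : Stmt :=
  .loop 20 ♯rQ (.loop 21 ♯rQ (.ite ♯20
    (.store aAdd (♯rQ * ♯20 + ♯21) (2 * .load aAdd (♯rQ * .load aHalf ♯20 + .load aHalf ♯21) +
      ((.load aPar ♯20 - .load aPar ♯21) + (.load aPar ♯21 - .load aPar ♯20))))
    (.store aAdd (♯rQ * ♯20 + ♯21) ♯21)))

/-- Code for the multiplication table: the product of `a` and `b` is `g` times the product of
`a / 2` and `b`, plus `b` if `a` is odd.  Multiplication by `g` doubles the number, and if the result
is `Q + z` with `z < Q` then the relation `g ^ (2 q) = g ^ q + 1` turns it into the sum of the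
elements with the numbers `z` and `2 ^ q + 1`. -/
def mulTable : Stmt :=
  .loop 20 ♯rQ (.loop 21 ♯rQ (
    .assign 22 (2 * .load aMul (♯rQ * .load aHalf ♯20 + ♯21)) ;;
    .ite (♯22 + 1 - ♯rQ) (.assign 22 (.load aAdd (♯rQ * (♯22 - ♯rQ) + (♯rW + 1)))) .skip ;;
    .ite (.load aPar ♯20) (.assign 22 (.load aAdd (♯rQ * ♯22 + ♯21))) .skip ;;
    .ite ♯20 .skip (.assign 22 0) ;;
    .store aMul (♯rQ * ♯20 + ♯21) ♯22))

/-- Code for the table of inverses, found by search in the multiplication table; the entry for `0` is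
`0`. -/
def invTable : Stmt :=
  .loop 20 ♯rQ (.store aInv ♯20 0 ;;
    .loop 21 ♯rQ (.assign 22 (.load aMul (♯rQ * ♯20 + ♯21)) ;;
      .ite ((♯22 - 1) + (1 - ♯22)) .skip (.store aInv ♯20 ♯21)))

/-- Code for the table of the powers of the cube root of unity with exponents `0, 1, 2, 4`, the
products of two elements of `{0, 1, 2}`. -/
def powTable : Stmt :=
  .store aPow 0 1 ;; .store aPow 1 ♯rW ;; .store aPow 2 (♯rW + 1) ;; .store aPow 4 ♯rW

/-- The tables of halves and parities are filled. -/
def HalfOK (P : Params) (s : Config) : Prop :=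
  ∀ a < P.Q, s.mem aHalf a = a / 2 ∧ s.mem aPar a = a % 2

/-- The addition table is filled. -/
def AddOK {F : Type} [Field F] (P : Params) (g : F) (s : Config) : Prop :=
  ∀ a < P.Q, ∀ b < P.Q, s.mem aAdd (P.Q * a + b) < P.Q ∧
    binVal g (s.mem aAdd (P.Q * a + b)) = binVal g a + binVal g b

/-- The multiplication table is filled. -/
def MulOK {F : Type} [Field F] (P : Params) (g : F) (s : Config) : Prop :=
  ∀ a < P.Q, ∀ b < P.Q, s.mem aMul (P.Q * a + b) < P.Q ∧
    binVal g (s.mem aMul (P.Q * a + b)) = binVal g a * binVal g b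

/-- The table of inverses is filled. -/
def InvOK {F : Type} [Field F] (P : Params) (g : F) (s : Config) : Prop :=
  ∀ a < P.Q, s.mem aInv a < P.Q ∧ binVal g (s.mem aInv a) = (binVal g a)⁻¹

/-- The table of powers is filled. -/
def PowOK {F : Type} [Field F] (P : Params) (g : F) (s : Config) : Prop :=
  ∀ a b : Fin 3, s.mem aPow ((a : ℕ) * (b : ℕ)) < P.Q ∧
    binVal g (s.mem aPow ((a : ℕ) * (b : ℕ))) = (g ^ P.q) ^ ((a : ℕ) * (b : ℕ))

section tables
variable {F : Type} [Field F] {g : F} {P : Params}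

theorem addTable_spec (hF : FieldCode F g P.q) (s : Config) (hP : P.Holds s) (hH : HalfOK P s) :
    AddOK P g (addTable.eval s) := by
  have hchar := hF.char
  suffices h : ∀ a < P.Q, ∀ b < P.Q,
      (∀ i, a < 2 ^ i → b < 2 ^ i → (addTable.eval s).mem aAdd (P.Q * a + b) < 2 ^ i) ∧
      binVal g ((addTable.eval s).mem aAdd (P.Q * a + b)) = binVal g a + binVal g b from
    fun a ha b hb => ⟨(h a ha b hb).1 _ ha hb, (h a ha b hb).2⟩
  refine Stmt.eval_fill₂ (P := P.Q) (M := P.Q) (by simp [hP.Q, hP.B, hP.Q_le])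
    (by simp [hP.Q, hP.B, hP.Q_le]) (by decide) (by decide) (by decide)
    (fun a b v => (∀ i, a < 2 ^ i → b < 2 ^ i → v < 2 ^ i) ∧ binVal g v = binVal g a + binVal g b) ?_
  intro a ha b hb s' hs' h20 h21 hI
  have hP' := hP.frame hs' (by decide)
  have hH' : HalfOK P s' := by
    intro a ha; rw [hs'.2 aHalf (by decide), hs'.2 aPar (by decide)]; exact hH a ha
  by_cases h0 : a = 0
  · refine ⟨b, ⟨fun i _ h => h, by simp [h0]⟩, ?_⟩
    simp [h20, h21, h0, hP'.Q, hP'.B, hP.Q_le]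
  · obtain ⟨h1, h2⟩ := hI (a / 2) (b / 2) (by omega) (Or.inl (by omega))
    have hp : (a % 2 - b % 2) + (b % 2 - a % 2) < 2 := by omega
    refine ⟨2 * s'.mem aAdd (P.Q * (a / 2) + b / 2) + ((a % 2 - b % 2) + (b % 2 - a % 2)), ⟨?_, ?_⟩, ?_⟩
    · intro i hai hbi
      obtain ⟨i, rfl⟩ : ∃ i', i = i' + 1 := by
        rcases i with _ | i
        · simp at hai; omega
        · exact ⟨i, rfl⟩
      have := h1 i (by omega) (by omega)
      omega
    · have hbit : (((a % 2 - b % 2) + (b % 2 - a % 2) : ℕ) : F) = ((a % 2 : ℕ) : F) + ((b % 2 : ℕ) : F) := by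
        have h11 : (1 : F) + 1 = 0 := CharTwo.add_self_eq_zero 1
        rcases Nat.mod_two_eq_zero_or_one a with e | e <;>
          rcases Nat.mod_two_eq_zero_or_one b with f | f <;> simp [e, f, h11]
      rw [binVal_two_mul_add g _ _ hp, h2, hbit, binVal_eq g a, binVal_eq g b]
      ring
    · have h2B : 2 ≤ P.B := by have := hP.eight_le; omega
      simp [h20, h21, h0, hP'.Q, hP'.B, hP.Q_le, hH' a ha, hH' b hb, h2B]

theorem mulTable_spec (hF : FieldCode F g P.q) (s : Config) (hP : P.Holds s) (hH : HalfOK P s)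
    (hA : AddOK P g s) : MulOK P g (mulTable.eval s) := by
  refine Stmt.eval_fill₂ (P := P.Q) (M := P.Q) (by simp [hP.Q, hP.B, hP.Q_le])
    (by simp [hP.Q, hP.B, hP.Q_le]) (by decide) (by decide) (by decide)
    (fun a b v => v < P.Q ∧ binVal g v = binVal g a * binVal g b) ?_
  intro a ha b hb s' hs' h20 h21 hI
  have hP' := hP.frame hs' (by decide)
  have hH' : HalfOK P s' := by
    intro a ha; rw [hs'.2 aHalf (by decide), hs'.2 aPar (by decide)]; exact hH a ha
  have hA' : AddOK P g s' := by
    intro a ha b hb; rw [hs'.2 aAdd (by decide)]; exact hA a ha b hb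
  have h2B : 2 ≤ P.B := by have := hP.eight_le; omega
  by_cases h0 : a = 0
  · refine ⟨0, ⟨by omega, by simp [h0]⟩, ?_⟩
    set t := (Stmt.ite (.load aPar ♯20) (.assign 22 (.load aAdd (♯rQ * ♯22 + ♯21))) .skip).eval
      ((Stmt.ite (♯22 + 1 - ♯rQ) (.assign 22 (.load aAdd (♯rQ * (♯22 - ♯rQ) + (♯rW + 1)))) .skip).eval
        ((Stmt.assign 22 (2 * .load aMul (♯rQ * .load aHalf ♯20 + ♯21))).eval s')) with ht
    have hf : Frame [22] [] s' t := (((Stmt.frame _ _).trans (Stmt.frame _ _)).trans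
      (Stmt.frame _ _)).mono (by decide) (by decide)
    have hPt := hP'.frame hf (by decide)
    have e20 : t.reg 20 = 0 := by rw [hf.1 20 (by decide), h20, h0]
    have e21 : t.reg 21 = b := by rw [hf.1 21 (by decide), h21]
    change ((Stmt.store aMul (♯rQ * ♯20 + ♯21) ♯22).eval
      ((Stmt.ite ♯20 .skip (.assign 22 0)).eval t)).mem aMul = _
    simp [e20, e21, h0, hPt.Q, hPt.B, hP.Q_le, hf.2 aMul (by decide)]
  · obtain ⟨h1, h2⟩ := hI (a / 2) b hb (Or.inl (by omega))
    set y := s'.mem aMul (P.Q * (a / 2) + b) with hy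
    -- multiplication by the generator
    obtain ⟨y', hy'1, hy'2, hy'3⟩ : ∃ y' < P.Q, binVal g y' = g * binVal g y ∧
        (if 2 * y + 1 - P.Q ≠ 0 then s'.mem aAdd (P.Q * (2 * y - P.Q) + (P.w + 1)) else 2 * y) = y' := by
      refine ⟨_, ?_, ?_, rfl⟩
      · split_ifs with h
        · exact (hA' _ (by omega) _ hF.pow_lt).1
        · omega
      · split_ifs with h
        · rw [(hA' _ (by omega) _ (show P.w + 1 < P.Q from hF.pow_lt)).2, Params.w, hF.binVal_w_add_one, ← hF.rel, add_comm,
            ← binVal_two_pow_add g _ _ (show 2 * y - P.Q < 2 ^ (2 * P.q) by unfold Params.Q at *; omega),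
            ← binVal_two_mul]
          congr 1
          unfold Params.Q at *; omega
        · rw [binVal_two_mul]
    refine ⟨if a % 2 ≠ 0 then s'.mem aAdd (P.Q * y' + b) else y', ⟨?_, ?_⟩, ?_⟩
    · split_ifs
      · exact (hA' _ hy'1 _ hb).1
      · exact hy'1
    · rw [binVal_eq g a]
      split_ifs with h
      · rw [(hA' _ hy'1 _ hb).2, hy'2, h2, show a % 2 = 1 by omega]; push_cast; ring
      · rw [hy'2, h2, show a % 2 = 0 by omega]; push_cast; ring
    · simp only [Stmt.eval_seq, Stmt.eval_store, Stmt.eval_assign, Stmt.eval_ite, Stmt.eval_skip]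
      have e1 : (2 * Expr.load aMul (♯rQ * .load aHalf ♯20 + ♯21) : Expr).eval s' = 2 * y := by
        simp [h20, h21, hP'.Q, hP'.B, hP.Q_le, h2B, hH' a ha, hy]
      rw [e1]
      set s1 := s'.setReg 22 (2 * y) with hs1
      have e2 : (if (♯22 + 1 - ♯rQ : Expr).eval s1 ≠ 0 then
          s1.setReg 22 ((Expr.load aAdd (♯rQ * (♯22 - ♯rQ) + (♯rW + 1))).eval s1) else s1) =
          s'.setReg 22 y' := by
        have hidem : ∀ v v' : ℕ, (s'.setReg 22 v).setReg 22 v' = s'.setReg 22 v' := by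
          intro v v'; simp [Config.setReg]
        have e3 : (♯22 + 1 - ♯rQ : Expr).eval s1 = 2 * y + 1 - P.Q := by simp [hs1, hP'.Q]
        have e4 : (Expr.load aAdd (♯rQ * (♯22 - ♯rQ) + (♯rW + 1))).eval s1 =
            s'.mem aAdd (P.Q * (2 * y - P.Q) + (P.w + 1)) := by
          simp [hs1, hP'.Q, hP'.w, hP'.B, hP.Q_le]
        rw [e3, e4, ← hy'3, hs1, hidem]
        split_ifs <;> rfl
      rw [e2]
      rcases Nat.mod_two_eq_zero_or_one a with hpar | hpar
      · simp [hH' a ha, h20, h21, hpar, h0, hP'.Q, hP'.B, hP.Q_le]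
      · simp [hH' a ha, h20, h21, hpar, h0, hP'.Q, hP'.B, hP.Q_le]

theorem invTable_spec (hF : FieldCode F g P.q) (s : Config) (hP : P.Holds s)
    (hM : MulOK P g s) : InvOK P g (invTable.eval s) := by
  have hone : 1 < P.Q := by have := hF.pow_lt; have := hF.one_lt; unfold Params.Q; omega
  refine Stmt.eval_fill (n := P.Q) (by simp [hP.Q, hP.B, hP.Q_le])
    (fun a v => v < P.Q ∧ binVal g v = (binVal g a)⁻¹) ?_
  intro a ha s' hs' h20 _
  have hP' := hP.frame hs' (by decide)
  have hM' : MulOK P g s' := by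
    intro a ha b hb; rw [hs'.2 aMul (by decide)]; exact hM a ha b hb
  rw [Stmt.eval_seq]
  set s1 := (Stmt.store aInv ♯20 0).eval s' with hs1
  have hs1f : Frame [] [aInv] s' s1 := (Stmt.store aInv ♯20 0).frame s'
  have hP1 := hP'.frame hs1f (by decide)
  have := Stmt.eval_loop (i := 21) (e := ♯rQ) (p := .assign 22 (.load aMul (♯rQ * ♯20 + ♯21)) ;;
      .ite ((♯22 - 1) + (1 - ♯22)) .skip (.store aInv ♯20 ♯21)) (s₀ := s1) (n := P.Q)
    (by simp [hP1.Q, hP1.B, hP.Q_le])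
    (fun m t => ∃ v < P.Q, t.mem aInv = Function.update (s'.mem aInv) a v ∧
      ((v = 0 ∧ ∀ b < m, s'.mem aMul (P.Q * a + b) ≠ 1) ∨ s'.mem aMul (P.Q * a + v) = 1))
    ⟨0, by omega, by simp [hs1, h20], Or.inl ⟨rfl, by simp⟩⟩ (fun _ _ h => h) ?_
  · obtain ⟨v, hv, hmem, hor⟩ := this
    refine ⟨v, ⟨hv, ?_⟩, hmem⟩
    rcases hor with ⟨rfl, hnone⟩ | hone'
    · by_cases hz : binVal g a = 0
      · simp [hz]
      · obtain ⟨b, hb, hb'⟩ := hF.surj (binVal g a)⁻¹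
        exfalso
        apply hnone b hb
        apply hF.inj (hM' a ha b hb).1 hone
        rw [(hM' a ha b hb).2, hb', mul_inv_cancel₀ hz, binVal_one]
    · have := (hM' a ha v hv).2
      rw [hone', binVal_one] at this
      exact eq_inv_of_mul_eq_one_right this.symm
  · intro b hb t ht h21 ⟨v, hv, hmem, hor⟩
    have hPt := hP1.frame ht (by decide)
    have h20t : t.reg 20 = a := by rw [ht.1 20 (by decide), hs1f.1 20 (by decide), h20]
    have hmul : t.mem aMul = s'.mem aMul := by rw [ht.2 aMul (by decide), hs1f.2 aMul (by decide)]
    by_cases h1 : s'.mem aMul (P.Q * a + b) = 1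
    · refine ⟨b, hb, ?_, Or.inr h1⟩
      simp [h20t, h21, hPt.Q, hPt.B, hP.Q_le, hmul, h1, hmem]
    · refine ⟨v, hv, ?_, ?_⟩
      · have : s'.mem aMul (P.Q * a + b) - 1 + (1 - s'.mem aMul (P.Q * a + b)) ≠ 0 := by omega
        rw [Stmt.eval_seq, Stmt.eval_assign, Stmt.eval_ite, if_pos]
        · exact hmem
        · simpa [h20t, h21, hPt.Q, hPt.B, hP.Q_le, hmul, h1, hmem] using this
      · rcases hor with ⟨hv0, hnone⟩ | h
        · refine Or.inl ⟨hv0, fun b' hb' => ?_⟩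
          rcases Nat.lt_succ_iff_lt_or_eq.1 hb' with h | rfl
          · exact hnone b' h
          · exact h1
        · exact Or.inr h

theorem powTable_spec (hF : FieldCode F g P.q) (s : Config) (hP : P.Holds s) :
    PowOK P g (powTable.eval s) := by
  have h3 := pow_three_eq_one hF.omega
  have hchar := hF.char
  have h2 : ∀ y : F, y + y = 0 := CharTwo.add_self_eq_zero
  have hlt := hF.pow_lt
  have hlt0 := hF.one_lt
  have hlt1 : 1 < P.Q := by unfold Params.Q; omega
  have hltw : P.w < P.Q := by unfold Params.Q Params.w; omega
  have hltw1 : P.w + 1 < P.Q := by unfold Params.Q Params.w; omega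
  have hw : binVal g P.w = g ^ P.q := FieldCode.binVal_w P.q
  have hw1 : binVal g (P.w + 1) = (g ^ P.q) ^ 2 := by
    rw [Params.w, hF.binVal_w_add_one]
    linear_combination -hF.omega + h2 (g ^ P.q) + h2 1
  have h4 : (g ^ P.q) ^ 4 = g ^ P.q := by linear_combination g ^ P.q * h3
  intro a b
  fin_cases a <;> fin_cases b <;>
    simp [powTable, hP.w, Function.update, hlt1, hltw, hltw1, hw, hw1, h4]

end tables

/-! ### Signatures as numbers, and random choices -/

/-- The signature with number `s`, given by the ternary digits of `s`. -/
def sigOf (k s : ℕ) : Fin k → Fin 3 := fun c => ⟨s / 3 ^ (c : ℕ) % 3, Nat.mod_lt _ (by norm_num)⟩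

theorem sigOf_eq {k : ℕ} (s : Fin (3 ^ k)) : sigOf k s = finFunctionFinEquiv.symm s := by
  funext c
  rfl

theorem sum_sigOf {R : Type} [AddCommMonoid R] (k : ℕ) (f : (Fin k → Fin 3) → R) :
    ∑ s ∈ Finset.range (3 ^ k), f (sigOf k s) = ∑ s : Fin k → Fin 3, f s := by
  rw [Finset.sum_range, ← Equiv.sum_comp finFunctionFinEquiv.symm f]
  simp_rw [sigOf_eq]

theorem exists_sigOf {k : ℕ} (u : Fin k → Fin 3) : ∃ s < 3 ^ k, sigOf k s = u := by
  refine ⟨finFunctionFinEquiv u, (finFunctionFinEquiv u).2, ?_⟩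
  rw [sigOf_eq, Equiv.symm_apply_apply]

/-- Code for the table of the ternary digits of the numbers of the signatures.  The array `aTmp`
holds the quotients by the powers of three. -/
def digTable : Stmt :=
  divTable 3 aQuo aRem rK ;;
  .loop 20 ♯rk (.loop 21 ♯rK (.ite ♯20
    (.store aTmp (♯rK * ♯20 + ♯21) (.load aQuo (.load aTmp (♯rK * (♯20 - 1) + ♯21))))
    (.store aTmp (♯rK * ♯20 + ♯21) ♯21))) ;;
  .loop 20 ♯rk (.loop 21 ♯rK
    (.store aDig (♯rK * ♯20 + ♯21) (.load aRem (.load aTmp (♯rK * ♯20 + ♯21)))))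

/-- The table of digits is filled. -/
def DigOK (P : Params) (s : Config) : Prop :=
  ∀ c < P.k, ∀ u < P.K, s.mem aDig (P.K * c + u) = u / 3 ^ c % 3

theorem digTable_spec {P : Params} (s : Config) (hP : P.Holds s) : DigOK P (digTable.eval s) := by
  rw [digTable, Stmt.eval_seq, Stmt.eval_seq]
  have hdiv := divTable_spec (d := 3) (Aq := aQuo) (Ar := aRem) (r := rK) (by norm_num)
    (by norm_num) (by norm_num) s (by rw [hP.K, hP.B]; exact hP.K_le)
  rw [hP.K] at hdiv
  set s1 := (divTable 3 aQuo aRem rK).eval s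
  have hP1 : P.Holds s1 := hP.frame (Stmt.frame _ _) (by decide)
  set s2 := Stmt.eval _ s1 with hs2
  have hf2 := Stmt.frame (.loop 20 ♯rk (.loop 21 ♯rK (.ite ♯20
    (.store aTmp (♯rK * ♯20 + ♯21) (.load aQuo (.load aTmp (♯rK * (♯20 - 1) + ♯21))))
    (.store aTmp (♯rK * ♯20 + ♯21) ♯21)))) s1
  rw [← hs2] at hf2
  have hP2 : P.Holds s2 := hP1.frame hf2 (by decide)
  have htmp : ∀ c < P.k, ∀ u < P.K, s2.mem aTmp (P.K * c + u) = u / 3 ^ c := by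
    refine Stmt.eval_fill₂ (P := P.k) (M := P.K) (by simp [hP1.k, hP1.B, hP.k_le])
      (by simp [hP1.K, hP1.B, hP.K_le]) (by decide) (by decide) (by decide)
      (fun c u v => v = u / 3 ^ c) ?_
    intro c hc u hu t ht h20 h21 hI
    have hPt := hP1.frame ht (by decide)
    refine ⟨_, rfl, ?_⟩
    by_cases h0 : c = 0
    · simp [h20, h21, h0, hPt.K, hPt.B, hP.K_le]
    · obtain ⟨c, rfl⟩ := Nat.exists_eq_succ_of_ne_zero h0
      have hprev := hI c u hu (Or.inl (by omega))
      have hquo : t.mem aQuo (u / 3 ^ c) = u / 3 ^ c / 3 := by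
        rw [ht.2 aQuo (by decide)]
        exact (hdiv _ (lt_of_le_of_lt (Nat.div_le_self _ _) hu)).1
      simp [h20, h21, hPt.K, hPt.B, hP.K_le, hprev, hquo, Nat.div_div_eq_div_mul, pow_succ]
  refine Stmt.eval_fill₂ (P := P.k) (M := P.K) (by simp [hP2.k, hP2.B, hP.k_le])
      (by simp [hP2.K, hP2.B, hP.K_le]) (by decide) (by decide) (by decide)
      (fun c u v => v = u / 3 ^ c % 3) ?_
  intro c hc u hu t ht h20 h21 hI
  have hPt := hP2.frame ht (by decide)
  refine ⟨_, rfl, ?_⟩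
  have h1 : t.mem aTmp (P.K * c + u) = u / 3 ^ c := by
    rw [ht.2 aTmp (by decide)]; exact htmp c hc u hu
  have h2 : t.mem aRem (u / 3 ^ c) = u / 3 ^ c % 3 := by
    rw [ht.2 aRem (by decide), hf2.2 aRem (by decide)]
    exact (hdiv _ (lt_of_le_of_lt (Nat.div_le_self _ _) hu)).2
  simp [h20, h21, hPt.K, hPt.B, hP.K_le, h1, h2]

/-- Code for the table of the values of the characters. -/
def pairTable : Stmt :=
  .loop 20 ♯rK (.loop 21 ♯rK (.assign 22 1 ;;
    .loop 23 ♯rk (.assign 22 (.load aMul (♯rQ * ♯22 + .load aPow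
      (.load aDig (♯rK * ♯23 + ♯20) * .load aDig (♯rK * ♯23 + ♯21))))) ;;
    .store aPair (♯rK * ♯20 + ♯21) ♯22))

/-- The table of the values of the characters is filled. -/
def PairOK {F : Type} [Field F] (P : Params) (g : F) (s : Config) : Prop :=
  ∀ a < P.K, ∀ u < P.K, s.mem aPair (P.K * a + u) < P.Q ∧
    binVal g (s.mem aPair (P.K * a + u)) = pairing (g ^ P.q) (sigOf P.k a) (sigOf P.k u)

section tables
variable {F : Type} [Field F] {g : F} {P : Params}

theorem pairTable_spec (hF : FieldCode F g P.q) (s : Config) (hP : P.Holds s) (hM : MulOK P g s)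
    (hW : PowOK P g s) (hD : DigOK P s) : PairOK P g (pairTable.eval s) := by
  have hone : 1 < P.Q := by have := hF.pow_lt; have := hF.one_lt; unfold Params.Q; omega
  refine Stmt.eval_fill₂ (P := P.K) (M := P.K) (by simp [hP.K, hP.B, hP.K_le])
    (by simp [hP.K, hP.B, hP.K_le]) (by decide) (by decide) (by decide)
    (fun a u v => v < P.Q ∧ binVal g v = pairing (g ^ P.q) (sigOf P.k a) (sigOf P.k u)) ?_
  intro a ha u hu t ht h20 h21 _
  rw [Stmt.eval_seq, Stmt.eval_seq]
  set t1 := (Stmt.assign 22 1).eval t with ht1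
  have hft1 : Frame _ _ s t1 := ht.trans ((Stmt.assign 22 1).frame t)
  have hP1 : P.Holds t1 := hP.frame hft1 (by decide)
  have h20' : t1.reg 20 = a := by simp [ht1, h20]
  have h21' : t1.reg 21 = u := by simp [ht1, h21]
  have hloop := Stmt.eval_loop (i := 23) (e := ♯rk) (p := .assign 22 (.load aMul (♯rQ * ♯22 + .load aPow
      (.load aDig (♯rK * ♯23 + ♯20) * .load aDig (♯rK * ♯23 + ♯21))))) (s₀ := t1) (n := P.k)
    (by simp [hP1.k, hP1.B, hP.k_le])
    (fun m t' => t'.reg 22 < P.Q ∧ binVal g (t'.reg 22) = ∏ c ∈ Finset.range m,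
      (g ^ P.q) ^ ((a / 3 ^ c % 3) * (u / 3 ^ c % 3)))
    (by simp [ht1, hone]) (by intro j t' h; simpa using h) ?_
  · have hf2 := Stmt.frame (.loop 23 ♯rk (.assign 22 (.load aMul (♯rQ * ♯22 + .load aPow
      (.load aDig (♯rK * ♯23 + ♯20) * .load aDig (♯rK * ♯23 + ♯21)))))) t1
    set t2 := Stmt.eval _ t1
    have hP2 : P.Holds t2 := hP1.frame hf2 (by decide)
    refine ⟨t2.reg 22, ⟨hloop.1, ?_⟩, ?_⟩
    · rw [hloop.2, Finset.prod_range]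
      rfl
    · have e20 : t2.reg 20 = a := by rw [hf2.1 20 (by decide), h20']
      have e21 : t2.reg 21 = u := by rw [hf2.1 21 (by decide), h21']
      simp [e20, e21, hP2.K, hP2.B, hP.K_le, hf2.2 aPair (by decide), ht1]
  · intro c hc t' ht' h23 ⟨hlt, hval⟩
    have hP' : P.Holds t' := hP1.frame ht' (by decide)
    have e20 : t'.reg 20 = a := by rw [ht'.1 20 (by decide), h20']
    have e21 : t'.reg 21 = u := by rw [ht'.1 21 (by decide), h21']
    have hfr := hft1.trans ht'
    have d1 : t'.mem aDig (P.K * c + a) = a / 3 ^ c % 3 := by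
      rw [hfr.2 aDig (by decide)]; exact hD c hc a ha
    have d2 : t'.mem aDig (P.K * c + u) = u / 3 ^ c % 3 := by
      rw [hfr.2 aDig (by decide)]; exact hD c hc u hu
    have hW' := hW (sigOf P.k a ⟨c, hc⟩) (sigOf P.k u ⟨c, hc⟩)
    simp only [sigOf] at hW'
    have hmin : min (a / 3 ^ c % 3) P.B = a / 3 ^ c % 3 :=
      min_eq_left (by have := hP.eight_le; have := Nat.mod_lt (a / 3 ^ c) (by norm_num : 3 > 0); omega)
    have heval : ((Stmt.assign 22 (.load aMul (♯rQ * ♯22 + .load aPow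
      (.load aDig (♯rK * ♯23 + ♯20) * .load aDig (♯rK * ♯23 + ♯21))))).eval t').reg 22 =
        s.mem aMul (P.Q * t'.reg 22 + s.mem aPow ((a / 3 ^ c % 3) * (u / 3 ^ c % 3))) := by
      simp [h23, e20, e21, hP'.K, hP'.Q, hP'.B, hP.K_le, hP.Q_le, d1, d2, hmin,
        hfr.2 aMul (by decide), hfr.2 aPow (by decide)]
    rw [heval, (hM _ hlt _ hW'.1).2, hval, hW'.2, Finset.prod_range_succ]
    exact ⟨(hM _ hlt _ hW'.1).1, rfl⟩

end tables

/-- Code that fills the first `e` cells of the array `A` with random numbers of as many bits as `r`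
says. -/
def drawArray (A : ℕ) (e : Expr) (r : ℕ) : Stmt :=
  .loop 20 e (.assign 22 0 ;; .loop 21 ♯r (.flip 23 ;; .assign 22 (♯22 + ♯22 + ♯23)) ;;
    .store A ♯20 ♯22)

theorem drawArray_spec {A : ℕ} {e : Expr} {r : ℕ} (s : Config) {L : ℕ}
    (hL : min (e.eval s) (s.reg 1) = L) (hr : s.reg r ≤ s.reg 1) (hr12 : r < 12) :
    ((drawArray A e r).eval s).coins = (fun t => s.coins (s.reg r * L + t)) ∧
    ∀ j < L, ((drawArray A e r).eval s).mem A j =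
      bitsNum (s.reg r) fun t => s.coins (s.reg r * j + t) := by
  refine Stmt.eval_loop hL (fun m s' => s'.coins = (fun t => s.coins (s.reg r * m + t)) ∧
    ∀ j < m, s'.mem A j = bitsNum (s.reg r) fun t => s.coins (s.reg r * j + t))
    (by simp) (fun _ _ h => h) ?_
  intro j hj t ht h20 ⟨hcoins, hI⟩
  rw [Stmt.eval_seq, Stmt.eval_seq]
  set t1 := (Stmt.assign 22 0).eval t with ht1
  have hr1 : t1.reg r = s.reg r := by
    simp [ht1, show r ≠ 22 by omega]
    exact ht.1 r (by simp [Stmt.regs]; omega)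
  have h11 : t1.reg 1 = s.reg 1 := by
    simp [ht1]; exact ht.1 1 (by simp [Stmt.regs])
  have hloop := Stmt.eval_loop (i := 21) (e := ♯r) (p := .flip 23 ;; .assign 22 (♯22 + ♯22 + ♯23))
    (s₀ := t1) (n := s.reg r) (by simp [hr1, h11, hr])
    (fun m t' => t'.coins = (fun i => s.coins (s.reg r * j + m + i)) ∧
      t'.reg 22 = bitsNum m fun i => s.coins (s.reg r * j + i))
    (by simp [ht1, hcoins, bitsNum]) (by intro j t' h; simpa using h) ?_
  · have hf2 := Stmt.frame (.loop 21 ♯r (.flip 23 ;; .assign 22 (♯22 + ♯22 + ♯23))) t1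
    set t2 := Stmt.eval _ t1
    have e20 : t2.reg 20 = j := by rw [hf2.1 20 (by simp [Stmt.regs])]; simp [ht1, h20]
    have hmem : t2.mem = t.mem := by
      funext a; rw [hf2.2 a (by simp [Stmt.arrs])]; simp [ht1]
    refine ⟨?_, ?_⟩
    · rw [Stmt.eval_store, Config.setMem_coins, hloop.1]
      rfl
    · intro j' hj'
      simp only [Stmt.eval_store, Expr.eval_var, e20, Config.setMem_mem, if_true, hmem]
      rcases Nat.lt_succ_iff_lt_or_eq.1 hj' with h | rfl
      · rw [Function.update_of_ne h.ne]; exact hI j' h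
      · rw [Function.update_self]; exact hloop.2
  · intro m hm t' _ h21 ⟨hc, hv⟩
    have hval : (t'.toss 23).reg 22 = t'.reg 22 := by simp
    refine ⟨?_, ?_⟩
    · simp only [Stmt.eval_seq, Stmt.eval_flip, Stmt.eval_assign, Config.setReg_coins,
        Config.toss_coins, hc]
      funext i; congr 1; ring
    · simp [bitsNum, hv, hc, two_mul]

/-- The arrays hold the colourings `χ` and the weights `ρ`. -/
structure RandOK {F : Type} [Field F] (P : Params) (g : F)
    (χ : Fin P.N → Fin P.n × Fin P.n → Fin P.k) (ρ : Fin P.n × Fin P.n → F) (s : Config) : Prop where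
  col : ∀ (a : Fin P.N) (x y : Fin P.n), s.mem aCol (P.n * P.n * (a : ℕ) + (P.n * (x : ℕ) + (y : ℕ))) = χ a (x, y)
  lt : ∀ x y : Fin P.n, s.mem aRho (P.n * (x : ℕ) + (y : ℕ)) < P.Q
  rho : ∀ x y : Fin P.n, binVal g (s.mem aRho (P.n * (x : ℕ) + (y : ℕ))) = ρ (x, y)

/-! ### The Tutte matrix and its determinant -/

/-- The number `x` encodes the field element `y`. -/
def Params.Code {F : Type} [Field F] (P : Params) (g : F) (x : ℕ) (y : F) : Prop :=
  x < P.Q ∧ binVal g x = y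

/-- The parameters, all tables, the random choices, and the input `inp` are in place. -/
structure Ready {F : Type} [Field F] (P : Params) (g : F)
    (χ : Fin P.N → Fin P.n × Fin P.n → Fin P.k) (ρ : Fin P.n × Fin P.n → F) (inp : ℕ → ℕ)
    (s : Config) : Prop where
  holds : P.Holds s
  add : AddOK P g s
  mul : MulOK P g s
  inv : InvOK P g s
  pow : PowOK P g s
  dig : DigOK P s
  pair : PairOK P g s
  rand : RandOK P g χ ρ s
  input : s.mem aIn = inp

/-- Code for the sum of two field elements. -/
def addE (a b : Expr) : Expr := .load aAdd (♯rQ * a + b)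

/-- Code for the product of two field elements. -/
def mulE (a b : Expr) : Expr := .load aMul (♯rQ * a + b)

/-- Code for an entry of the matrix. -/
def matE (i j : Expr) : Expr := .load aMat (♯rn * i + j)

section Ready
variable {F : Type} [Field F] {g : F} {P : Params} {χ : Fin P.N → Fin P.n × Fin P.n → Fin P.k}
  {ρ : Fin P.n × Fin P.n → F} {inp : ℕ → ℕ} {s s' : Config}

/-- The registers below `12` and the arrays below `14` are not changed any more once everything is in
place. -/
theorem Ready.frame {R A : List ℕ} (h : Ready P g χ ρ inp s) (hs : Frame R A s s')
    (hR : ∀ r ∈ R, 12 ≤ r) (hA : ∀ a ∈ A, 14 ≤ a) : Ready P g χ ρ inp s' := by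
  have key : ∀ a < 14, s'.mem a = s.mem a := fun a ha => hs.2 a fun h' => by
    have := hA a h'; omega
  refine ⟨h.holds.frame hs hR, ?_, ?_, ?_, ?_, ?_, ?_, ⟨?_, ?_, ?_⟩, ?_⟩
  · intro a ha b hb; rw [key _ (by norm_num)]; exact h.add a ha b hb
  · intro a ha b hb; rw [key _ (by norm_num)]; exact h.mul a ha b hb
  · intro a ha; rw [key _ (by norm_num)]; exact h.inv a ha
  · intro a b; rw [key _ (by norm_num)]; exact h.pow a b
  · intro a ha b hb; rw [key _ (by norm_num)]; exact h.dig a ha b hb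
  · intro a ha b hb; rw [key _ (by norm_num)]; exact h.pair a ha b hb
  · intro a x y; rw [key _ (by norm_num)]; exact h.rand.col a x y
  · intro x y; rw [key _ (by norm_num)]; exact h.rand.lt x y
  · intro x y; rw [key _ (by norm_num)]; exact h.rand.rho x y
  · rw [key _ (by norm_num)]; exact h.input

theorem FieldCode.one_lt_Q (hF : FieldCode F g P.q) : 1 < P.Q := by
  have := hF.pow_lt; have := hF.one_lt; unfold Params.Q; omega

theorem FieldCode.code_zero (hF : FieldCode F g P.q) : P.Code g 0 0 :=
  ⟨by have := hF.one_lt_Q; omega, binVal_zero g⟩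

theorem FieldCode.code_one (hF : FieldCode F g P.q) : P.Code g 1 1 :=
  ⟨hF.one_lt_Q, binVal_one g⟩

theorem FieldCode.code_eq_zero (hF : FieldCode F g P.q) {x : ℕ} {y : F} (h : P.Code g x y) :
    x = 0 ↔ y = 0 := by
  constructor
  · rintro rfl; rw [← h.2, binVal_zero]
  · rintro rfl; exact hF.inj h.1 hF.code_zero.1 (h.2.trans (binVal_zero g).symm)

theorem Ready.addE (h : Ready P g χ ρ inp s) {a b : Expr} {y z : F} (ha : P.Code g (a.eval s) y)
    (hb : P.Code g (b.eval s) z) : P.Code g ((addE a b).eval s) (y + z) := by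
  have e : (DiverseMatching.addE a b).eval s = s.mem aAdd (P.Q * a.eval s + b.eval s) := by
    simp [DiverseMatching.addE, h.holds.Q, h.holds.B, h.holds.Q_le]
  rw [e, ← ha.2, ← hb.2]
  exact h.add _ ha.1 _ hb.1

theorem Ready.mulE (h : Ready P g χ ρ inp s) {a b : Expr} {y z : F} (ha : P.Code g (a.eval s) y)
    (hb : P.Code g (b.eval s) z) : P.Code g ((mulE a b).eval s) (y * z) := by
  have e : (DiverseMatching.mulE a b).eval s = s.mem aMul (P.Q * a.eval s + b.eval s) := by
    simp [DiverseMatching.mulE, h.holds.Q, h.holds.B, h.holds.Q_le]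
  rw [e, ← ha.2, ← hb.2]
  exact h.mul _ ha.1 _ hb.1

theorem Ready.invE (h : Ready P g χ ρ inp s) {a : Expr} {y : F} (ha : P.Code g (a.eval s) y) :
    P.Code g ((Expr.load aInv a).eval s) y⁻¹ := by
  rw [Expr.eval_load, ← ha.2]
  exact h.inv _ ha.1

/-- The array holds the matrix `A`. -/
def MatIs (P : Params) (g : F) (A : Matrix (Fin P.n) (Fin P.n) F) (s : Config) : Prop :=
  ∀ x y : Fin P.n, P.Code g (s.mem aMat (P.n * (x : ℕ) + (y : ℕ))) (A x y)

theorem MatIs.frame {A : Matrix (Fin P.n) (Fin P.n) F} (h : MatIs P g A s) {R B : List ℕ}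
    (hs : Frame R B s s') (hB : aMat ∉ B) : MatIs P g A s' := by
  intro x y; rw [hs.2 _ hB]; exact h x y

theorem Ready.matE_eval (h : Ready P g χ ρ inp s) (i j : Expr) :
    (matE i j).eval s = s.mem aMat (P.n * i.eval s + j.eval s) := by
  simp [DiverseMatching.matE, h.holds.n, h.holds.B, h.holds.n_le]

theorem Ready.matE (h : Ready P g χ ρ inp s) {A : Matrix (Fin P.n) (Fin P.n) F} (hA : MatIs P g A s)
    {i j : Expr} {x y : Fin P.n} (hi : i.eval s = x) (hj : j.eval s = y) :
    P.Code g ((matE i j).eval s) (A x y) := by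
  rw [h.matE_eval, hi, hj]; exact hA x y

/-- Code for the power of the cube root of unity by which the character number `e` weighs the edge
in register `39` in the colouring number `a`. -/
def facE (a e : Expr) : Expr :=
  .load aPow (.load aDig (♯rK * .load aCol (♯rn * ♯rn * a + ♯39) + e))

theorem Ready.facE (h : Ready P g χ ρ inp s) {a e : Expr} {α : Fin P.N} {x y : Fin P.n} {σ : ℕ}
    (ha : a.eval s = α) (h39 : s.reg 39 = P.n * x + y) (he : e.eval s = σ) (hσ : σ < P.K) :
    P.Code g ((facE a e).eval s) ((g ^ P.q) ^ (sigOf P.k σ (χ α (x, y)) : ℕ)) := by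
  have h1 : (DiverseMatching.facE a e).eval s = s.mem aPow (s.mem aDig
      (P.K * s.mem aCol (P.n * P.n * α + (P.n * x + y)) + σ)) := by
    simp [DiverseMatching.facE, h.holds.n, h.holds.K, h.holds.B, h.holds.n_le, h.holds.K_le,
      h.holds.nn_le, ha, h39, he]
  rw [h1, h.rand.col, h.dig _ (χ α (x, y)).2 _ hσ]
  have := h.pow (sigOf P.k σ (χ α (x, y))) 1
  simpa [sigOf, Params.Code] using this

/-- Code that computes the entries of the Tutte matrix of the graph whose code begins at the content
of register `30`, with the weights given by the colourings in the registers `31` and `33` and the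
characters in the registers `35` and `36`. -/
def buildMat : Stmt :=
  .loop 37 ♯rn (.loop 38 ♯rn (
    .assign 39 (♯rn * (♯37 - (♯37 - ♯38)) + (♯38 + (♯37 - ♯38))) ;;
    .ite ((♯37 - ♯38) + (♯38 - ♯37))
      (.ite (.load aIn (♯30 + 1 + ♯rn + (♯rn * ♯37 + ♯38)))
        (.assign 40 (mulE (mulE (.load aRho ♯39) (facE ♯31 ♯35)) (facE ♯33 ♯36)))
        (.assign 40 0))
      (.assign 40 (1 - .load aIn (♯30 + 1 + ♯37))) ;;
    .store aMat (♯rn * ♯37 + ♯38) ♯40))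

open Classical in
/-- The code of the graph `G` stands in `inp` from `base` on. -/
def GraphAt {n : ℕ} (G : Graph n) (inp : ℕ → ℕ) (base : ℕ) : Prop :=
  (∀ v : Fin n, inp (base + 1 + v) = if v ∈ G.verts then 1 else 0) ∧
  ∀ x y : Fin n, inp (base + 1 + n + (n * x + y)) = if G.Adj x y then 1 else 0

theorem buildMat_spec (hF : FieldCode F g P.q) (h : Ready P g χ ρ inp s) {G : Graph P.n}
    (hG : GraphAt G inp (s.reg 30)) {a b : Fin P.N} {σ σ' : ℕ} (ha : s.reg 31 = a)
    (hb : s.reg 33 = b) (hs : s.reg 35 = σ) (hs' : s.reg 36 = σ') (hσ : σ < P.K) (hσ' : σ' < P.K) :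
    MatIs P g (tutteMatrix G fun e => ρ e * (g ^ P.q) ^ (sigOf P.k σ (χ a e) : ℕ) *
      (g ^ P.q) ^ (sigOf P.k σ' (χ b e) : ℕ)) (buildMat.eval s) := by
  classical
  have key := Stmt.eval_fill₂ (i := 37) (j := 38) (A := aMat) (r := rn) (e := ♯rn) (p :=
    .assign 39 (♯rn * (♯37 - (♯37 - ♯38)) + (♯38 + (♯37 - ♯38))) ;;
    .ite ((♯37 - ♯38) + (♯38 - ♯37))
      (.ite (.load aIn (♯30 + 1 + ♯rn + (♯rn * ♯37 + ♯38)))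
        (.assign 40 (mulE (mulE (.load aRho ♯39) (facE ♯31 ♯35)) (facE ♯33 ♯36)))
        (.assign 40 0))
      (.assign 40 (1 - .load aIn (♯30 + 1 + ♯37))) ;;
    .store aMat (♯rn * ♯37 + ♯38) ♯40)
    (s₀ := s) (P := P.n) (M := P.n) (by simp [h.holds.n, h.holds.B, h.holds.n_le])
    (by simp [h.holds.n, h.holds.B, h.holds.n_le]) (by decide) (by decide) (by decide)
    (fun x y v => ∀ (hx : x < P.n) (hy : y < P.n), P.Code g v
      (tutteMatrix G (fun e => ρ e * (g ^ P.q) ^ (sigOf P.k σ (χ a e) : ℕ) *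
      (g ^ P.q) ^ (sigOf P.k σ' (χ b e) : ℕ)) ⟨x, hx⟩ ⟨y, hy⟩)) ?_
  · exact fun x y => key x x.2 y y.2 x.2 y.2
  intro x hx y hy t ht h37 h38 _
  set e39 : Expr := ♯rn * (♯37 - (♯37 - ♯38)) + (♯38 + (♯37 - ♯38)) with he39
  rw [Stmt.eval_seq, Stmt.eval_seq]
  set t1 := (Stmt.assign 39 e39).eval t with ht1
  have hf1 : Frame _ _ s t1 := ht.trans (Stmt.frame _ _)
  have hR1 : Ready P g χ ρ inp t1 := h.frame hf1 (by decide) (by decide)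
  have hP := (h.frame ht (by decide) (by decide)).holds
  have h37' : t1.reg 37 = x := by simp [ht1, h37]
  have h38' : t1.reg 38 = y := by simp [ht1, h38]
  have h39 : t1.reg 39 = P.n * min x y + max x y := by
    have e1 : x - (x - y) = min x y := by omega
    have e2 : y + (x - y) = max x y := by omega
    simp [ht1, he39, h37, h38, hP.n, hP.B, hP.n_le, e1, e2]
  have h30 : t1.reg 30 = s.reg 30 := hf1.1 30 (by decide)
  set p2 : Stmt := .ite ((♯37 - ♯38) + (♯38 - ♯37))
      (.ite (.load aIn (♯30 + 1 + ♯rn + (♯rn * ♯37 + ♯38)))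
        (.assign 40 (mulE (mulE (.load aRho ♯39) (facE ♯31 ♯35)) (facE ♯33 ♯36)))
        (.assign 40 0))
      (.assign 40 (1 - .load aIn (♯30 + 1 + ♯37))) with hp2
  have hf2 : Frame [40] [] t1 (p2.eval t1) := (Stmt.frame _ _).mono (by decide) (by decide)
  refine ⟨(p2.eval t1).reg 40, ?_, ?_⟩
  · intro hx hy
    rw [hp2, Stmt.eval_ite]
    simp only [tutteMatrix]
    by_cases hxy : x = y
    · subst hxy
      have hv := hG.1 ⟨x, hx⟩
      simp only at hv
      rw [if_neg (by simp [h37', h38']), if_pos rfl]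
      simp only [Stmt.eval_assign, Config.setReg_reg, if_true, Expr.eval_sub, Expr.eval_one,
        Expr.eval_load, Expr.eval_add, Expr.eval_var, h37', h30, hR1.input, hv]
      split_ifs
      · simpa using hF.code_zero
      · simpa using hF.code_one
    · have hv := hG.2 ⟨x, hx⟩ ⟨y, hy⟩
      simp only at hv
      rw [if_pos (by simp [h37', h38']; omega), if_neg (by simpa using hxy), Stmt.eval_ite]
      have he : (Expr.load aIn (♯30 + 1 + ♯rn + (♯rn * ♯37 + ♯38))).eval t1 =
          if G.Adj ⟨x, hx⟩ ⟨y, hy⟩ then 1 else 0 := by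
        rw [← hv]
        simp [h37', h38', h30, hR1.input, hR1.holds.n, hR1.holds.B, hP.n_le]
      rw [he]
      split_ifs with hadj h1 h1
      · rw [Stmt.eval_assign, Config.setReg_reg, if_pos rfl]
        have hm : min (⟨x, hx⟩ : Fin P.n) ⟨y, hy⟩ = ⟨min x y, by omega⟩ := by
          apply Fin.ext
          rcases le_total x y with h | h
          · rw [min_eq_left (by simpa using h)]; simp [h]
          · rw [min_eq_right (by simpa using h)]; simp [h]
        have hM : max (⟨x, hx⟩ : Fin P.n) ⟨y, hy⟩ = ⟨max x y, by omega⟩ := by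
          apply Fin.ext
          rcases le_total x y with h | h
          · rw [max_eq_right (by simpa using h)]; simp [h]
          · rw [max_eq_left (by simpa using h)]; simp [h]
        rw [hm, hM]
        refine hR1.mulE (hR1.mulE ?_ (hR1.facE ?_ ?_ ?_ hσ)) (hR1.facE ?_ ?_ ?_ hσ')
        · rw [Expr.eval_load, Expr.eval_var, h39]
          exact ⟨hR1.rand.lt ⟨min x y, by omega⟩ ⟨max x y, by omega⟩,
            hR1.rand.rho ⟨min x y, by omega⟩ ⟨max x y, by omega⟩⟩
        · rw [Expr.eval_var, hf1.1 31 (by decide), ha]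
        · exact h39
        · rw [Expr.eval_var, hf1.1 35 (by decide), hs]
        · rw [Expr.eval_var, hf1.1 33 (by decide), hb]
        · exact h39
        · rw [Expr.eval_var, hf1.1 36 (by decide), hs']
      · exact absurd one_ne_zero h1
      · exact absurd rfl h1
      · simpa using hF.code_zero
  · have hR2 := hR1.frame hf2 (by decide) (by decide)
    have e37 : (p2.eval t1).reg 37 = x := by rw [hf2.1 37 (by decide), h37']
    have e38 : (p2.eval t1).reg 38 = y := by rw [hf2.1 38 (by decide), h38']
    have hmem : (p2.eval t1).mem aMat = t.mem aMat := hf2.2 aMat (by decide)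
    simp [e37, e38, hR2.holds.n, hR2.holds.B, hP.n_le, hmem]

/-- Code that adds the multiple by the content of register `52` of the row `src` to the row `dst`. -/
def addRow (dst src : ℕ) : Stmt :=
  .loop 53 ♯rn (.store aMat (♯rn * ♯dst + ♯53)
    (addE (matE ♯dst ♯53) (mulE ♯52 (matE ♯src ♯53))))

/-- A row operation that preserves the determinant is carried out in place. -/
theorem addRow_spec (h : Ready P g χ ρ inp s) {A : Matrix (Fin P.n) (Fin P.n) F}
    (hA : MatIs P g A s) {dst src : ℕ} (h1 : dst ≠ 53) (h2 : src ≠ 53) {i j : Fin P.n}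
    (hi : s.reg dst = i) (hj : s.reg src = j) {l : F} (hl : P.Code g (s.reg 52) l) :
    MatIs P g (A.updateRow i (A i + l • A j)) ((addRow dst src).eval s) := by
  have key := Stmt.eval_loop (i := 53) (e := ♯rn) (p := .store aMat (♯rn * ♯dst + ♯53)
    (addE (matE ♯dst ♯53) (mulE ♯52 (matE ♯src ♯53)))) (s₀ := s) (n := P.n)
    (by simp [h.holds.n, h.holds.B, h.holds.n_le])
    (fun m t => MatIs P g (fun x y => if x = i ∧ (y : ℕ) < m then A i y + l * A j y else A x y) t)
    (by simpa using hA) (fun _ _ h => h) ?_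
  · intro x y
    have hxy := key x y
    by_cases hx : x = i
    · subst hx
      simpa [addRow] using hxy
    · simpa [addRow, hx] using hxy
  intro c hc t ht h53 hI
  have hR := h.frame ht (by simp [Stmt.regs]) (by simp [Stmt.arrs])
  have hd : t.reg dst = i := by rw [ht.1 dst (by simp [Stmt.regs, h1]), hi]
  have hsr : t.reg src = j := by rw [ht.1 src (by simp [Stmt.regs, h2]), hj]
  have h52 : P.Code g (t.reg 52) l := by rw [ht.1 52 (by simp [Stmt.regs])]; exact hl
  have hval := hR.addE (hR.matE hI (i := ♯dst) (j := ♯53) (y := ⟨c, hc⟩) hd h53)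
    (hR.mulE (a := ♯52) h52 (hR.matE hI (i := ♯src) (j := ♯53) (y := ⟨c, hc⟩) hsr h53))
  simp only [lt_self_iff_false, if_false, and_false] at hval
  intro x y
  rw [Stmt.eval_store, Config.setMem_mem, if_pos rfl]
  have he : (♯rn * ♯dst + ♯53 : Expr).eval t = P.n * i + c := by
    simp [hR.holds.n, hR.holds.B, h.holds.n_le, hd, h53]
  rw [he]
  by_cases hxy : x = i ∧ (y : ℕ) = c
  · obtain ⟨rfl, hyc⟩ := hxy
    obtain rfl : y = ⟨c, hc⟩ := Fin.ext hyc
    simp only [Function.update_self, true_and, Nat.lt_succ_self, if_true]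
    exact hval
  · rw [Function.update_of_ne]
    · have hlt : (x = i ∧ (y : ℕ) < c + 1) ↔ (x = i ∧ (y : ℕ) < c) := by
        constructor
        · rintro ⟨h, h'⟩
          exact ⟨h, lt_of_le_of_ne (Nat.lt_succ_iff.1 h') fun h'' => hxy ⟨h, h''⟩⟩
        · rintro ⟨h, h'⟩; exact ⟨h, by omega⟩
      simp only [hlt]
      exact hI x y
    · intro he
      have := (mul_add_inj y.2 hc).1 he
      exact hxy ⟨Fin.ext this.1, this.2⟩

/-- Code for Gaussian elimination.  Where the pivot vanishes, the row that is to be eliminated is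
first added to the pivot row. -/
def elim : Stmt :=
  .loop 50 ♯rn (.loop 51 (♯rn - (♯50 + 1)) (
    .assign 54 (♯50 + 1 + ♯51) ;;
    .ite (matE ♯50 ♯50) (.assign 52 0) (.assign 52 1) ;;
    addRow 50 54 ;;
    .assign 52 (mulE (matE ♯54 ♯50) (.load aInv (matE ♯50 ♯50))) ;;
    addRow 54 50))

/-- Code for the product of the diagonal entries, which becomes the content of register `41`. -/
def diagProd : Stmt :=
  .assign 41 1 ;; .loop 50 ♯rn (.assign 41 (mulE ♯41 (matE ♯50 ♯50)))

/-- The matrix becomes upper triangular, and its determinant does not change. -/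
theorem elim_spec (hF : FieldCode F g P.q) (h : Ready P g χ ρ inp s)
    {A : Matrix (Fin P.n) (Fin P.n) F} (hA : MatIs P g A s) :
    ∃ A' : Matrix (Fin P.n) (Fin P.n) F, MatIs P g A' (elim.eval s) ∧ A'.det = A.det ∧ ∀ x y, y < x → A' x y = 0 := by
  have hchar := hF.char
  have key := Stmt.eval_loop (i := 50) (e := ♯rn) (p := .loop 51 (♯rn - (♯50 + 1)) (
      .assign 54 (♯50 + 1 + ♯51) ;;
      .ite (matE ♯50 ♯50) (.assign 52 0) (.assign 52 1) ;;
      addRow 50 54 ;;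
      .assign 52 (mulE (matE ♯54 ♯50) (.load aInv (matE ♯50 ♯50))) ;;
      addRow 54 50)) (s₀ := s) (n := P.n) (by simp [h.holds.n, h.holds.B, h.holds.n_le])
    (fun m t => ∃ A' : Matrix (Fin P.n) (Fin P.n) F, MatIs P g A' t ∧ A'.det = A.det ∧
      ∀ x y : Fin P.n, y < x → (y : ℕ) < m → A' x y = 0)
    ⟨A, hA, rfl, by simp⟩ (fun _ _ h => h) ?_
  · obtain ⟨A', h1, h2, h3⟩ := key
    exact ⟨A', h1, h2, fun x y hxy => h3 x y hxy y.2⟩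
  rintro c hc t ht h50 ⟨A₁, hA₁, hdet₁, hz₁⟩
  have hR := h.frame ht (by decide) (by decide)
  have hinner := Stmt.eval_loop (i := 51) (e := ♯rn - (♯50 + 1)) (p :=
      .assign 54 (♯50 + 1 + ♯51) ;;
      .ite (matE ♯50 ♯50) (.assign 52 0) (.assign 52 1) ;;
      addRow 50 54 ;;
      .assign 52 (mulE (matE ♯54 ♯50) (.load aInv (matE ♯50 ♯50))) ;;
      addRow 54 50) (s₀ := t) (n := P.n - (c + 1))
    (by have := h.holds.n_le; simp [hR.holds.n, hR.holds.B, h50]; omega)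
    (fun m t' => ∃ A' : Matrix (Fin P.n) (Fin P.n) F, MatIs P g A' t' ∧ A'.det = A.det ∧
      (∀ x y : Fin P.n, y < x → (y : ℕ) < c → A' x y = 0) ∧
      ∀ x : Fin P.n, c < x → (x : ℕ) < c + 1 + m → A' x ⟨c, hc⟩ = 0)
    ⟨A₁, hA₁, hdet₁, hz₁, by intro x h1 h2; omega⟩ (fun _ _ h => h) ?_
  · obtain ⟨A', h1, h2, h3, h4⟩ := hinner
    refine ⟨A', h1, h2, fun x y hxy hy => ?_⟩
    rcases Nat.lt_succ_iff_lt_or_eq.1 hy with hy | hy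
    · exact h3 x y hxy hy
    · obtain rfl : y = ⟨c, hc⟩ := Fin.ext hy
      exact h4 x hxy (by have := x.2; omega)
  rintro d hd t' ht' h51 ⟨A₂, hA₂, hdet₂, hz₂, hz₂'⟩
  have h50t : t'.reg 50 = c := by rw [ht'.1 50 (by decide), h50]
  obtain ⟨C, rfl⟩ : ∃ C : Fin P.n, c = C := ⟨⟨c, hc⟩, rfl⟩
  obtain ⟨r, hr⟩ : ∃ r : Fin P.n, (r : ℕ) = C + 1 + d := ⟨⟨C + 1 + d, by omega⟩, rfl⟩
  have hCr : C < r := by rw [Fin.lt_def]; omega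
  simp only [Stmt.eval_seq]
  -- the pivot row is changed if the pivot vanishes
  set t1 := (Stmt.assign 54 (♯50 + 1 + ♯51)).eval t' with ht1
  have hf1 : Frame _ _ t t1 := ht'.trans (Stmt.frame _ _)
  have hR1 := hR.frame hf1 (by decide) (by decide)
  have hM1 : MatIs P g A₂ t1 := hA₂
  have h54 : t1.reg 54 = r := by simp [ht1, h50t, h51, hr]
  have h50' : t1.reg 50 = C := by simp [ht1, h50t]
  have hpiv := hR1.matE hM1 (i := ♯50) (j := ♯50) h50' h50'
  set p2 : Stmt := .ite (matE ♯50 ♯50) (.assign 52 0) (.assign 52 1) with hp2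
  set t2 := p2.eval t1 with ht2
  have hf2 : Frame [52] [] t1 t2 := (Stmt.frame _ _).mono (by decide) (by decide)
  have hR2 := hR1.frame hf2 (by decide) (by decide)
  have hM2 := hM1.frame hf2 (by decide)
  obtain ⟨l, hl, hl0⟩ : ∃ l : F, P.Code g (t2.reg 52) l ∧
      ((A₂ C C = 0 ∧ l = 1) ∨ (A₂ C C ≠ 0 ∧ l = 0)) := by
    by_cases h0 : A₂ C C = 0
    · refine ⟨1, ?_, Or.inl ⟨h0, rfl⟩⟩
      rw [ht2, hp2, Stmt.eval_ite, if_neg (not_not.2 ((hF.code_eq_zero hpiv).2 h0))]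
      simpa using hF.code_one
    · refine ⟨0, ?_, Or.inr ⟨h0, rfl⟩⟩
      rw [ht2, hp2, Stmt.eval_ite, if_pos (mt (hF.code_eq_zero hpiv).1 h0)]
      simpa using hF.code_zero
  have h50'' : t2.reg 50 = C := by rw [hf2.1 50 (by decide), h50']
  have h54' : t2.reg 54 = r := by rw [hf2.1 54 (by decide), h54]
  have hM3 := addRow_spec hR2 hM2 (dst := 50) (src := 54) (by decide) (by decide) h50'' h54' hl
  have hf3 := (addRow 50 54).frame t2
  set t3 := (addRow 50 54).eval t2
  set A₃ := A₂.updateRow C (A₂ C + l • A₂ r) with hA₃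
  have hR3 := hR2.frame hf3 (by decide) (by decide)
  have h50₃ : t3.reg 50 = C := by rw [hf3.1 50 (by decide), h50'']
  have h54₃ : t3.reg 54 = r := by rw [hf3.1 54 (by decide), h54']
  have hmul := hR3.mulE (hR3.matE hM3 (i := ♯54) (j := ♯50) h54₃ h50₃)
    (hR3.invE (hR3.matE hM3 (i := ♯50) (j := ♯50) h50₃ h50₃))
  set t4 := (Stmt.assign 52 (mulE (matE ♯54 ♯50) (.load aInv (matE ♯50 ♯50)))).eval t3 with ht4
  have hR4 : Ready P g χ ρ inp t4 :=
    hR3.frame (Stmt.frame (.assign 52 (mulE (matE ♯54 ♯50) (.load aInv (matE ♯50 ♯50)))) t3)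
      (by decide) (by decide)
  have hM4 : MatIs P g A₃ t4 := hM3
  have hM5 := addRow_spec hR4 hM4 (dst := 54) (src := 50) (by decide) (by decide)
    (i := r) (j := C) (l := A₃ r C * (A₃ C C)⁻¹)
    (by simp [ht4, h54₃]) (by simp [ht4, h50₃]) (by simpa [ht4] using hmul)
  have e3 : ∀ x, x ≠ C → A₃ x = A₂ x := fun x hx => by rw [hA₃, Matrix.updateRow_ne hx]
  have e3C : A₃ C = A₂ C + l • A₂ r := by rw [hA₃, Matrix.updateRow_self]
  refine ⟨_, hM5, ?_, ?_, ?_⟩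
  · rw [Matrix.det_updateRow_add_smul_self _ hCr.ne', hA₃,
      Matrix.det_updateRow_add_smul_self _ hCr.ne, hdet₂]
  · intro x y (hyx : y < x) (hyC : (y : ℕ) < C)
    have hyC' : y < C := hyC
    have e4 : A₃ C y = 0 := by
      simp [e3C, hz₂ C y hyC' hyC, hz₂ r y (hyC'.trans hCr) hyC]
    by_cases hx : x = r
    · subst hx
      rw [Matrix.updateRow_self]
      simp [e4, e3 x hCr.ne', hz₂ x y hyx hyC]
    · rw [Matrix.updateRow_ne hx]
      by_cases hxC : x = C
      · rw [hxC, e4]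
      · rw [e3 x hxC, hz₂ x y hyx hyC]
  · intro x hCx hx
    by_cases hxr : x = r
    · subst hxr
      rw [Matrix.updateRow_self]
      by_cases h0 : A₃ C C = 0
      · -- the row to be eliminated has been added to the pivot row
        have : A₃ x C = 0 := by
          rcases hl0 with ⟨h1, rfl⟩ | ⟨h1, rfl⟩
          · rw [e3C] at h0
            simpa [h1, e3 x hCr.ne'] using h0
          · rw [e3C] at h0
            simp at h0
            exact absurd h0 h1
        simp [this]
      · simp only [Pi.add_apply, Pi.smul_apply, smul_eq_mul]
        rw [inv_mul_cancel_right₀ h0]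
        exact CharTwo.add_self_eq_zero _
    · rw [Matrix.updateRow_ne hxr, e3 x (by rintro rfl; exact absurd hCx (lt_irrefl _))]
      refine hz₂' x hCx ?_
      have : (x : ℕ) ≠ r := fun h => hxr (Fin.ext h)
      omega

theorem diagProd_spec (hF : FieldCode F g P.q) (h : Ready P g χ ρ inp s)
    {A : Matrix (Fin P.n) (Fin P.n) F} (hA : MatIs P g A s) :
    P.Code g ((diagProd.eval s).reg 41) (∏ x, A x x) := by
  rw [diagProd, Stmt.eval_seq]
  have hR := h.frame ((Stmt.assign 41 1).frame s) (by decide) (by decide)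
  have key := Stmt.eval_loop (i := 50) (e := ♯rn) (p := .assign 41 (mulE ♯41 (matE ♯50 ♯50)))
    (s₀ := (Stmt.assign 41 1).eval s) (n := P.n)
    (by rw [Expr.eval_var, hR.holds.n, hR.holds.B, min_eq_left h.holds.n_le])
    (fun m t => P.Code g (t.reg 41) (∏ x ∈ Finset.range m, if hx : x < P.n then A ⟨x, hx⟩ ⟨x, hx⟩ else 1))
    (by simpa using hF.code_one) (by intro j t h; simpa using h) ?_
  · rw [Finset.prod_range] at key
    simpa using key
  intro c hc t ht h50 hI
  have hRt := hR.frame ht (by decide) (by decide)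
  have hM : MatIs P g A t := MatIs.frame (s := (Stmt.assign 41 1).eval s) hA ht (by decide)
  rw [Finset.prod_range_succ, dif_pos hc, Stmt.eval_assign, Config.setReg_reg, if_pos rfl]
  exact hRt.mulE (a := ♯41) hI (hRt.matE hM (x := ⟨c, hc⟩) (y := ⟨c, hc⟩) h50 h50)

/-- Code that computes `testValue` into register `42`, for the colourings in the registers `31` and
`33` and the signatures in the registers `32` and `34`. -/
def test : Stmt :=
  .assign 42 0 ;;
  .loop 35 ♯rK (.loop 36 ♯rK (buildMat ;; elim ;; diagProd ;;
    .assign 42 (addE ♯42 (mulE (mulE (.load aPair (♯rK * ♯35 + ♯32))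
      (.load aPair (♯rK * ♯36 + ♯34))) ♯41))))

theorem test_spec (hF : FieldCode F g P.q) (h : Ready P g χ ρ inp s) {G : Graph P.n}
    (hG : GraphAt G inp (s.reg 30)) {a b : Fin P.N} {u v : ℕ} (ha : s.reg 31 = a)
    (hu : s.reg 32 = u) (hb : s.reg 33 = b) (hv : s.reg 34 = v) (huK : u < P.K) (hvK : v < P.K) :
    P.Code g ((test.eval s).reg 42)
      (testValue (g ^ P.q) G ρ (χ a) (χ b) (sigOf P.k u) (sigOf P.k v)) := by
  set f : (Fin P.k → Fin 3) → (Fin P.k → Fin 3) → F := fun z z' =>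
    pairing (g ^ P.q) z (sigOf P.k u) * pairing (g ^ P.q) z' (sigOf P.k v) *
    (tutteMatrix G fun e => ρ e * (g ^ P.q) ^ (z (χ a e) : ℕ) * (g ^ P.q) ^ (z' (χ b e) : ℕ)).det
    with hf
  have htv : testValue (g ^ P.q) G ρ (χ a) (χ b) (sigOf P.k u) (sigOf P.k v) =
      ∑ z ∈ Finset.range P.K, ∑ z' ∈ Finset.range P.K, f (sigOf P.k z) (sigOf P.k z') := by
    simp_rw [Params.K]
    rw [sum_sigOf P.k fun z => ∑ z' ∈ Finset.range (3 ^ P.k), f z (sigOf P.k z')]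
    simp_rw [sum_sigOf P.k (f _)]
    rfl
  rw [htv, test, Stmt.eval_seq]
  have hf0 := (Stmt.assign 42 0).frame s
  have hR0 := h.frame hf0 (by decide) (by decide)
  set s1 := (Stmt.assign 42 0).eval s with hs1
  have h42 : s1.reg 42 = 0 := by simp [hs1]
  refine Stmt.eval_loop (by rw [Expr.eval_var, hR0.holds.K, hR0.holds.B, min_eq_left h.holds.K_le])
    (fun m t => P.Code g (t.reg 42)
      (∑ z ∈ Finset.range m, ∑ z' ∈ Finset.range P.K, f (sigOf P.k z) (sigOf P.k z')))
    (by rw [h42]; simpa using hF.code_zero) (by intro j t h; simpa using h) ?_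
  intro z hz t ht h35 hI
  have hRt := hR0.frame ht (by decide) (by decide)
  rw [Finset.sum_range_succ]
  refine Stmt.eval_loop (by rw [Expr.eval_var, hRt.holds.K, hRt.holds.B, min_eq_left h.holds.K_le])
    (fun m t => P.Code g (t.reg 42)
      ((∑ z ∈ Finset.range z, ∑ z' ∈ Finset.range P.K, f (sigOf P.k z) (sigOf P.k z')) +
        ∑ z' ∈ Finset.range m, f (sigOf P.k z) (sigOf P.k z')))
    (by simpa using hI) (by intro j t h; simpa using h) ?_
  intro z' hz' t' ht' h36 hI'
  have hft := (hf0.trans ht).trans ht'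
  have hRt' := hRt.frame ht' (by decide) (by decide)
  simp only [Stmt.eval_seq]
  have h35' : t'.reg 35 = z := by rw [ht'.1 35 (by decide), h35]
  have hM := buildMat_spec hF hRt' (G := G) (a := a) (b := b) (σ := z) (σ' := z')
    (by rw [hft.1 30 (by decide)]; exact hG) (by rw [hft.1 31 (by decide), ha])
    (by rw [hft.1 33 (by decide), hb]) h35' h36 hz hz'
  have hf1 := buildMat.frame t'
  set t1 := buildMat.eval t'
  have hR1 := hRt'.frame hf1 (by decide) (by decide)
  obtain ⟨A, hA, hdet, htri⟩ := elim_spec hF hR1 hM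
  have hf2 := elim.frame t1
  set t2 := elim.eval t1
  have hR2 := hR1.frame hf2 (by decide) (by decide)
  have hd := diagProd_spec hF hR2 hA
  have hf3 := diagProd.frame t2
  set t3 := diagProd.eval t2
  have hR3 := hR2.frame hf3 (by decide) (by decide)
  rw [← Matrix.det_of_isUpperTriangular (fun x y h => htri x y h), hdet] at hd
  have hf13 := (hf1.trans hf2).trans hf3
  have hfs3 := hft.trans hf13
  have hpair : ∀ {i j : ℕ} {z w : ℕ}, t3.reg i = z → t3.reg j = w → z < P.K → w < P.K →
      P.Code g ((Expr.load aPair (♯rK * ♯i + ♯j)).eval t3)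
        (pairing (g ^ P.q) (sigOf P.k z) (sigOf P.k w)) := by
    rintro i j z w hi hj hz hw
    have := hR3.pair z hz w hw
    simpa [hR3.holds.K, hR3.holds.B, h.holds.K_le, hi, hj, Params.Code] using this
  rw [Finset.sum_range_succ, ← add_assoc, Stmt.eval_assign, Config.setReg_reg, if_pos rfl]
  refine hR3.addE ?_ (hR3.mulE (hR3.mulE (hpair ?_ ?_ hz huK) (hpair ?_ ?_ hz' hvK)) hd)
  · rw [Expr.eval_var, hf13.1 42 (by decide)]; exact hI'
  · rw [hf13.1 35 (by decide), h35']
  · rw [hfs3.1 32 (by decide), hu]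
  · rw [hf13.1 36 (by decide), h36]
  · rw [hfs3.1 34 (by decide), hv]

end Ready

/-! ### Dynamic programming over the stages -/

/-- A loop that sets the flag in register `f` if some round finds what is sought. -/
theorem eval_search {i f : ℕ} {e : Expr} {p : Stmt} {s₀ : Config} {n : ℕ}
    (hn : min (e.eval s₀) (s₀.reg 1) = n) (hf : f ≠ i) (C : ℕ → Prop)
    (hstep : ∀ j < n, ∀ s, Frame (i :: p.regs) p.arrs s₀ s → s.reg i = j →
      ((p.eval s).reg f ≠ 0 ↔ s.reg f ≠ 0 ∨ C j)) :
    ((Stmt.loop i e p).eval s₀).reg f ≠ 0 ↔ s₀.reg f ≠ 0 ∨ ∃ j < n, C j := by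
  refine Stmt.eval_loop hn (fun m s => s.reg f ≠ 0 ↔ s₀.reg f ≠ 0 ∨ ∃ j < m, C j) (by simp)
    (by intro j s h; simpa [hf] using h) ?_
  intro j hj s hs hi hI
  rw [hstep j hj s hs hi, hI, or_assoc]
  refine or_congr_right ⟨?_, ?_⟩
  · rintro (⟨j', h, h'⟩ | h)
    · exact ⟨j', by omega, h'⟩
    · exact ⟨j, by omega, h⟩
  · rintro ⟨j', h, h'⟩
    rcases Nat.lt_succ_iff_lt_or_eq.1 h with h | rfl
    · exact Or.inl ⟨j', h, h'⟩
    · exact Or.inr h'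

/-- Code that counts into register `44` the digits in which the signatures with the numbers in the
registers `43` and `32` differ. -/
def distCount : Stmt :=
  .assign 44 0 ;; .loop 45 ♯rk (.ite
    ((.load aDig (♯rK * ♯45 + ♯43) - .load aDig (♯rK * ♯45 + ♯32)) +
      (.load aDig (♯rK * ♯45 + ♯32) - .load aDig (♯rK * ♯45 + ♯43)))
    (.assign 44 (♯44 + 1)) .skip)

/-- Code that sets the flag in register `46` if one of the current signatures for the colouring in
register `31` is far from the signature in register `32`. -/
def searchFar : Stmt :=
  .loop 43 ♯rK (.ite (.load aCur (♯rK * ♯31 + ♯43))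
    (distCount ;; .ite (♯44 + 1 - ♯rℓ) (.assign 46 1) .skip) .skip)

/-- Code that decides whether the signature in register `34` for the colouring in register `33` is
reachable in the next stage. -/
def cell : Stmt :=
  .assign 46 0 ;; .loop 31 ♯rN (.loop 32 ♯rK (test ;; .ite ♯42 searchFar .skip)) ;;
  .store aNext (♯rK * ♯33 + ♯34) ♯46

/-- Code for a stage of the dynamic program. -/
def stage : Stmt :=
  .loop 33 ♯rN (.loop 34 ♯rK cell) ;;
  .loop 33 ♯rN (.loop 34 ♯rK
    (.store aCur (♯rK * ♯33 + ♯34) (.load aNext (♯rK * ♯33 + ♯34)))) ;;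
  .assign 30 (♯30 + (1 + ♯rn + ♯rn * ♯rn))

/-- Code for the dynamic program. -/
def dynamicProgram : Stmt :=
  .loop 33 ♯rN (.loop 34 ♯rK (.store aCur (♯rK * ♯33 + ♯34) 1)) ;;
  .assign 30 2 ;;
  .loop 47 ♯rτ stage ;;
  .assign 46 0 ;;
  .loop 33 ♯rN (.loop 34 ♯rK (.ite (.load aCur (♯rK * ♯33 + ♯34)) (.assign 46 1) .skip)) ;;
  .ite ♯46 (.assign 0 1) (.assign 0 0)

section Ready
variable {F : Type} [Field F] {g : F} {P : Params} {χ : Fin P.N → Fin P.n × Fin P.n → Fin P.k}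
  {ρ : Fin P.n × Fin P.n → F} {inp : ℕ → ℕ} {s s' : Config}

theorem distCount_spec (h : Ready P g χ ρ inp s) {u w : ℕ} (hu : s.reg 32 = u) (hw : s.reg 43 = w)
    (huK : u < P.K) (hwK : w < P.K) :
    (distCount.eval s).reg 44 = hammingDist (sigOf P.k w) (sigOf P.k u) := by
  rw [distCount, Stmt.eval_seq]
  have hf0 := (Stmt.assign 44 0).frame s
  have hR := h.frame hf0 (by decide) (by decide)
  have key := Stmt.eval_loop (i := 45) (e := ♯rk) (p := .ite
    ((.load aDig (♯rK * ♯45 + ♯43) - .load aDig (♯rK * ♯45 + ♯32)) +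
      (.load aDig (♯rK * ♯45 + ♯32) - .load aDig (♯rK * ♯45 + ♯43)))
    (.assign 44 (♯44 + 1)) .skip) (s₀ := (Stmt.assign 44 0).eval s)
    (by rw [Expr.eval_var, hR.holds.k, hR.holds.B, min_eq_left h.holds.k_le])
    (fun m t => t.reg 44 = ∑ c ∈ Finset.range m, if w / 3 ^ c % 3 ≠ u / 3 ^ c % 3 then 1 else 0)
    (by simp) (by intro j t h; simpa using h) ?_
  · rw [key, Finset.sum_range, hammingDist, Finset.card_filter]
    refine Finset.sum_congr rfl fun c _ => ?_
    simp [sigOf]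
  · intro c hc t ht h45 hI
    have hRt := hR.frame ht (by decide) (by decide)
    have hft := hf0.trans ht
    have e1 : (Expr.load aDig (♯rK * ♯45 + ♯43)).eval t = w / 3 ^ c % 3 := by
      rw [← hRt.dig c hc w hwK]
      simp [hRt.holds.K, hRt.holds.B, h.holds.K_le, h45, hft.1 43 (by decide), hw]
    have e2 : (Expr.load aDig (♯rK * ♯45 + ♯32)).eval t = u / 3 ^ c % 3 := by
      rw [← hRt.dig c hc u huK]
      simp [hRt.holds.K, hRt.holds.B, h.holds.K_le, h45, hft.1 32 (by decide), hu]
    rw [Stmt.eval_ite, Expr.eval_add, Expr.eval_sub, Expr.eval_sub, e1, e2, Finset.sum_range_succ,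
      ← hI]
    by_cases hne : w / 3 ^ c % 3 = u / 3 ^ c % 3
    · simp [hne]
    · rw [if_pos (by omega), if_pos hne]
      simp

/-- The signatures for which a nonzero entry is stored are those that satisfy `R`. -/
def CurOK (P : Params) (R : Fin P.N → (Fin P.k → Fin 3) → Prop) (s : Config) : Prop :=
  ∀ (b : Fin P.N), ∀ v < P.K, s.mem aCur (P.K * (b : ℕ) + v) ≠ 0 ↔ R b (sigOf P.k v)

theorem searchFar_spec (h : Ready P g χ ρ inp s) {R : Fin P.N → (Fin P.k → Fin 3) → Prop}
    (hC : CurOK P R s) {a : Fin P.N} {u : ℕ} (ha : s.reg 31 = a) (hu : s.reg 32 = u)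
    (huK : u < P.K) :
    (searchFar.eval s).reg 46 ≠ 0 ↔ s.reg 46 ≠ 0 ∨
      ∃ w, R a w ∧ P.ℓ ≤ hammingDist w (sigOf P.k u) := by
  have key := eval_search (f := 46) (i := 43) (e := ♯rK)
    (p := .ite (.load aCur (♯rK * ♯31 + ♯43))
    (distCount ;; .ite (♯44 + 1 - ♯rℓ) (.assign 46 1) .skip) .skip) (s₀ := s)
    (by rw [Expr.eval_var, h.holds.K, h.holds.B, min_eq_left h.holds.K_le]) (by decide)
    (fun w => R a (sigOf P.k w) ∧ P.ℓ ≤ hammingDist (sigOf P.k w) (sigOf P.k u)) ?_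
  · rw [searchFar, key]
    refine or_congr_right ⟨?_, ?_⟩
    · rintro ⟨w, -, hw⟩; exact ⟨_, hw⟩
    · rintro ⟨w, hw⟩
      obtain ⟨w, h1, rfl⟩ := exists_sigOf w
      exact ⟨w, h1, hw⟩
  intro w hw t ht h43
  have hRt := h.frame ht (by decide) (by decide)
  have h32 : t.reg 32 = u := by rw [ht.1 32 (by decide), hu]
  have e1 : (Expr.load aCur (♯rK * ♯31 + ♯43)).eval t = s.mem aCur (P.K * a + w) := by
    simp [hRt.holds.K, hRt.holds.B, h.holds.K_le, h43, ht.1 31 (by decide), ha,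
      ht.2 aCur (by decide)]
  rw [Stmt.eval_ite, e1]
  by_cases hR : R a (sigOf P.k w)
  · rw [if_pos ((hC a w hw).2 hR)]
    have hd := distCount_spec hRt h32 h43 huK hw
    have hfd := distCount.frame t
    have hRd := hRt.frame hfd (by decide) (by decide)
    rw [Stmt.eval_seq, Stmt.eval_ite]
    have e2 : (♯44 + 1 - ♯rℓ : Expr).eval (distCount.eval t) =
        hammingDist (sigOf P.k w) (sigOf P.k u) + 1 - P.ℓ := by simp [hd, hRd.holds.ℓ]
    rw [e2]
    split_ifs with h1
    · have : P.ℓ ≤ hammingDist (sigOf P.k w) (sigOf P.k u) := by omega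
      simp [hR, this]
    · have : ¬ P.ℓ ≤ hammingDist (sigOf P.k w) (sigOf P.k u) := by omega
      simp [hfd.1 46 (by decide), this]
  · rw [if_neg (mt (hC a w hw).1 hR)]
    simp [hR]

/-- A stage of the program computes the reachable signatures of the next stage from the current ones,
and moves on to the code of the next graph. -/
theorem stage_spec (hF : FieldCode F g P.q) (h : Ready P g χ ρ inp s) {G : Graph P.n}
    (hG : GraphAt G inp (s.reg 30)) {R : Fin P.N → (Fin P.k → Fin 3) → Prop} (hC : CurOK P R s) :
    (stage.eval s).reg 30 = s.reg 30 + (1 + P.n + P.n * P.n) ∧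
    CurOK P (fun b v => ∃ a u, testValue (g ^ P.q) G ρ (χ a) (χ b) u v ≠ 0 ∧
      ∃ w, R a w ∧ P.ℓ ≤ hammingDist w u) (stage.eval s) := by
  rw [stage, Stmt.eval_seq, Stmt.eval_seq]
  have hN : min ((♯rN : Expr).eval s) (s.reg 1) = P.N := by
    rw [Expr.eval_var, h.holds.N, h.holds.B, min_eq_left h.holds.N_le]
  have key := Stmt.eval_fill₂ (i := 33) (j := 34) (e := ♯rN) (p := cell) (A := aNext) (r := rK)
    (s₀ := s) (M := P.K) hN (by simp [h.holds.K, h.holds.B, h.holds.K_le])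
    (by decide) (by decide) (by decide)
    (fun b v x => ∀ hb : b < P.N, x ≠ 0 ↔ ∃ a u,
      testValue (g ^ P.q) G ρ (χ a) (χ ⟨b, hb⟩) u (sigOf P.k v) ≠ 0 ∧
      ∃ w, R a w ∧ P.ℓ ≤ hammingDist w u) ?_
  · have hf1 := (Stmt.loop 33 ♯rN (.loop 34 ♯rK cell)).frame s
    set s1 := (Stmt.loop 33 ♯rN (.loop 34 ♯rK cell)).eval s
    have hR1 := h.frame hf1 (by decide) (by decide)
    have hcopy := Stmt.eval_fill₂ (i := 33) (j := 34) (e := ♯rN) (p :=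
      .store aCur (♯rK * ♯33 + ♯34) (.load aNext (♯rK * ♯33 + ♯34))) (A := aCur) (r := rK)
      (s₀ := s1) (P := P.N) (M := P.K)
      (by rw [Expr.eval_var, hR1.holds.N, hR1.holds.B, min_eq_left h.holds.N_le])
      (by simp [hR1.holds.K, hR1.holds.B, h.holds.K_le])
      (by decide) (by decide) (by decide) (fun b v x => x = s1.mem aNext (P.K * b + v)) (by
        intro b hb v hv t ht h33 h34 _
        have hRt := hR1.frame ht (by decide) (by decide)
        refine ⟨_, rfl, ?_⟩
        simp [hRt.holds.K, hRt.holds.B, h.holds.K_le, h33, h34, ht.2 aNext (by decide)])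
    have hf2 := (Stmt.loop 33 ♯rN (.loop 34 ♯rK
      (.store aCur (♯rK * ♯33 + ♯34) (.load aNext (♯rK * ♯33 + ♯34))))).frame s1
    set s2 := Stmt.eval _ s1
    have hR2 := hR1.frame hf2 (by decide) (by decide)
    refine ⟨?_, ?_⟩
    · simp [hR2.holds.n, hR2.holds.B, h.holds.n_le, hf2.1 30 (by decide), hf1.1 30 (by decide)]
    · intro b v hv
      rw [Stmt.eval_assign, Config.setReg_mem, hcopy b b.2 v hv]
      exact key b b.2 v hv b.2
  intro b hb v hv t ht h33 h34 _
  have hRt := h.frame ht (by decide) (by decide)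
  rw [cell, Stmt.eval_seq, Stmt.eval_seq]
  have hf1 := (Stmt.assign 46 0).frame t
  have h46 : ((Stmt.assign 46 0).eval t).reg 46 = 0 := by simp
  set t1 := (Stmt.assign 46 0).eval t
  have hR1 := hRt.frame hf1 (by decide) (by decide)
  have hsearch := eval_search (f := 46) (i := 31) (e := ♯rN) (p := .loop 32 ♯rK
    (test ;; .ite ♯42 searchFar .skip)) (s₀ := t1) (n := P.N)
    (by rw [Expr.eval_var, hR1.holds.N, hR1.holds.B, min_eq_left h.holds.N_le]) (by decide)
    (fun a => ∃ u < P.K, ∃ ha : a < P.N,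
      testValue (g ^ P.q) G ρ (χ ⟨a, ha⟩) (χ ⟨b, hb⟩) (sigOf P.k u) (sigOf P.k v) ≠ 0 ∧
      ∃ w, R ⟨a, ha⟩ w ∧ P.ℓ ≤ hammingDist w (sigOf P.k u)) ?_
  · have hf2 := (Stmt.loop 31 ♯rN (.loop 32 ♯rK (test ;; .ite ♯42 searchFar .skip))).frame t1
    set t2 := (Stmt.loop 31 ♯rN (.loop 32 ♯rK (test ;; .ite ♯42 searchFar .skip))).eval t1
    have hf12 := hf1.trans hf2
    have hR2 := hR1.frame hf2 (by decide) (by decide)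
    refine ⟨t2.reg 46, fun _ => ?_, ?_⟩
    · rw [hsearch, h46]
      simp only [ne_eq, not_true_eq_false, false_or]
      constructor
      · rintro ⟨a, -, u, -, ha, h⟩; exact ⟨_, _, h⟩
      · rintro ⟨a, u, h⟩
        obtain ⟨u, hu, rfl⟩ := exists_sigOf u
        exact ⟨a, a.2, u, hu, a.2, h⟩
    · simp [hR2.holds.K, hR2.holds.B, h.holds.K_le, hf12.1 33 (by decide), hf12.1 34 (by decide),
        h33, h34, hf12.2 aNext (by decide)]
  intro a ha t' ht' h31
  have hR' := hR1.frame ht' (by decide) (by decide)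
  refine eval_search (f := 46) (by rw [Expr.eval_var, hR'.holds.K, hR'.holds.B,
    min_eq_left h.holds.K_le]) (by decide) _ ?_
  intro u hu t₂ ht₂ h32
  have hfr := ((ht.trans hf1).trans ht').trans ht₂
  have hR₂ := hR'.frame ht₂ (by decide) (by decide)
  have h31' : t₂.reg 31 = a := by rw [ht₂.1 31 (by decide), h31]
  have htest := test_spec hF hR₂ (G := G) (a := ⟨a, ha⟩) (b := ⟨b, hb⟩) (u := u) (v := v)
    (by rw [hfr.1 30 (by decide)]; exact hG) h31' h32
    (by rw [((hf1.trans ht').trans ht₂).1 33 (by decide), h33])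
    (by rw [((hf1.trans ht').trans ht₂).1 34 (by decide), h34]) hu hv
  have hft := test.frame t₂
  rw [Stmt.eval_seq, Stmt.eval_ite]
  have hR₃ := hR₂.frame hft (by decide) (by decide)
  have e46 : (test.eval t₂).reg 46 = t₂.reg 46 := hft.1 46 (by decide)
  rw [Expr.eval_var]
  by_cases h0 : testValue (g ^ P.q) G ρ (χ ⟨a, ha⟩) (χ ⟨b, hb⟩) (sigOf P.k u) (sigOf P.k v) = 0
  · rw [if_neg (not_not.2 ((hF.code_eq_zero htest).2 h0)), Stmt.eval_skip, e46]
    simp [h0]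
  · rw [if_pos (mt (hF.code_eq_zero htest).1 h0)]
    have hcur : (test.eval t₂).mem aCur = s.mem aCur := by
      rw [hft.2 aCur (by decide), hfr.2 aCur (by decide)]
    rw [searchFar_spec hR₃ (R := R) (a := ⟨a, ha⟩) (u := u)
      (by intro b v hv; rw [hcur]; exact hC b v hv)
      (by rw [hft.1 31 (by decide), h31']) (by rw [hft.1 32 (by decide), h32]) hu, e46]
    simp [h0, ha]

open Classical in
/-- The machine carries out the dynamic program, for graphs whose codes follow one another in the
input from position `2` on. -/
theorem dynamicProgram_spec (hF : FieldCode F g P.q) (h : Ready P g χ ρ inp s) {G : ℕ → Graph P.n}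
    (hG : ∀ i < P.τ, GraphAt (G i) inp (2 + i * (1 + P.n + P.n * P.n))) :
    (dynamicProgram.eval s).reg 0 =
      if ∃ b v, Reachable (g ^ P.q) G P.ℓ ρ χ P.τ b v then 1 else 0 := by
  rw [dynamicProgram, Stmt.eval_seq, Stmt.eval_seq, Stmt.eval_seq, Stmt.eval_seq, Stmt.eval_seq]
  have hN : min ((♯rN : Expr).eval s) (s.reg 1) = P.N := by
    rw [Expr.eval_var, h.holds.N, h.holds.B, min_eq_left h.holds.N_le]
  have hinit := Stmt.eval_fill₂ (i := 33) (j := 34) (e := ♯rN) (p :=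
      .store aCur (♯rK * ♯33 + ♯34) 1) (A := aCur) (r := rK)
      (s₀ := s) (P := P.N) (M := P.K) hN (by simp [h.holds.K, h.holds.B, h.holds.K_le])
      (by decide) (by decide) (by decide) (fun b v x => x ≠ 0) (by
        intro b hb v hv t ht h33 h34 _
        have hRt := h.frame ht (by decide) (by decide)
        refine ⟨1, one_ne_zero, ?_⟩
        simp [hRt.holds.K, hRt.holds.B, h.holds.K_le, h33, h34])
  have hf1 := (Stmt.loop 33 ♯rN (.loop 34 ♯rK (.store aCur (♯rK * ♯33 + ♯34) 1))).frame s
  set s1 := (Stmt.loop 33 ♯rN (.loop 34 ♯rK (.store aCur (♯rK * ♯33 + ♯34) 1))).eval s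
  have hR1 := h.frame hf1 (by decide) (by decide)
  have hf2 := (Stmt.assign 30 2).frame s1
  have h30 : ((Stmt.assign 30 2).eval s1).reg 30 = 2 := by simp
  have hC2 : CurOK P (Reachable (g ^ P.q) G P.ℓ ρ χ 0) ((Stmt.assign 30 2).eval s1) :=
    fun b v hv => iff_of_true (hinit b b.2 v hv) trivial
  set s2 := (Stmt.assign 30 2).eval s1
  have hR2 := hR1.frame hf2 (by decide) (by decide)
  have hloop := Stmt.eval_loop (i := 47) (e := ♯rτ) (p := stage) (s₀ := s2) (n := P.τ)
    (by rw [Expr.eval_var, hR2.holds.τ, hR2.holds.B, min_eq_left h.holds.τ_le])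
    (fun m t => t.reg 30 = 2 + m * (1 + P.n + P.n * P.n) ∧
      CurOK P (Reachable (g ^ P.q) G P.ℓ ρ χ m) t) ⟨by simp [h30], hC2⟩
    (by intro j t h; exact ⟨by simpa using h.1, h.2⟩) (by
      rintro i hi t ht - ⟨hI1, hI2⟩
      have hRt := hR2.frame ht (by decide) (by decide)
      obtain ⟨h1, h2⟩ := stage_spec hF hRt (by rw [hI1]; exact hG i hi) hI2
      refine ⟨by rw [h1, hI1]; ring, h2⟩)
  have hf3 := (Stmt.loop 47 ♯rτ stage).frame s2
  set s3 := (Stmt.loop 47 ♯rτ stage).eval s2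
  have hR3 := hR2.frame hf3 (by decide) (by decide)
  have hf4 := (Stmt.assign 46 0).frame s3
  have h46 : ((Stmt.assign 46 0).eval s3).reg 46 = 0 := by simp
  set s4 := (Stmt.assign 46 0).eval s3
  have hR4 := hR3.frame hf4 (by decide) (by decide)
  have hsearch := eval_search (f := 46) (i := 33) (e := ♯rN) (p := .loop 34 ♯rK
    (.ite (.load aCur (♯rK * ♯33 + ♯34)) (.assign 46 1) .skip)) (s₀ := s4) (n := P.N)
    (by rw [Expr.eval_var, hR4.holds.N, hR4.holds.B, min_eq_left h.holds.N_le]) (by decide)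
    (fun b => ∃ v < P.K, ∃ hb : b < P.N, Reachable (g ^ P.q) G P.ℓ ρ χ P.τ ⟨b, hb⟩ (sigOf P.k v)) (by
      intro b hb t ht h33
      have hRt := hR4.frame ht (by decide) (by decide)
      refine eval_search (f := 46) (by rw [Expr.eval_var, hRt.holds.K, hRt.holds.B,
        min_eq_left h.holds.K_le]) (by decide) _ ?_
      intro v hv t' ht' h34
      have hRt' := hRt.frame ht' (by decide) (by decide)
      have e1 : (Expr.load aCur (♯rK * ♯33 + ♯34)).eval t' = s3.mem aCur (P.K * b + v) := by
        simp [hRt'.holds.K, hRt'.holds.B, h.holds.K_le, h34, ht'.1 33 (by decide), h33,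
          ((hf4.trans ht).trans ht').2 aCur (by decide)]
      have hcur := hloop.2 ⟨b, hb⟩ v hv
      rw [Stmt.eval_ite, e1]
      split_ifs with h1
      · simp [hcur.1 h1, hb]
      · simp [mt hcur.2 h1])
  rw [h46] at hsearch
  simp only [ne_eq, not_true_eq_false, false_or] at hsearch
  have hiff : (∃ j < P.N, ∃ v < P.K, ∃ hb : j < P.N,
      Reachable (g ^ P.q) G P.ℓ ρ χ P.τ ⟨j, hb⟩ (sigOf P.k v)) ↔
      ∃ b v, Reachable (g ^ P.q) G P.ℓ ρ χ P.τ b v := by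
    constructor
    · rintro ⟨b, -, v, -, hb, h⟩; exact ⟨_, _, h⟩
    · rintro ⟨b, v, h⟩
      obtain ⟨v, hv, rfl⟩ := exists_sigOf v
      exact ⟨b, b.2, v, hv, b.2, h⟩
  rw [hiff] at hsearch
  rw [Stmt.eval_ite, Expr.eval_var]
  by_cases hex : ∃ b v, Reachable (g ^ P.q) G P.ℓ ρ χ P.τ b v
  · rw [if_pos (hsearch.2 hex), if_pos hex]; simp
  · rw [if_neg (mt hsearch.1 hex), if_neg hex]; simp

end Ready

/-! ### The whole computation once the parameters are known -/

/-- Code that fills the tables. -/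
def tables : Stmt :=
  divTable 2 aHalf aPar rQ ;; addTable ;; mulTable ;; invTable ;; powTable ;; digTable ;; pairTable

/-- Code for the algorithm, given its parameters. -/
def mainPhase : Stmt :=
  tables ;; drawArray aCol (♯rn * ♯rn * ♯rN) rb ;; drawArray aRho (♯rn * ♯rn) rm ;; dynamicProgram

section Ready
variable {F : Type} [Field F] {g : F} {P : Params} {inp : ℕ → ℕ} {s s' : Config}

/-- The colourings given by random numbers. -/
def coloursOf {n k N b : ℕ} (hk : k = 2 ^ b) (d : Fin (N * (n * n)) → Fin (2 ^ b)) :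
    Fin N → Fin n × Fin n → Fin k :=
  fun a e => Fin.cast hk.symm (d (finProdFinEquiv (a, finProdFinEquiv e)))

/-- The field elements given by random numbers. -/
def weightsOf (g : F) {n m : ℕ} (d : Fin (n * n) → Fin (2 ^ m)) (i : Fin (n * n)) : F :=
  binVal g (d i)

theorem tables_spec (hF : FieldCode F g P.q) (hP : P.Holds s) :
    P.Holds (tables.eval s) ∧ AddOK P g (tables.eval s) ∧ MulOK P g (tables.eval s) ∧
    InvOK P g (tables.eval s) ∧ PowOK P g (tables.eval s) ∧ DigOK P (tables.eval s) ∧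
    PairOK P g (tables.eval s) ∧ (tables.eval s).mem aIn = s.mem aIn := by
  simp only [tables, Stmt.eval_seq]
  have hH : HalfOK P ((divTable 2 aHalf aPar rQ).eval s) := by
    have := divTable_spec (d := 2) (Aq := aHalf) (Ar := aPar) (r := rQ) (by norm_num)
      (by norm_num) (by norm_num) s (by rw [hP.Q, hP.B]; exact hP.Q_le)
    rwa [hP.Q] at this
  have hf1 := (divTable 2 aHalf aPar rQ).frame s
  set s1 := (divTable 2 aHalf aPar rQ).eval s
  have hP1 := hP.frame hf1 (by decide)
  have hA := addTable_spec hF s1 hP1 hH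
  have hf2 := addTable.frame s1
  set s2 := addTable.eval s1
  have hP2 := hP1.frame hf2 (by decide)
  have hH2 : HalfOK P s2 := by
    intro a ha; rw [hf2.2 aHalf (by decide), hf2.2 aPar (by decide)]; exact hH a ha
  have hM := mulTable_spec hF s2 hP2 hH2 hA
  have hf3 := mulTable.frame s2
  set s3 := mulTable.eval s2
  have hP3 := hP2.frame hf3 (by decide)
  have hI := invTable_spec hF s3 hP3 hM
  have hf4 := invTable.frame s3
  set s4 := invTable.eval s3
  have hP4 := hP3.frame hf4 (by decide)
  have hW := powTable_spec hF s4 hP4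
  have hf5 := powTable.frame s4
  set s5 := powTable.eval s4
  have hP5 := hP4.frame hf5 (by decide)
  have hD := digTable_spec s5 hP5
  have hf6 := digTable.frame s5
  set s6 := digTable.eval s5
  have hP6 := hP5.frame hf6 (by decide)
  have hM6 : MulOK P g s6 := by
    intro a ha b hb; rw [((hf4.trans hf5).trans hf6).2 aMul (by decide)]; exact hM a ha b hb
  have hW6 : PowOK P g s6 := by
    intro a b; rw [hf6.2 aPow (by decide)]; exact hW a b
  have hpair := pairTable_spec hF s6 hP6 hM6 hW6 hD
  have hf7 := pairTable.frame s6
  set s7 := pairTable.eval s6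
  have hf37 := (((hf3.trans hf4).trans hf5).trans hf6).trans hf7
  refine ⟨hP6.frame hf7 (by decide), ?_, ?_, ?_, ?_, ?_, hpair, ?_⟩
  · intro a ha b hb; rw [hf37.2 aAdd (by decide)]; exact hA a ha b hb
  · intro a ha b hb; rw [hf7.2 aMul (by decide)]; exact hM6 a ha b hb
  · intro a ha; rw [((hf5.trans hf6).trans hf7).2 aInv (by decide)]; exact hI a ha
  · intro a b; rw [hf7.2 aPow (by decide)]; exact hW6 a b
  · intro a ha b hb; rw [hf7.2 aDig (by decide)]; exact hD a ha b hb
  · rw [((hf1.trans hf2).trans hf37).2 aIn (by decide)]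

open Classical in
/-- The answer of the machine is that of the dynamic program for the colourings and weights that are
drawn with the coin tosses. -/
theorem mainPhase_spec (hF : FieldCode F g P.q) (hP : P.Holds s) (hin : s.mem aIn = inp)
    (hk : P.k = 2 ^ P.b) {G : ℕ → Graph P.n}
    (hG : ∀ i < P.τ, GraphAt (G i) inp (2 + i * (1 + P.n + P.n * P.n))) :
    (mainPhase.eval s).reg 0 = if ∃ b v, Reachable (g ^ P.q) G P.ℓ
      (fun e => weightsOf g (draw (P.N * (P.n * P.n)) P.b (P.n * P.n) (2 * P.q) s.coins).2
        (finProdFinEquiv e))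
      (coloursOf hk (draw (P.N * (P.n * P.n)) P.b (P.n * P.n) (2 * P.q) s.coins).1)
      P.τ b v then 1 else 0 := by
  rw [mainPhase, Stmt.eval_seq, Stmt.eval_seq, Stmt.eval_seq]
  obtain ⟨hP1, hA, hM, hI, hW, hD, hpair, hin1⟩ := tables_spec hF hP
  have hc1 : (tables.eval s).coins = s.coins := Stmt.eval_coins _ (by decide) _
  set s1 := tables.eval s
  obtain ⟨hc2, hcol⟩ := drawArray_spec (A := aCol) (e := ♯rn * ♯rn * ♯rN) (r := rb) s1
    (L := P.n * P.n * P.N) (by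
      simp [hP1.n, hP1.N, hP1.B, hP.n_le, hP.nn_le, hP.Nnn_le])
    (by rw [hP1.b, hP1.B]; exact hP.b_le) (by norm_num)
  have hf2 := (drawArray aCol (♯rn * ♯rn * ♯rN) rb).frame s1
  set s2 := (drawArray aCol (♯rn * ♯rn * ♯rN) rb).eval s1
  have hP2 := hP1.frame hf2 (by decide)
  obtain ⟨hc3, hrho⟩ := drawArray_spec (A := aRho) (e := ♯rn * ♯rn) (r := rm) s2
    (L := P.n * P.n) (by simp [hP2.n, hP2.B, hP.n_le, hP.nn_le])
    (by rw [hP2.m, hP2.B]; exact hP.m_le) (by norm_num)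
  have hf3 := (drawArray aRho (♯rn * ♯rn) rm).frame s2
  set s3 := (drawArray aRho (♯rn * ♯rn) rm).eval s2
  have hf23 := hf2.trans hf3
  rw [hP1.b, hc1] at hcol hc2
  rw [hP2.m, hc2] at hrho
  have hidx : ∀ x y : Fin P.n, ((finProdFinEquiv (x, y) : Fin (P.n * P.n)) : ℕ) =
      P.n * x + y := fun x y => by simp [finProdFinEquiv, add_comm]
  refine dynamicProgram_spec hF (inp := inp) ⟨hP2.frame hf3 (by decide), ?_, ?_, ?_, ?_, ?_, ?_,
    ⟨?_, ?_, ?_⟩, ?_⟩ hG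
  · intro a ha b hb; rw [hf23.2 aAdd (by decide)]; exact hA a ha b hb
  · intro a ha b hb; rw [hf23.2 aMul (by decide)]; exact hM a ha b hb
  · intro a ha; rw [hf23.2 aInv (by decide)]; exact hI a ha
  · intro a b; rw [hf23.2 aPow (by decide)]; exact hW a b
  · intro a ha b hb; rw [hf23.2 aDig (by decide)]; exact hD a ha b hb
  · intro a ha b hb; rw [hf23.2 aPair (by decide)]; exact hpair a ha b hb
  · intro a x y
    have hlt : P.n * P.n * (a : ℕ) + (P.n * (x : ℕ) + (y : ℕ)) < P.n * P.n * P.N :=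
      mul_add_lt a.2 (mul_add_lt x.2 y.2)
    rw [hf3.2 aCol (by decide), hcol _ hlt]
    have : ((finProdFinEquiv (a, (finProdFinEquiv (x, y) : Fin (P.n * P.n)))
        : Fin (P.N * (P.n * P.n))) : ℕ) = P.n * P.n * a + (P.n * x + y) := by
      simp [finProdFinEquiv]; ring
    simp only [coloursOf, draw, Fin.val_cast, this]
  · intro x y
    rw [hrho _ (mul_add_lt x.2 y.2)]
    exact bitsNum_lt _ _
  · intro x y
    rw [hrho _ (mul_add_lt x.2 y.2)]
    simp only [weightsOf, draw, hidx]
    rw [mul_comm P.N]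
  · rw [hf23.2 aIn (by decide), hin1, hin]

end Ready

/-! ### Computing the parameters -/

/-- The program that runs the statements one after the other, each with the bound on its loops that
the preceding ones have left in register `99`. -/
def phases : List Stmt → Program
  | [] => .skip
  | p :: ps => .seq (.copy 1 99) (.seq (p.compile 0) (phases ps))

/-- The effect of `phases`. -/
def evalPhases : List Stmt → Config → Config
  | [], s => s
  | p :: ps, s => evalPhases ps (p.eval (s.setReg 1 (s.reg 99)))

/-- All bounds on loops that `phases` uses are at most `M`. -/
def Bounded (M : ℕ) : List Stmt → Config → Prop
  | [], _ => True
  | p :: ps, s => s.reg 99 ≤ M ∧ Bounded M ps (p.eval (s.setReg 1 (s.reg 99)))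

/-- The program for the statements runs in polynomial time in the bounds on the loops. -/
theorem phases_spec (ps : List Stmt) (hps : ∀ p ∈ ps, p.WF) : ∃ C d : ℕ, ∀ (M : ℕ) (s σ : Config),
    Sim s σ → Bounded M ps σ → ∃ t ≤ C * (M + 1) ^ d, ∃ s', Runs (phases ps) s t s' ∧
      Sim s' (evalPhases ps σ) := by
  induction ps with
  | nil => exact ⟨1, 0, fun M s σ h _ => ⟨1, by simp, s, .skip s, h⟩⟩
  | cons p ps ih =>
    obtain ⟨C, d, hC⟩ := ih fun p hp => hps p (List.mem_cons_of_mem _ hp)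
    obtain ⟨C', d', hC'⟩ := p.cost_poly
    have hp := hps p List.mem_cons_self
    refine ⟨1 + (C' + C), d' + d, fun M s σ h ⟨hM, hB⟩ => ?_⟩
    have h1 : Sim (s.setReg 1 (s.reg 99)) (σ.setReg 1 (σ.reg 99)) := by
      rw [h.2.2 99 (by norm_num)]; exact h.setReg _ _
    obtain ⟨t, ht, s1, hr1, hs1, -⟩ := p.compile_spec hp 0 _ _ h1
    obtain ⟨u, hu, s2, hr2, hs2⟩ := hC M s1 _ hs1 hB
    refine ⟨_, ?_, s2, (Runs.copy 1 99 s).seq (hr1.seq hr2), hs2⟩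
    have e1 : (M + 1) ^ d' ≤ (M + 1) ^ (d' + d) := Nat.pow_le_pow_right (by omega) (by omega)
    have e2 : (M + 1) ^ d ≤ (M + 1) ^ (d' + d) := Nat.pow_le_pow_right (by omega) (by omega)
    have e3 : 1 ≤ (M + 1) ^ (d' + d) := Nat.one_le_pow _ _ (by omega)
    have ht' : t ≤ C' * (M + 1) ^ d' := by
      refine ht.trans ((hC' _).trans (Nat.mul_le_mul_left _ (Nat.pow_le_pow_left ?_ _)))
      simpa using hM
    calc 1 + (t + u) ≤ (M + 1) ^ (d' + d) + (C' * (M + 1) ^ (d' + d) + C * (M + 1) ^ (d' + d)) :=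
          Nat.add_le_add e3 (Nat.add_le_add (ht'.trans (Nat.mul_le_mul_left _ e1))
            (hu.trans (Nat.mul_le_mul_left _ e2)))
      _ = (1 + (C' + C)) * (M + 1) ^ (d' + d) := by ring

/-- Code that multiplies register `r` by `m ^ e`.  The constant `m` is the first factor, the one that
is cut off. -/
def powLoop (r m : ℕ) (e : Expr) : Stmt := .loop 13 e (.assign r (.lit m * ♯r))

theorem powLoop_spec {r m n : ℕ} {e : Expr} (s : Config) (hn : min (e.eval s) (s.reg 1) = n)
    (hm : m ≤ s.reg 1) (hr : r ≠ 13) (hr1 : r ≠ 1) :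
    ((powLoop r m e).eval s).reg r = m ^ n * s.reg r := by
  refine Stmt.eval_loop hn (fun j t => t.reg r = m ^ j * s.reg r) (by simp)
    (by intro j t h; simpa [hr] using h) ?_
  intro j hj t ht _ hI
  have h1 : t.reg 1 = s.reg 1 := ht.1 1 (by simp [Stmt.regs, hr1.symm])
  simp [h1, hm, hI, pow_succ]
  ring

/-- Code that reads `ℓ`, `τ` and `n`.  Register `1` still holds `0`, so that no multiplication is
possible yet. -/
def readPhase (c : ℕ) : Stmt :=
  .assign rℓ (.load aIn 0) ;; .assign rτ (.load aIn 1) ;; .assign rn (.load aIn 2) ;;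
  .assign 99 (♯rℓ + ♯rℓ + ♯rℓ + ♯rℓ + ♯rℓ + ♯rℓ + ♯rτ + ♯rn + .lit (c + 20))

/-- Code for the least power of two that is at least `3 ℓ`. -/
def colourLoop : Stmt :=
  .assign rk 1 ;; .assign rb 0 ;;
  .loop 13 (3 * ♯rℓ) (.ite (3 * ♯rℓ - ♯rk) (.assign rk (2 * ♯rk) ;; .assign rb (♯rb + 1)) .skip)

/-- Code for the numbers of colours, of signatures and of colourings, and for the lower bound
`c (n + 1) (τ + 1)` on the size of the field, in register `12`. -/
def colourPhase (c : ℕ) : Stmt :=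
  colourLoop ;; .assign rK 1 ;; powLoop rK 3 ♯rk ;;
  .assign rN (.lit c * (♯rτ + 1)) ;; powLoop rN 18 ♯rℓ ;;
  .assign 12 (.lit c * ((♯rn + 1) * (♯rτ + 1))) ;;
  .assign 99 (.lit c * ((♯rn + 1) * ((♯rτ + 1) * ♯12)) + 4)

/-- Code for the least size of a field of order `2 ^ (2 * 3 ^ j)` that is at least the content of
register `12`.  Register `rm` holds `3 ^ j` and `rW` holds `2 ^ 3 ^ j`, which is cubed when `j`
grows; as this happens only while its square is too small, the size stays polynomial. -/
def fieldLoop : Stmt :=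
  .assign rW 2 ;; .assign rm 1 ;;
  .loop 13 ♯12 (.ite (♯12 - ♯rW * ♯rW) (.assign rW (♯rW * (♯rW * ♯rW)) ;; .assign rm (3 * ♯rm)) .skip)

/-- Code for the size of the field and for the bound on the loops of the algorithm. -/
def fieldPhase : Stmt :=
  fieldLoop ;; .assign rQ (♯rW * ♯rW) ;; .assign rm (2 * ♯rm) ;;
  .assign 99 (♯rτ + ♯rn + ♯rk + ♯rb + ♯rK + ♯rN + ♯rm + ♯rQ + ♯rn * ♯rn + ♯rn * (♯rn * ♯rN) + 8)

theorem colourLoop_spec (s : Config) {ℓ : ℕ} (hℓ : s.reg rℓ = ℓ) (hB : 6 * ℓ + 20 ≤ s.reg 1) :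
    ∃ b, (colourLoop.eval s).reg rb = b ∧ (colourLoop.eval s).reg rk = 2 ^ b ∧
      3 * ℓ ≤ 2 ^ b ∧ (ℓ ≠ 0 → 2 ^ b ≤ 6 * ℓ) ∧ 2 ^ b ≤ 6 * ℓ + 1 := by
  rw [colourLoop, Stmt.eval_seq, Stmt.eval_seq]
  set s1 := (Stmt.assign rb 0).eval ((Stmt.assign rk 1).eval s) with hs1
  have h1 : s1.reg 1 = s.reg 1 := by simp [hs1]
  have h2 : s1.reg rℓ = ℓ := by simp [hs1, hℓ]
  have key := Stmt.eval_loop (i := 13) (e := 3 * ♯rℓ) (p := .ite (3 * ♯rℓ - ♯rk)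
    (.assign rk (2 * ♯rk) ;; .assign rb (♯rb + 1)) .skip) (s₀ := s1) (n := 3 * ℓ)
    (by simp [h1, h2, show min 3 (s.reg 1) = 3 by omega]; omega)
    (fun j t => ∃ b, t.reg rb = b ∧ t.reg rk = 2 ^ b ∧ (j ≤ b ∨ 3 * ℓ ≤ 2 ^ b) ∧
      (ℓ ≠ 0 → 2 ^ b ≤ 6 * ℓ) ∧ 2 ^ b ≤ 6 * ℓ + 1)
    ⟨0, by simp [hs1], by simp [hs1], by simp, by intro h; simp; omega, by simp⟩
    (by intro j t h; simpa using h) ?_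
  · obtain ⟨b, hb, hk, hor, h6, h7⟩ := key
    refine ⟨b, hb, hk, ?_, h6, h7⟩
    have := Nat.lt_two_pow_self (n := b)
    omega
  · rintro j hj t ht - ⟨b, hb, hk, hor, h6, h7⟩
    have e1 : t.reg 1 = s.reg 1 := by rw [ht.1 1 (by decide), h1]
    have e2 : t.reg rℓ = ℓ := by rw [ht.1 rℓ (by decide), h2]
    have m3 : min 3 (s.reg 1) = 3 := by omega
    have m2 : min 2 (s.reg 1) = 2 := by omega
    have e3 : (3 * ♯rℓ - ♯rk : Expr).eval t = 3 * ℓ - 2 ^ b := by simp [e1, e2, hk, m3]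
    rw [Stmt.eval_ite, e3]
    split_ifs with h
    · have h2b : 2 ^ (b + 1) = 2 * 2 ^ b := by ring
      refine ⟨b + 1, by simp [hb], by simp [hk, e1, m2, h2b], ?_, ?_, ?_⟩ <;> omega
    · exact ⟨b, hb, hk, Or.inr (by omega), h6, h7⟩

theorem colourPhase_spec (s : Config) {c ℓ τ n : ℕ} (hℓ : s.reg rℓ = ℓ) (hτ : s.reg rτ = τ)
    (hn : s.reg rn = n) (hB : 6 * ℓ + τ + n + (c + 20) ≤ s.reg 1) :
    ∃ b, 3 * ℓ ≤ 2 ^ b ∧ (ℓ ≠ 0 → 2 ^ b ≤ 6 * ℓ) ∧ 2 ^ b ≤ 6 * ℓ + 1 ∧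
      ((colourPhase c).eval s).reg rb = b ∧ ((colourPhase c).eval s).reg rk = 2 ^ b ∧
      ((colourPhase c).eval s).reg rK = 3 ^ 2 ^ b ∧
      ((colourPhase c).eval s).reg rN = c * (τ + 1) * 18 ^ ℓ ∧
      ((colourPhase c).eval s).reg 12 = c * (n + 1) * (τ + 1) ∧
      ((colourPhase c).eval s).reg 99 = (c * (n + 1) * (τ + 1)) * (c * (n + 1) * (τ + 1)) + 4 := by
  obtain ⟨b, hb, hk, h3, h6, h7⟩ := colourLoop_spec s hℓ (by omega)
  refine ⟨b, h3, h6, h7, ?_⟩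
  simp only [colourPhase, Stmt.eval_seq]
  have hf1 := colourLoop.frame s
  set s1 := colourLoop.eval s
  have hf2 := (Stmt.assign rK 1).frame s1
  have hK2 : ((Stmt.assign rK 1).eval s1).reg rK = 1 := by simp
  set s2 := (Stmt.assign rK 1).eval s1
  have hf12 := hf1.trans hf2
  have hK3 := powLoop_spec (r := rK) (m := 3) (e := ♯rk) s2 (n := 2 ^ b)
    (by rw [Expr.eval_var, hf2.1 rk (by decide), hk, hf12.1 1 (by decide)]; omega)
    (by rw [hf12.1 1 (by decide)]; omega) (by norm_num) (by norm_num)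
  have hf3 := (powLoop rK 3 ♯rk).frame s2
  set s3 := (powLoop rK 3 ♯rk).eval s2
  have hf13 := hf12.trans hf3
  have hf4 : Frame [rN] [] s3 ((Stmt.assign rN (.lit c * (♯rτ + 1))).eval s3) :=
    Stmt.frame (.assign rN (Expr.lit c * (♯rτ + 1))) s3
  have hN4 : ((Stmt.assign rN (.lit c * (♯rτ + 1))).eval s3).reg rN = c * (τ + 1) := by
    have : min c (s.reg 1) = c := by omega
    simp [hf13.1 1 (by decide), hf13.1 rτ (by decide), hτ, this]
  set s4 := (Stmt.assign rN (.lit c * (♯rτ + 1))).eval s3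
  have hf14 := hf13.trans hf4
  have hN5 := powLoop_spec (r := rN) (m := 18) (e := ♯rℓ) s4 (n := ℓ)
    (by rw [Expr.eval_var, hf14.1 rℓ (by decide), hℓ, hf14.1 1 (by decide)]; omega)
    (by rw [hf14.1 1 (by decide)]; omega) (by norm_num) (by norm_num)
  have hf5 := (powLoop rN 18 ♯rℓ).frame s4
  set s5 := (powLoop rN 18 ♯rℓ).eval s4
  have hf15 := hf14.trans hf5
  have h1 : s5.reg 1 = s.reg 1 := hf15.1 1 (by decide)
  have hn5 : s5.reg rn = n := by rw [hf15.1 rn (by decide), hn]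
  have hτ5 : s5.reg rτ = τ := by rw [hf15.1 rτ (by decide), hτ]
  have m1 : min c (s.reg 1) = c := by omega
  have m2 : min (n + 1) (s.reg 1) = n + 1 := by omega
  have m3 : min (τ + 1) (s.reg 1) = τ + 1 := by omega
  have hf25 := (((hf2.trans hf3).trans hf4).trans hf5)
  refine ⟨?_, ?_, ?_, ?_, ?_, ?_⟩
  · simp [hf25.1 rb (by decide), hb]
  · simp [hf25.1 rk (by decide), hk]
  · simp [(hf4.trans hf5).1 rK (by decide), hK3, hK2]
  · simp [hN5, hN4, mul_comm]
  · simp [h1, hn5, hτ5, m1, m2, mul_assoc]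
  · simp [h1, hn5, hτ5, m1, m2, m3]
    ring

theorem fieldLoop_spec (s : Config) {X : ℕ} (hX : s.reg 12 = X) (hB : X * X + 4 ≤ s.reg 1) :
    ∃ j, (fieldLoop.eval s).reg rm = 3 ^ j ∧ (fieldLoop.eval s).reg rW = 2 ^ 3 ^ j ∧
      X ≤ 2 ^ 3 ^ j * 2 ^ 3 ^ j ∧ 2 ^ 3 ^ j ≤ X * X + 2 := by
  rw [fieldLoop, Stmt.eval_seq, Stmt.eval_seq]
  set s1 := (Stmt.assign rm 1).eval ((Stmt.assign rW 2).eval s) with hs1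
  have h1 : s1.reg 1 = s.reg 1 := by simp [hs1]
  have h2 : s1.reg 12 = X := by simp [hs1, hX]
  have hXX : X ≤ X * X := Nat.le_mul_self X
  have key := Stmt.eval_loop (i := 13) (e := ♯12) (p := .ite (♯12 - ♯rW * ♯rW)
    (.assign rW (♯rW * (♯rW * ♯rW)) ;; .assign rm (3 * ♯rm)) .skip) (s₀ := s1) (n := X)
    (by rw [Expr.eval_var, h1, h2]; omega)
    (fun i t => ∃ j, t.reg rm = 3 ^ j ∧ t.reg rW = 2 ^ 3 ^ j ∧
      (i ≤ j ∨ X ≤ 2 ^ 3 ^ j * 2 ^ 3 ^ j) ∧ 2 ^ 3 ^ j ≤ X * X + 2)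
    ⟨0, by simp [hs1], by simp [hs1], by simp, by simp⟩
    (by intro j t h; simpa using h) ?_
  · obtain ⟨j, hq, hw, hor, h4⟩ := key
    refine ⟨j, hq, hw, ?_, h4⟩
    rcases hor with h | h
    · have e1 : j < 3 ^ j := Nat.lt_pow_self (by norm_num)
      have e2 : 3 ^ j < 2 ^ 3 ^ j := Nat.lt_two_pow_self
      have e3 := Nat.le_mul_self (2 ^ 3 ^ j)
      omega
    · exact h
  · rintro i hi t ht - ⟨j, hq, hw, hor, h4⟩
    have e1 : t.reg 1 = s.reg 1 := by rw [ht.1 1 (by decide), h1]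
    have e2 : t.reg 12 = X := by rw [ht.1 12 (by decide), h2]
    have m3 : min 3 (s.reg 1) = 3 := by omega
    have mw : min (2 ^ 3 ^ j) (s.reg 1) = 2 ^ 3 ^ j := by omega
    have e3 : (♯12 - ♯rW * ♯rW : Expr).eval t = X - 2 ^ 3 ^ j * 2 ^ 3 ^ j := by
      simp [e1, e2, hw, mw]
    rw [Stmt.eval_ite, e3]
    split_ifs with h
    · have hcube : 2 ^ 3 ^ (j + 1) = 2 ^ 3 ^ j * (2 ^ 3 ^ j * 2 ^ 3 ^ j) := by
        rw [pow_succ 3 j, pow_mul]; ring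
      refine ⟨j + 1, by simp [hq, e1, m3, pow_succ, mul_comm], by simp [hw, e1, mw, hcube], ?_, ?_⟩
      · rcases hor with h' | h'
        · exact Or.inl (by omega)
        · omega
      · have hlt : 2 ^ 3 ^ j * 2 ^ 3 ^ j ≤ X := by omega
        have hle : 2 ^ 3 ^ j ≤ X := (Nat.le_mul_self _).trans hlt
        rw [hcube]
        have := Nat.mul_le_mul hle hlt
        omega
    · exact ⟨j, hq, hw, Or.inr (by omega), h4⟩

theorem fieldPhase_spec (s : Config) {X τ n k b K N : ℕ} (hX : s.reg 12 = X)
    (hB : X * X + 4 ≤ s.reg 1) (hnX : n ≤ X) (hτ : s.reg rτ = τ) (hn : s.reg rn = n)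
    (hk : s.reg rk = k) (hb : s.reg rb = b) (hK : s.reg rK = K) (hN : s.reg rN = N) :
    ∃ j, X ≤ 2 ^ (2 * 3 ^ j) ∧ 2 ^ 3 ^ j ≤ X * X + 2 ∧ (fieldPhase.eval s).reg rm = 2 * 3 ^ j ∧
      (fieldPhase.eval s).reg rW = 2 ^ 3 ^ j ∧ (fieldPhase.eval s).reg rQ = 2 ^ (2 * 3 ^ j) ∧
      (fieldPhase.eval s).reg 99 = τ + n + k + b + K + N + 2 * 3 ^ j + 2 ^ (2 * 3 ^ j) + n * n +
        n * (n * N) + 8 := by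
  obtain ⟨j, hq, hw, hXw, hwX⟩ := fieldLoop_spec s hX hB
  have hf := fieldLoop.frame s
  have hQ : 2 ^ (2 * 3 ^ j) = 2 ^ 3 ^ j * 2 ^ 3 ^ j := by rw [two_mul, pow_add]
  simp only [fieldPhase, Stmt.eval_seq]
  set s3 := fieldLoop.eval s
  have e1 : s3.reg 1 = s.reg 1 := hf.1 1 (by decide)
  have e3 : s3.reg rτ = τ := by rw [hf.1 _ (by decide), hτ]
  have e4 : s3.reg rn = n := by rw [hf.1 _ (by decide), hn]
  have e5 : s3.reg rk = k := by rw [hf.1 _ (by decide), hk]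
  have e6 : s3.reg rb = b := by rw [hf.1 _ (by decide), hb]
  have e7 : s3.reg rK = K := by rw [hf.1 _ (by decide), hK]
  have e8 : s3.reg rN = N := by rw [hf.1 _ (by decide), hN]
  have hXX : X ≤ X * X := Nat.le_mul_self X
  have m2 : min 2 (s.reg 1) = 2 := by omega
  have mn : min n (s.reg 1) = n := by omega
  have mw : min (2 ^ 3 ^ j) (s.reg 1) = 2 ^ 3 ^ j := by omega
  refine ⟨j, by rwa [hQ], hwX, ?_, ?_, ?_, ?_⟩
  · simp [e1, hq, m2]
  · simp [hw]
  · simp [hw, e1, mw, hQ]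
  · simp [e1, e3, e4, e5, e6, e7, e8, hq, hw, m2, mn, mw, hQ]

/-- The statements of which the algorithm consists. -/
def algorithm (c : ℕ) : List Stmt := [readPhase c, colourPhase c, fieldPhase, mainPhase]

/-- The configuration in which `mainPhase` starts: the parameters stand in their registers, and no
coin has been tossed yet. -/
def preparedConfig (c : ℕ) (s : Config) : Config :=
  let t := evalPhases [readPhase c, colourPhase c, fieldPhase] s
  t.setReg 1 (t.reg 99)

theorem evalPhases_algorithm (c : ℕ) (s : Config) :
    evalPhases (algorithm c) s = mainPhase.eval (preparedConfig c s) := rfl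

/-- The parameters are as the analysis of the error probability demands them, and all bounds on the
loops are at most `M` if `M` exceeds the bounds that are expressed here through the input alone, where
`6 ℓ + 1` stands for the number of colours and for that of its bits, and `Q` for the size of the
field. -/
theorem preparedConfig_spec {c : ℕ} (hc : 0 < c) (s : Config) (hs : s.reg 99 = 0) :
    ∃ P : Params, P.Holds (preparedConfig c s) ∧ (preparedConfig c s).mem aIn = s.mem aIn ∧
      (preparedConfig c s).coins = s.coins ∧
      P.ℓ = s.mem aIn 0 ∧ P.τ = s.mem aIn 1 ∧ P.n = s.mem aIn 2 ∧ P.k = 2 ^ P.b ∧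
      3 * P.ℓ ≤ P.k ∧ (P.ℓ ≠ 0 → P.k ≤ 6 * P.ℓ) ∧ P.N = c * (P.τ + 1) * 18 ^ P.ℓ ∧
      c * (P.n + 1) * (P.τ + 1) ≤ P.Q ∧ (∃ j, P.q = 3 ^ j) ∧
      ∀ M, 6 * P.ℓ + P.τ + P.n + (c + 20) ≤ M →
        (c * (P.n + 1) * (P.τ + 1)) * (c * (P.n + 1) * (P.τ + 1)) + 4 ≤ M → 
        (∀ Q, Q ≤ ((c * (P.n + 1) * (P.τ + 1)) * (c * (P.n + 1) * (P.τ + 1)) + 2) ^ 2 → 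
          P.τ + P.n + (6 * P.ℓ + 1) + (6 * P.ℓ + 1) + 3 ^ (6 * P.ℓ + 1) + P.N + Q + Q + P.n * P.n +
            P.n * (P.n * P.N) + 8 ≤ M) →
        Bounded M (algorithm c) s := by
  set ℓ := s.mem aIn 0
  set τ := s.mem aIn 1
  set n := s.mem aIn 2
  set X := c * (n + 1) * (τ + 1) with hX
  set s0 := s.setReg 1 (s.reg 99) with hs0
  set s1 := (readPhase c).eval s0 with hs1
  have r2 : s1.reg rℓ = ℓ := by simp [hs1, hs0, readPhase, ℓ]
  have r3 : s1.reg rτ = τ := by simp [hs1, hs0, readPhase, τ]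
  have r4 : s1.reg rn = n := by simp [hs1, hs0, readPhase, n]
  have r99 : s1.reg 99 = 6 * ℓ + τ + n + (c + 20) := by
    simp [hs1, hs0, readPhase, n, ℓ, τ]; ring
  have hm1 : s1.mem aIn = s.mem aIn := rfl
  have hc1 : s1.coins = s.coins := Stmt.eval_coins _ (by simp [readPhase, Stmt.noFlip]) _
  set t1 := s1.setReg 1 (s1.reg 99) with ht1
  obtain ⟨b, h3, h6, h7, rb', rk', rK', rN', r12, r99'⟩ := colourPhase_spec (c := c) t1
    (by simpa [ht1] using r2) (by simpa [ht1] using r3) (by simpa [ht1] using r4)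
    (by simp [ht1, r99])
  have hf2 : Frame (colourPhase 0).regs [] t1 ((colourPhase c).eval t1) := (colourPhase c).frame t1
  have hc2 : ((colourPhase c).eval t1).coins = s.coins := by
    rw [Stmt.eval_coins (colourPhase c) (show (colourPhase 0).noFlip = true by decide), ht1,
      Config.setReg_coins, hc1]
  set s2 := (colourPhase c).eval t1
  rw [← hX] at r12 r99'
  set t2 := s2.setReg 1 (s2.reg 99) with ht2
  have e1 : t2.reg 1 = X * X + 4 := by simp [ht2, r99']
  have e2 : t2.reg rℓ = ℓ := by simp [ht2, hf2.1 rℓ (by decide), ht1, r2]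
  have e3 : t2.reg rτ = τ := by simp [ht2, hf2.1 rτ (by decide), ht1, r3]
  have e4 : t2.reg rn = n := by simp [ht2, hf2.1 rn (by decide), ht1, r4]
  have e5 : t2.reg rk = 2 ^ b := by simp [ht2, rk']
  have e6 : t2.reg rb = b := by simp [ht2, rb']
  have e7 : t2.reg rK = 3 ^ 2 ^ b := by simp [ht2, rK']
  have e8 : t2.reg rN = c * (τ + 1) * 18 ^ ℓ := by simp [ht2, rN']
  have e12 : t2.reg 12 = X := by simp [ht2, r12]
  have hnX : n ≤ X := by
    have h1 : 1 * (n + 1) * 1 ≤ c * (n + 1) * (τ + 1) :=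
      Nat.mul_le_mul (Nat.mul_le_mul hc le_rfl) (by omega)
    omega
  obtain ⟨N, hN⟩ : ∃ N, N = c * (τ + 1) * 18 ^ ℓ := ⟨_, rfl⟩
  rw [← hN] at e8
  obtain ⟨j, hXQ, hwX, rm', rW', rQ', r99''⟩ := fieldPhase_spec t2 e12 e1.ge hnX e3 e4 e5 e6 e7 e8
  have hf3 := fieldPhase.frame t2
  have hc3 : (fieldPhase.eval t2).coins = s.coins := by
    rw [Stmt.eval_coins fieldPhase (by decide), ht2, Config.setReg_coins, hc2]
  have hm3 : (fieldPhase.eval t2).mem aIn = s.mem aIn := by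
    rw [hf3.2 _ (by decide), ht2, Config.setReg_mem, hf2.2 _ (by decide), ht1, Config.setReg_mem, hm1]
  have hprep : preparedConfig c s = (fieldPhase.eval t2).setReg 1 ((fieldPhase.eval t2).reg 99) := rfl
  have hbd : ∀ M, s.reg 99 ≤ M → s1.reg 99 ≤ M → s2.reg 99 ≤ M → (fieldPhase.eval t2).reg 99 ≤ M →
      Bounded M (algorithm c) s := fun M h1 h2 h3 h4 => ⟨h1, h2, h3, h4, trivial⟩
  set s3 := fieldPhase.eval t2
  obtain ⟨B, hB⟩ : ∃ B, B = τ + n + 2 ^ b + b + 3 ^ 2 ^ b + N + 2 * 3 ^ j + 2 ^ (2 * 3 ^ j) + n * n +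
    n * (n * N) + 8 := ⟨_, rfl⟩
  rw [← hB] at r99''
  have hqQ : 2 * 3 ^ j < 2 ^ (2 * 3 ^ j) := Nat.lt_two_pow_self
  have hbk : b < 2 ^ b := Nat.lt_two_pow_self
  have hnn : n * n * N = n * (n * N) := by ring
  have hreg : ∀ r, r ≠ 1 → (preparedConfig c s).reg r = s3.reg r := by
    intro r hr; rw [hprep, Config.setReg_reg, if_neg hr]
  obtain ⟨P, pℓ, pτ, pn, pk, pb, pN, pq, pB⟩ : ∃ P : Params, P.ℓ = ℓ ∧ P.τ = τ ∧ P.n = n ∧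
    P.k = 2 ^ b ∧ P.b = b ∧ P.N = N ∧ P.q = 3 ^ j ∧ P.B = B :=
    ⟨⟨ℓ, τ, n, 2 ^ b, b, N, 3 ^ j, B⟩, rfl, rfl, rfl, rfl, rfl, rfl, rfl, rfl⟩
  have pQ : P.Q = 2 ^ (2 * 3 ^ j) := by rw [Params.Q, pq]
  have pK : P.K = 3 ^ 2 ^ b := by rw [Params.K, pk]
  have pw : P.w = 2 ^ 3 ^ j := by rw [Params.w, pq]
  refine ⟨P, ⟨?_, ?_, ?_, ?_, ?_, ?_, ?_, ?_, ?_, ?_, ?_, ?_, ?_, ?_, ?_,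
    ?_, ?_, ?_, ?_, ?_, ?_, ?_⟩, ?_, ?_, pℓ, pτ, pn, by rw [pk, pb], ?_, ?_, ?_, ?_, ⟨j, pq⟩, ?_⟩
  · rw [hprep, r99'', pB]; simp
  · rw [hreg _ (by norm_num), hf3.1 _ (by decide), e2, pℓ]
  · rw [hreg _ (by norm_num), hf3.1 _ (by decide), e3, pτ]
  · rw [hreg _ (by norm_num), hf3.1 _ (by decide), e4, pn]
  · rw [hreg _ (by norm_num), hf3.1 _ (by decide), e5, pk]
  · rw [hreg _ (by norm_num), hf3.1 _ (by decide), e6, pb]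
  · rw [hreg _ (by norm_num), hf3.1 _ (by decide), e7, pK]
  · rw [hreg _ (by norm_num), hf3.1 _ (by decide), e8, pN]
  · rw [hreg _ (by norm_num), rW', pw]
  · rw [hreg _ (by norm_num), rm', pq]
  · rw [hreg _ (by norm_num), rQ', pQ]
  · omega
  · omega
  · omega
  · omega
  · omega
  · omega
  · omega
  · rw [pq, pB]; omega
  · omega
  · rw [pn, pB]; omega
  · rw [pn, pN, pB]; omega
  · rw [hprep, Config.setReg_mem, hm3]
  · rw [hprep, Config.setReg_coins, hc3]
  · rw [pℓ, pk]; exact h3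
  · rw [pℓ, pk]; exact h6
  · rw [pN, pτ, pℓ]; exact hN
  · rw [pn, pτ, pQ]; exact hXQ
  · intro M hM1 hM2 hM3
    rw [pℓ, pτ, pn] at hM1
    rw [pn, pτ, ← hX] at hM2
    rw [pℓ, pτ, pn, pN, ← hX] at hM3
    refine hbd M (by omega) (r99.le.trans hM1) (r99'.le.trans hM2)
      (r99''.le.trans (le_trans ?_ (hM3 (2 ^ (2 * 3 ^ j)) ?_)))
    · have : 3 ^ 2 ^ b ≤ 3 ^ (6 * ℓ + 1) := Nat.pow_le_pow_right (by norm_num) h7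
      omega
    · rw [mul_comm, pow_mul]
      exact Nat.pow_le_pow_left hwX 2

/-! ### The encoding of the input -/

theorem getD_flatten_ofFn {L d : ℕ} {τ : ℕ} (f : Fin τ → List ℕ) (hf : ∀ i, (f i).length = L)
    (i : Fin τ) {r : ℕ} (hr : r < L) (rest : List ℕ) :
    ((List.ofFn f).flatten ++ rest).getD (L * i + r) d = (f i).getD r d := by
  induction τ with
  | zero => exact i.elim0
  | succ τ ih =>
    rw [List.ofFn_succ, List.flatten_cons, List.append_assoc]
    induction i using Fin.cases with
    | zero =>
      rw [List.getD_append _ _ _ _ (by rw [hf]; simpa using hr)]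
      simp
    | succ i =>
      rw [List.getD_append_right _ _ _ _ (by rw [hf, Fin.val_succ]; nlinarith), hf]
      rw [← ih (fun i => f i.succ) (fun i => hf _) i]
      congr 1
      rw [Fin.val_succ, mul_add]; omega

theorem length_flatten_ofFn {L τ : ℕ} (f : Fin τ → List ℕ) (hf : ∀ i, (f i).length = L) :
    (List.ofFn f).flatten.length = τ * L := by
  rw [List.length_flatten, List.map_ofFn, List.sum_ofFn]
  simp [hf]

theorem length_graphCode {n : ℕ} (G : Graph n) : (graphCode G).length = 1 + n + n * n := by
  rw [graphCode, List.length_cons, List.length_append, List.length_ofFn,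
    length_flatten_ofFn (L := n) _ fun i => List.length_ofFn]
  ring

theorem graphAt_graphCode {n : ℕ} (G : Graph n) : GraphAt G (fun r => (graphCode G).getD r 0) 0 := by
  classical
  refine ⟨fun v => ?_, fun x y => ?_⟩
  · simp only [graphCode]
    rw [show 0 + 1 + (v : ℕ) = v + 1 by omega, List.getD_cons_succ,
      List.getD_append _ _ _ _ (by simp), List.getD_eq_getElem _ _ (by simp)]
    simp
  · simp only [graphCode]
    rw [show 0 + 1 + n + (n * (x : ℕ) + y) = n + (n * (x : ℕ) + y) + 1 by omega, List.getD_cons_succ,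
      List.getD_append_right _ _ _ _ (by simp), List.length_ofFn, Nat.add_sub_cancel_left]
    have := getD_flatten_ofFn (L := n) (d := 0) (fun u : Fin n => List.ofFn fun v : Fin n =>
      if G.Adj u v then 1 else 0) (fun i => List.length_ofFn) x y.2 []
    rw [List.append_nil] at this
    rw [this, List.getD_eq_getElem _ _ (by simp)]
    simp

theorem Instance.getD_code (J : Instance) {i : ℕ} (hi : i < J.τ) {r : ℕ}
    (hr : r < 1 + J.n + J.n * J.n) :
    J.code.getD (2 + i * (1 + J.n + J.n * J.n) + r) 0 = (graphCode (J.graph i)).getD r 0 := by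
  have := getD_flatten_ofFn (L := 1 + J.n + J.n * J.n) (d := 0) (fun i => graphCode (J.G i))
    (fun i => length_graphCode _) ⟨i, hi⟩ hr []
  rw [List.append_nil] at this
  rw [Instance.code, show 2 + i * (1 + J.n + J.n * J.n) + r =
    (1 + J.n + J.n * J.n) * i + r + 1 + 1 by ring, List.getD_cons_succ, List.getD_cons_succ, this,
    Instance.graph, dif_pos hi]

theorem Instance.graphAt (J : Instance) {i : ℕ} (hi : i < J.τ) :
    GraphAt (J.graph i) (fun r => J.code.getD r 0) (2 + i * (1 + J.n + J.n * J.n)) := by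
  obtain ⟨h1, h2⟩ := graphAt_graphCode (J.graph i)
  refine ⟨fun v => ?_, fun x y => ?_⟩
  · rw [← h1 v]
    simp only
    rw [add_assoc, J.getD_code hi (by omega), zero_add]
  · have := mul_add_lt x.2 y.2
    rw [← h2 x y]
    simp only
    rw [show 2 + i * (1 + J.n + J.n * J.n) + 1 + J.n + (J.n * (x : ℕ) + y) =
      2 + i * (1 + J.n + J.n * J.n) + (1 + J.n + (J.n * (x : ℕ) + y)) by ring,
      J.getD_code hi (by omega)]

theorem Instance.getD_code_two (J : Instance) (hτ : 0 < J.τ) : J.code.getD 2 0 = J.n := by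
  have := J.getD_code hτ (r := 0) (by omega)
  simpa [graphCode] using this

theorem Instance.le_size (J : Instance) : 2 + J.τ * (1 + J.n + J.n * J.n) ≤ J.size := by
  have h1 : J.code.length = 2 + J.τ * (1 + J.n + J.n * J.n) := by
    rw [Instance.code, List.length_cons, List.length_cons,
      length_flatten_ofFn _ fun i => length_graphCode _]
    ring
  rw [← h1, Instance.size, inputSize]
  generalize J.code = x
  induction x with
  | nil => simp
  | cons a x ih => simp only [List.length_cons, List.map_cons, List.sum_cons]; omega

/-! ### Running time and error probability -/

/-- All bounds on loops are at most the twelfth power of `(c + 20) 2 ^ ℓ S`, where `S` is the size of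
the instance. -/
theorem bound_le {c ℓ τ n N S Z : ℕ} (hZ : Z = (c + 20) * 2 ^ ℓ * S) (hτ : τ + 1 ≤ S) (hn : n + 1 ≤ S)
    (hN : N = c * (τ + 1) * 18 ^ ℓ) :
    6 * ℓ + τ + n + (c + 20) ≤ Z ^ 12 ∧
    (c * (n + 1) * (τ + 1)) * (c * (n + 1) * (τ + 1)) + 4 ≤ Z ^ 12 ∧
    ∀ Q, Q ≤ ((c * (n + 1) * (τ + 1)) * (c * (n + 1) * (τ + 1)) + 2) ^ 2 →
      τ + n + (6 * ℓ + 1) + (6 * ℓ + 1) + 3 ^ (6 * ℓ + 1) + N + Q + Q + n * n + n * (n * N) + 8 ≤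
        Z ^ 12 := by
  have hp : 1 ≤ 2 ^ ℓ := Nat.one_le_two_pow
  have hS : 1 ≤ S := by omega
  have hlp : ℓ + 1 ≤ 2 ^ ℓ := Nat.lt_two_pow_self
  have h20 : 20 ≤ Z := by rw [hZ]; nlinarith [Nat.mul_le_mul hp hS]
  have hSZ : S ≤ Z := by
    rw [hZ]; exact Nat.le_mul_of_pos_left _ (by positivity)
  have hpZ : 2 ^ ℓ ≤ Z := by
    rw [hZ, mul_assoc, mul_comm, mul_assoc]
    exact Nat.le_mul_of_pos_right _ (by positivity)
  have hℓZ : 20 * ℓ + 20 ≤ Z := by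
    calc 20 * ℓ + 20 = 20 * (ℓ + 1) * 1 := by ring
      _ ≤ (c + 20) * 2 ^ ℓ * S := Nat.mul_le_mul (Nat.mul_le_mul (by omega) hlp) hS
      _ = Z := hZ.symm
  have hcZ : c + 20 ≤ Z := by
    calc c + 20 = (c + 20) * 1 * 1 := by ring
      _ ≤ (c + 20) * 2 ^ ℓ * S := Nat.mul_le_mul (Nat.mul_le_mul le_rfl hp) hS
      _ = Z := hZ.symm
  have hcS : ∀ m, m ≤ S → c * m ≤ Z := by
    intro m hm
    calc c * m = c * 1 * m := by ring
      _ ≤ (c + 20) * 2 ^ ℓ * S := Nat.mul_le_mul (Nat.mul_le_mul (by omega) hp) hm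
      _ = Z := hZ.symm
  have hX : c * (n + 1) * (τ + 1) ≤ Z ^ 2 := by
    rw [pow_two]; exact Nat.mul_le_mul (hcS _ hn) (hτ.trans hSZ)
  have hmono : ∀ {a b : ℕ}, a ≤ b → Z ^ a ≤ Z ^ b := fun h => Nat.pow_le_pow_right (by omega) h
  have hstep : ∀ {a : ℕ}, 20 * Z ^ a ≤ Z ^ (a + 1) := by
    intro a; rw [pow_succ, mul_comm]; exact Nat.mul_le_mul_left _ h20
  have hZ1 : Z ≤ Z ^ 11 := by simpa using hmono (show 1 ≤ 11 by norm_num)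
  have h11 : 20 * Z ^ 11 ≤ Z ^ 12 := hstep
  generalize c * (n + 1) * (τ + 1) = X at *
  have hXX : X * X ≤ Z ^ 4 := by
    calc _ ≤ Z ^ 2 * Z ^ 2 := Nat.mul_le_mul hX hX
      _ = Z ^ 4 := by ring
  have hXX' : X * X + 4 ≤ Z ^ 5 := by
    have h4 : 20 * Z ^ 4 ≤ Z ^ 5 := hstep
    have h5 : 1 ≤ Z ^ 4 := Nat.one_le_pow _ _ (by omega)
    omega
  have hN' : N ≤ Z ^ 6 := by
    rw [hN]
    calc _ ≤ Z * Z ^ 5 := Nat.mul_le_mul (hcS _ hτ) ?_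
      _ = Z ^ 6 := by ring
    calc 18 ^ ℓ ≤ 32 ^ ℓ := Nat.pow_le_pow_left (by norm_num) _
      _ = (2 ^ ℓ) ^ 5 := by rw [← pow_mul, mul_comm, pow_mul]; norm_num
      _ ≤ Z ^ 5 := Nat.pow_le_pow_left hpZ _
  have hK : 3 ^ (6 * ℓ + 1) ≤ Z ^ 11 := by
    calc 3 ^ (6 * ℓ + 1) = 3 * 729 ^ ℓ := by rw [pow_succ, pow_mul]; norm_num [mul_comm]
      _ ≤ 3 * 1024 ^ ℓ := Nat.mul_le_mul_left _ (Nat.pow_le_pow_left (by norm_num) _)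
      _ = 3 * (2 ^ ℓ) ^ 10 := by rw [← pow_mul, mul_comm ℓ, pow_mul]; norm_num
      _ ≤ 20 * Z ^ 10 := Nat.mul_le_mul (by norm_num) (Nat.pow_le_pow_left hpZ _)
      _ ≤ Z ^ 11 := hstep
  have hnZ : n ≤ Z := by omega
  have hnn : n * n ≤ Z ^ 11 := by
    calc n * n ≤ Z * Z := Nat.mul_le_mul hnZ hnZ
      _ = Z ^ 2 := by ring
      _ ≤ Z ^ 11 := hmono (by norm_num)
  have hnnN : n * (n * N) ≤ Z ^ 11 := by
    calc n * (n * N) ≤ Z * (Z * Z ^ 6) := Nat.mul_le_mul hnZ (Nat.mul_le_mul hnZ hN')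
      _ = Z ^ 8 := by ring
      _ ≤ Z ^ 11 := hmono (by norm_num)
  have hN'' : N ≤ Z ^ 11 := hN'.trans (hmono (by norm_num))
  refine ⟨by omega, ?_, fun Q hQ => ?_⟩
  · exact hXX'.trans (hmono (by norm_num))
  · have hQ' : Q ≤ Z ^ 11 := by
      calc Q ≤ _ := hQ
        _ ≤ (Z ^ 5) ^ 2 := Nat.pow_le_pow_left (by omega) _
        _ = Z ^ 10 := by ring
        _ ≤ Z ^ 11 := hmono (by norm_num)
    omega

/-- Random numbers yield uniformly distributed colourings and weights. -/
theorem bijective_colours_weights {F : Type} [Field F] {g : F} {n N b q : ℕ}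
    (hF : FieldCode F g q) :
    Function.Bijective fun d : (Fin (N * (n * n)) → Fin (2 ^ b)) × (Fin (n * n) → Fin (2 ^ (2 * q))) =>
      (coloursOf (n := n) rfl d.1, weightsOf g d.2) := by
  have h1 : Function.Bijective (coloursOf (n := n) (N := N) (b := b) rfl) := by
    constructor
    · intro d d' h
      funext i
      obtain ⟨⟨a, e⟩, rfl⟩ := finProdFinEquiv.surjective i
      obtain ⟨e, rfl⟩ := finProdFinEquiv.surjective e
      exact congrFun (congrFun h a) e
    · intro χ
      refine ⟨fun i => χ (finProdFinEquiv.symm i).1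
        (finProdFinEquiv.symm (finProdFinEquiv.symm i).2), ?_⟩
      funext a e
      simp [coloursOf]
  have h2 : Function.Bijective (weightsOf g (n := n) (m := 2 * q)) := by
    constructor
    · intro d d' h
      funext i
      exact hF.bij.1 (congrFun h i)
    · intro ρ
      choose d hd using fun i => hF.bij.2 (ρ i)
      exact ⟨d, funext hd⟩
  exact h1.prodMap h2

/-- The parameters do not depend on the coin tosses. -/
theorem preparedConfig_withCoins (c : ℕ) (s : Config) (ω : ℕ → Bool) :
    preparedConfig c (s.withCoins ω) = (preparedConfig c s).withCoins ω := by
  have h1 : (readPhase c).noFlip := show (readPhase 0).noFlip = true by decide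
  have h2 : (colourPhase c).noFlip := show (colourPhase 0).noFlip = true by decide
  have h3 : fieldPhase.noFlip := by decide
  have hset : ∀ (s : Config) r x, (s.withCoins ω).setReg r x = (s.setReg r x).withCoins ω :=
    fun _ _ _ => rfl
  have hreg : ∀ (s : Config) r, (s.withCoins ω).reg r = s.reg r := fun _ _ => rfl
  simp only [preparedConfig, evalPhases, hset, hreg, Stmt.eval_withCoins _ h1,
    Stmt.eval_withCoins _ h2, Stmt.eval_withCoins _ h3]

/-- Running time and error probability of the algorithm with the parameter `c`, given the constants
of `phases_spec`, for an instance whose value of `n` can be read off from its code. -/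
theorem algorithm_correct {c : ℕ} (hc : 0 < c) {C d : ℕ}
    (hC : ∀ (M : ℕ) (s σ : Config), Sim s σ → Bounded M (algorithm c) σ →
      ∃ t ≤ C * (M + 1) ^ d, ∃ s', Runs (phases (algorithm c)) s t s' ∧
        Sim s' (evalPhases (algorithm c) σ))
    (J : Instance) (hJ : J.code.getD 2 0 = J.n) (hn : J.n + 1 ≤ J.size) (hτ : J.τ + 1 ≤ J.size) :
    (∀ ω, HaltsWithin (phases (algorithm c)) J.code ω
      (C * (((c + 20) * 2 ^ J.ℓ * J.size) ^ 12 + 1) ^ d)) ∧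
    1 - 2 / (c : ℝ) ≤ fairCoins.real
      {ω | Outputs (phases (algorithm c)) J.code ω (open Classical in if J.IsYes then 1 else 0)} := by
  classical
  have hmem : ∀ ω, (initial J.code ω).mem aIn = fun r => J.code.getD r 0 := by
    intro ω; funext r; simp [initial]
  have e0 : J.code.getD 0 0 = J.ℓ := rfl
  have e1 : J.code.getD 1 0 = J.τ := rfl
  have hBd : ∀ ω, Bounded (((c + 20) * 2 ^ J.ℓ * J.size) ^ 12) (algorithm c) (initial J.code ω) := by
    intro ω
    obtain ⟨P, -, -, -, pℓ, pτ, pn, -, -, -, pN, -, -, hB⟩ :=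
      preparedConfig_spec hc (initial J.code ω) rfl
    rw [hmem] at pℓ pτ pn
    simp only [e0, e1, hJ] at pℓ pτ pn
    rw [pℓ, pτ] at pN
    obtain ⟨b1, b2, b3⟩ := bound_le rfl hτ hn pN
    rw [pℓ, pτ, pn] at hB
    exact hB _ b1 b2 b3
  obtain ⟨P, hP, hin, -, pℓ, pτ, pn, pk, h3, h6, pN, hQ, ⟨j, pq⟩, -⟩ :=
    preparedConfig_spec hc (initial J.code fun _ => false) rfl
  rw [hmem] at pℓ pτ pn hin
  simp only [e0, e1, hJ] at pℓ pτ pn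
  obtain ⟨ℓ, τ, n, k, b, N, q, B⟩ := P
  simp only at pℓ pτ pn pk h3 h6 pN hQ pq
  subst pℓ pτ pn pk pq
  obtain ⟨F, hFf, hFt, g, hchar, hrel, hbij⟩ := exists_field j
  have hF : FieldCode F g (3 ^ j) := ⟨hchar, by positivity, hrel, hbij⟩
  -- the answer as a function of the random choices
  set D := (Fin (N * (J.n * J.n)) → Fin (2 ^ b)) × (Fin (J.n * J.n) → Fin (2 ^ (2 * 3 ^ j)))
  set Good : (Fin N → Fin J.n × Fin J.n → Fin (2 ^ b)) × (Fin (J.n * J.n) → F) → Prop := fun x =>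
    ∃ a v, Reachable (g ^ 3 ^ j) J.graph J.ℓ (fun e => x.2 (finProdFinEquiv e)) x.1 J.τ a v with hGood
  set Φ : D → (Fin N → Fin J.n × Fin J.n → Fin (2 ^ b)) × (Fin (J.n * J.n) → F) := fun d =>
    (coloursOf (n := J.n) rfl d.1, weightsOf g d.2) with hΦ
  have hΦb : Function.Bijective Φ := bijective_colours_weights hF
  have hrun : ∀ ω, ∃ t ≤ C * (((c + 20) * 2 ^ J.ℓ * J.size) ^ 12 + 1) ^ d, ∃ s',
      Runs (phases (algorithm c)) (initial J.code ω) t s' ∧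
      s'.reg 0 = if Good (Φ (draw (N * (J.n * J.n)) b (J.n * J.n) (2 * 3 ^ j) ω)) then 1 else 0 := by
    intro ω
    obtain ⟨t, ht, s', hr, hs⟩ := hC _ _ _ (Sim.refl _) (hBd ω)
    refine ⟨t, ht, s', hr, ?_⟩
    have hprep : preparedConfig c (initial J.code ω) =
        (preparedConfig c (initial J.code fun _ => false)).withCoins ω :=
      preparedConfig_withCoins c (initial J.code fun _ => false) ω
    rw [hs.2.2 0 (by norm_num), evalPhases_algorithm, hprep]
    generalize preparedConfig c (initial J.code fun _ => false) = s₀ at hP hin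
    have hP' := hP.frame (R := []) (A := []) (s' := s₀.withCoins ω)
      ⟨fun _ _ => rfl, fun _ _ => rfl⟩ (by simp)
    exact mainPhase_spec (P := ⟨J.ℓ, J.τ, J.n, 2 ^ b, b, N, 3 ^ j, B⟩) hF hP' hin rfl
      (fun i hi => J.graphAt hi)
  refine ⟨fun ω => ?_, ?_⟩
  · obtain ⟨t, ht, s', hr, -⟩ := hrun ω
    exact ⟨t, ht, s', hr⟩
  have := hFt
  have hcardF : Fintype.card F = 2 ^ (2 * 3 ^ j) := by
    rw [← Fintype.card_of_bijective hbij, Fintype.card_fin]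
  have hcount := card_correct_ge J hF.omega hc h3 h6 pN (by rw [hcardF]; exact hQ)
  have hdraw := draw_uniform (N * (J.n * J.n)) b (J.n * J.n) (2 * 3 ^ j)
    (Finset.univ.filter fun d => J.IsYes ↔ Good (Φ d))
  have hcard : (Finset.univ.filter fun d => J.IsYes ↔ Good (Φ d)).card =
      (Finset.univ.filter fun x => J.IsYes ↔ Good x).card := by
    refine Finset.card_bijective Φ hΦb fun d => ?_
    simp
  rw [hcard, Fintype.card_of_bijective hΦb] at hdraw
  have hpos : (0 : ℝ) < Fintype.card
      ((Fin N → Fin J.n × Fin J.n → Fin (2 ^ b)) × (Fin (J.n * J.n) → F)) := by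
    have : 0 < Fintype.card D := Fintype.card_pos
    rw [Fintype.card_of_bijective hΦb] at this
    exact_mod_cast this
  calc 1 - 2 / (c : ℝ) ≤ _ := (le_div_iff₀ hpos).2 hcount
    _ = _ := hdraw.symm
    _ ≤ _ := by
      refine MeasureTheory.measureReal_mono (fun ω hω => ?_) (MeasureTheory.measure_ne_top _ _)
      obtain ⟨t, -, s', hr, hs⟩ := hrun ω
      refine ⟨t, s', hr, ?_⟩
      have hiff : J.IsYes ↔ Good (Φ (draw (N * (J.n * J.n)) b (J.n * J.n) (2 * 3 ^ j) ω)) := by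
        simpa using hω
      rw [hs]
      simp only [hiff]

/-- Diverse Multistage Perfect Matching can be solved with error probability `ε`: take `c ≥ 2 / ε`. -/
theorem exists_program (ε : ℝ) (hε : 0 < ε) :
    ∃ (p : Program) (C c d : ℕ),
      Solves p Instance.code Instance.IsYes (fun J => C * 2 ^ (c * J.ℓ) * J.size ^ d) ε := by
  classical
  obtain ⟨c, hc⟩ := exists_nat_gt (2 / ε)
  have hc0 : (0 : ℝ) < c := lt_trans (by positivity) hc
  have hcε : 2 / (c : ℝ) ≤ ε := by
    rw [div_le_iff₀ hc0]
    rw [div_lt_iff₀ hε] at hc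
    linarith
  have hWF : ∀ p ∈ algorithm c, p.WF := by
    have h1 : (readPhase c).WF := show (readPhase 0).WF = true by decide
    have h2 : (colourPhase c).WF := show (colourPhase 0).WF = true by decide
    have h3 : fieldPhase.WF := by decide
    have h4 : mainPhase.WF := by decide
    simp [algorithm, h1, h2, h3, h4]
  obtain ⟨C, d, hC⟩ := phases_spec (algorithm c) hWF
  refine ⟨phases (algorithm c), C * 2 ^ d * (c + 20) ^ (12 * d), 12 * d, 12 * d, fun J => ?_⟩
  -- an instance with no graphs may be regarded as one with `n = 0`, which is what the machine reads
  obtain ⟨J', hcode, hℓ, hyes, hJ', hn, hτ⟩ : ∃ J' : Instance, J'.code = J.code ∧ J'.ℓ = J.ℓ ∧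
      (J'.IsYes ↔ J.IsYes) ∧ J'.code.getD 2 0 = J'.n ∧ J'.n + 1 ≤ J'.size ∧ J'.τ + 1 ≤ J'.size := by
    have hsize := J.le_size
    rcases Nat.eq_zero_or_pos J.τ with h0 | h0
    · obtain ⟨n, τ, ℓ, G⟩ := J
      simp only at h0
      subst h0
      have hc : (⟨0, 0, ℓ, fun i => i.elim0⟩ : Instance).code = (⟨n, 0, ℓ, G⟩ : Instance).code := by
        simp [Instance.code]
      have hyes : ∀ J : Instance, J.τ = 0 → J.IsYes := by
        rintro ⟨n, τ, ℓ, G⟩ h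
        simp only at h
        subst h
        exact ⟨fun i => i.elim0, fun i => i.elim0, fun i => i.elim0⟩
      have hs := (⟨0, 0, ℓ, fun i => i.elim0⟩ : Instance).le_size
      simp only at hs
      refine ⟨⟨0, 0, ℓ, fun i => i.elim0⟩, hc, rfl, iff_of_true (hyes _ rfl) (hyes _ rfl), ?_, ?_, ?_⟩
      · simp [Instance.code]
      · simp only; omega
      · simp only; omega
    · have h1 : 1 * (1 + J.n + J.n * J.n) ≤ J.τ * (1 + J.n + J.n * J.n) :=
        Nat.mul_le_mul_right _ h0
      have h2 : J.τ * 1 ≤ J.τ * (1 + J.n + J.n * J.n) := Nat.mul_le_mul_left _ (by omega)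
      exact ⟨J, rfl, rfl, Iff.rfl, J.getD_code_two h0, by omega, by omega⟩
  obtain ⟨h1, h2⟩ := algorithm_correct (by exact_mod_cast hc0) hC J' hJ' hn hτ
  have hsz : J'.size = J.size := by rw [Instance.size, Instance.size, hcode]
  have hpos : 1 ≤ ((c + 20) * 2 ^ J.ℓ * J.size) ^ 12 := by
    have := J.le_size
    exact Nat.one_le_pow _ _ (Nat.mul_pos (by positivity) (by omega))
  rw [hℓ, hsz, hcode] at h1
  rw [hcode] at h2
  refine ⟨fun ω => ?_, ?_⟩
  · obtain ⟨t, ht, hr⟩ := h1 ω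
    refine ⟨t, ht.trans ?_, hr⟩
    calc C * (((c + 20) * 2 ^ J.ℓ * J.size) ^ 12 + 1) ^ d
        ≤ C * (2 * ((c + 20) * 2 ^ J.ℓ * J.size) ^ 12) ^ d :=
          Nat.mul_le_mul_left _ (Nat.pow_le_pow_left (by omega) _)
      _ = C * 2 ^ d * (c + 20) ^ (12 * d) * 2 ^ (12 * d * J.ℓ) * J.size ^ (12 * d) := by
          rw [mul_comm (12 * d) J.ℓ, pow_mul 2 J.ℓ]
          simp only [mul_pow, ← pow_mul]
          ring
  · simp only [hyes] at h2
    refine le_trans (by linarith) h2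

end DiverseMatching

theorem mainTheorem2 (ε : ℝ) (hε : 0 < ε) :
    ∃ (p : RandRAM.Program) (C c d : ℕ),
      RandRAM.Solves p DiverseMatching.Instance.code DiverseMatching.Instance.IsYes
        (fun J => C * 2 ^ (c * J.ℓ) * J.size ^ d) ε :=
  DiverseMatching.exists_program ε hε
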